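/- **Setting.** Let $V=(V^j)_{j\in\mathbb Z}$ be a family of real vector spaces and let $n\in\mathbb Z$. For a pointed simplicial set $K$ let $C(K)$ be its reduced (unnormalized) chain complex, $C(K)_i=\mathbb Z K_i/\mathbb Z\mathrm{pt}$ with $\partial=\sum_a(-1)^a d_a$. Put $$C^n(K;V)=\prod_{i+j=n,\ i\ge 0}\operatorname{Hom}(C(K)_i,V^j),\qquad \delta u=u\circ\partial,$$ let $Z^n(K;V)=\prod_{i+j=n}Z^i(K;V^j)$ be the cocycles in it and $H^n(K;V)=\prod_{i+j=n}H^i(K;V^j)$ the reduced cohomology (cocycles modulo coboundaries). For fixed $V$ write $Z^n(K)=Z^n(K;V)$. Let $EZ\colon C(K)\otimes C(L)\to C(K\wedge L)$ be the Eilenberg–Zilber (shuffle) map. For a chain $e\in C(L)_k$ and $u\in C^n(K\wedge L;V)$ the slant product $u/e\in C^{n-k}(K;V)$ is $(u/e)(d)=u(EZ(d\otimes e))$. Let $S^1=\Delta^1/\partial\Delta^1$, and let $[S^1]\in C(S^1)_1$ and $[\Delta^k_+]\in C(\Delta^k_+)_k$ be the generators given by the nondegenerate top-dimensional simplices. The $n$-th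 space of the cocycle spectrum is the simplicial vector space $Z^n(K\wedge\Delta^\bullet_+)$, pointed by $0$. With $(\Omega L)_k=\operatorname{Hom}_*(\Delta^k_+\wedge S^1,L)$ there is a canonical isomorphism $\Omega Z^n(K\wedge\Delta^\bullet_+)\cong Z^n(K\wedge\Delta^\bullet_+\wedge S^1)$, and the costructure map is $$\psi\colon \Omega Z^n(K\wedge\Delta^\bullet_+)\cong Z^n(K\wedge\Delta^\bullet_+\wedge S^1)\longrightarrow Z^{n-1}(K\wedge\Delta^\bullet_+),\qquad \psi(f)(c)=f(EZ(c\otimes[S^1])).$$ **Proposition.** 1. $\psi$ is natural in the pointed simplicial set $K$. 2. For every $K$, $\psi$ is a weak equivalence of simplicial sets; more precisely, source and target are Kan complexes, and $\psi$ induces a bijection on $\pi_0$ and on $\pi_k$ for all $k\ge1$ and all base vertices. 3. For every $K$ and $m\in\mathbb Z$ the slant product $u\mapsto u/[S^1]$ induces an isomorphism $\sigma\colon H^m(K\wedge S^1;V)\to H^{m-1}(K;V)$. This is the suspension isomorphism of the cofibre sequence $K\to K\wedge\Delta^1\to K\wedge S^1$ (with $\Delta^1$ pointed by the vertex $0$ and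 $K$ included at the vertex $1$), up to the sign $(-1)^i$ on the component of cochain degree $i$: $\sigma(x)=y$ if and only if there are a cocycle $u$ representing $x$ and a cochain $g$ on $K\wedge\Delta^1$ such that $\delta g$ is the pullback of $u$ and the cochain with components $(-1)^i(g|_K)_i$ is a cocycle representing $y$. 4. For every $K$ and $k\ge0$, $\psi$ corresponds to $\sigma$ on homotopy groups at the base point $0$. The slant products with $[\Delta^k_+]$ induce isomorphisms (bijections for $k=0$, group isomorphisms for $k\ge1$) $$A\colon \pi_k\,Z^n(K\wedge\Delta^\bullet_+\wedge S^1)\cong H^{n-k}(K\wedge S^1;V),\qquad B\colon \pi_k\,Z^{n-1}(K\wedge\Delta^\bullet_+)\cong H^{n-k-1}(K;V),$$ where for $A$ the factors $\Delta^k_+$ and $S^1$ are interchanged before slanting. These hold both for the slant product as above, with $[\Delta^k_+]$ behind, $f\mapsto f/[\Delta^k_+]$, and for its variant with $[\Delta^k_+]$ in front, $f\mapsto\bigl(\sigma'\mapsto f(EZ([\Delta^k_+]\otimes\sigma'))\bigr)$ (where the factor $\Delta^k_+$ is moved to the front). With $[\Delta^k_+]$ in front, $$B\circ\pi_k(\psi)=\sigma\circ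 A ,$$ and with $[\Delta^k_+]$ behind, $B\circ\pi_k(\psi)=(-1)^k\,\sigma\circ A$. -/

import Mathlib

open CategoryTheory Simplicial Opposite

universe u

namespace CocycleSpectrum

/-! ### Pointed simplicial sets -/

/-- The category of pointed simplicial sets. -/
abbrev PSSet : Type (u + 1) := SimplicialObject Pointed.{u}

/-- Two pairs are identified in the smash product if both lie in the wedge. -/
def smashRel (P Q : Pointed.{u}) (a b : P.X × Q.X) : Prop :=
  (a.1 = P.point ∨ a.2 = Q.point) ∧ (b.1 = P.point ∨ b.2 = Q.point)

/-- The smash product `P ∧ Q = (P × Q) / (P ∨ Q)` of pointed sets. -/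
def smashPt (P Q : Pointed.{u}) : Pointed.{u} :=
  ⟨Quot (smashRel P Q), Quot.mk _ (P.point, Q.point)⟩

/-- The point `x ∧ y` of `P ∧ Q`. -/
def smk {P Q : Pointed.{u}} (x : P.X) (y : Q.X) : (smashPt P Q).X := Quot.mk _ (x, y)

lemma smk_left {P Q : Pointed.{u}} (y : Q.X) :
    smk P.point y = (smashPt P Q).point :=
  Quot.sound ⟨Or.inl rfl, Or.inl rfl⟩

lemma smk_right {P Q : Pointed.{u}} (x : P.X) :
    smk x Q.point = (smashPt P Q).point :=
  Quot.sound ⟨Or.inr rfl, Or.inl rfl⟩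

lemma smash_ind {P Q : Pointed.{u}} {p : (smashPt P Q).X → Prop}
    (h : ∀ x y, p (smk x y)) (z : (smashPt P Q).X) : p z := by
  obtain ⟨⟨x, y⟩, rfl⟩ := Quot.exists_rep z
  exact h x y

/-- A map out of `P ∧ Q` from a map of two variables that collapses the wedge. -/
def smashLift {P Q : Pointed.{u}} {A : Type*} (f : P.X → Q.X → A) (a : A)
    (h₁ : ∀ y, f P.point y = a) (h₂ : ∀ x, f x Q.point = a) : (smashPt P Q).X → A :=
  Quot.lift (fun p => f p.1 p.2) (by
    rintro ⟨x, y⟩ ⟨x', y'⟩ ⟨h | h, h' | h'⟩ <;> dsimp only at h h' ⊢ <;> subst h <;> subst h' <;>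
      simp only [h₁, h₂])

@[simp] lemma smashLift_smk {P Q : Pointed.{u}} {A : Type*} (f : P.X → Q.X → A) (a : A) (h₁ h₂)
    (x : P.X) (y : Q.X) : smashLift f a h₁ h₂ (smk x y) = f x y := rfl

/-- A pointed map out of `P ∧ Q` from a map of two variables that collapses the wedge. -/
def smashHom {P Q R : Pointed.{u}} (f : P.X → Q.X → R.X)
    (h₁ : ∀ y, f P.point y = R.point) (h₂ : ∀ x, f x Q.point = R.point) : smashPt P Q ⟶ R :=
  ⟨smashLift f R.point h₁ h₂, h₁ _⟩

@[simp] lemma smashHom_smk {P Q R : Pointed.{u}} (f : P.X → Q.X → R.X) (h₁ h₂)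
    (x : P.X) (y : Q.X) : (smashHom (R := R) f h₁ h₂).toFun (smk x y) = f x y := rfl

/-- The map `f ∧ g`. -/
def smashPtMap {P P' Q Q' : Pointed.{u}} (f : P ⟶ P') (g : Q ⟶ Q') :
    smashPt P Q ⟶ smashPt P' Q' :=
  smashHom (fun x y => smk (f.toFun x) (g.toFun y))
    (fun y => by rw [f.map_point, smk_left]) (fun x => by rw [g.map_point, smk_right])

@[simp] lemma smashPtMap_smk {P P' Q Q' : Pointed.{u}} (f : P ⟶ P') (g : Q ⟶ Q')
    (x : P.X) (y : Q.X) :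
    (smashPtMap f g).toFun (smk x y) = smk (f.toFun x) (g.toFun y) := rfl

lemma smash_hom_ext {P Q R : Pointed.{u}} {f g : smashPt P Q ⟶ R}
    (h : ∀ x y, f.toFun (smk x y) = g.toFun (smk x y)) : f = g :=
  Pointed.Hom.ext (funext (smash_ind h))

lemma map_comp_toFun (K : PSSet.{u}) {a b c : SimplexCategoryᵒᵖ} (f : a ⟶ b) (g : b ⟶ c)
    (x : (K.obj a).X) : (K.map g).toFun ((K.map f).toFun x) = (K.map (f ≫ g)).toFun x := by
  rw [K.map_comp]; rfl

lemma map_id_toFun (K : PSSet.{u}) {a : SimplexCategoryᵒᵖ}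
    (x : (K.obj a).X) : (K.map (𝟙 a)).toFun x = x := by
  rw [K.map_id]; rfl

lemma naturality_toFun {K L : PSSet.{u}} (φ : K ⟶ L) {a b : SimplexCategoryᵒᵖ} (f : a ⟶ b)
    (x : (K.obj a).X) :
    (φ.app b).toFun ((K.map f).toFun x) = (L.map f).toFun ((φ.app a).toFun x) :=
  congrFun (congrArg Pointed.Hom.toFun (φ.naturality f)) x

/-- The smash product of pointed simplicial sets, formed in each degree. -/
abbrev smash (K L : PSSet.{u}) : PSSet.{u} where
  obj n := smashPt (K.obj n) (L.obj n)
  map f := smashPtMap (K.map f) (L.map f)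
  map_id n := smash_hom_ext fun x y => by simp
  map_comp f g := smash_hom_ext fun x y => by simp

/-- The map `φ ∧ χ` of pointed simplicial sets. -/
def smashMap {K K' L L' : PSSet.{u}} (φ : K ⟶ K') (χ : L ⟶ L') : smash K L ⟶ smash K' L' where
  app n := smashPtMap (φ.app n) (χ.app n)
  naturality _ _ f := smash_hom_ext fun x y =>
    congrArg₂ smk (naturality_toFun φ f x) (naturality_toFun χ f y)

/-- The symmetry `K ∧ L → L ∧ K`. -/
def smashSwap (K L : PSSet.{u}) : smash K L ⟶ smash L K where
  app _ := smashHom (fun x y => smk y x) (fun _ => smk_right _) (fun _ => smk_left _)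
  naturality _ _ _ := smash_hom_ext fun _ _ => rfl

/-- The associativity map `K ∧ (L ∧ M) → (K ∧ L) ∧ M`. -/
def smashAssoc (K L M : PSSet.{u}) : smash K (smash L M) ⟶ smash (smash K L) M where
  app n := smashHom
    (fun x => smashLift (fun y z => smk (smk x y) z) (smk (smk x (L.obj n).point) (M.obj n).point)
      (fun z => by rw [smk_right, smk_left, smk_right]) (fun y => by rw [smk_right, smk_right]))
    (smash_ind fun y z => by
      change smk (smk (K.obj n).point y) z = _
      rw [smk_left]; exact smk_left z)
    (fun x => by exact smk_right _)
  naturality _ _ _ :=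
    Pointed.Hom.ext (funext (smash_ind fun _ => smash_ind fun _ _ => rfl))

/-- The pointed simplicial set `Δ^k_+`, the standard simplex with a disjoint base point. -/
def simplexPlus : SimplexCategory ⥤ PSSet.{u} :=
  SSet.stdSimplex.{u} ⋙ (SimplicialObject.whiskering _ _).obj typeToPointed.{u}

/-- The collapse relation of `Δ^1/∂Δ^1`. -/
def circleRel (n : SimplexCategoryᵒᵖ) (a b : (Δ[1] : SSet.{u}).obj n) : Prop :=
  a ∈ (SSet.boundary.{u} 1).obj n ∧ b ∈ (SSet.boundary.{u} 1).obj n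

/-- The constant simplex of `Δ^1` at a vertex. -/
def constOne (n : SimplexCategoryᵒᵖ) (e : Fin 2) : (Δ[1] : SSet.{u}).obj n :=
  SSet.stdSimplex.objEquiv.symm (SimplexCategory.const n.unop ⦋1⦌ e)

/-- The simplicial circle `S^1 = Δ^1/∂Δ^1`. -/
def circle : PSSet.{u} where
  obj n := ⟨Quot (circleRel.{u} n), Quot.mk _ (constOne n 0)⟩
  map {n m} f := ⟨Quot.map (fun a => (Δ[1] : SSet.{u}).map f a) (fun _ _ h =>
    ⟨(SSet.boundary.{u} 1).map f h.1, (SSet.boundary.{u} 1).map f h.2⟩), rfl⟩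
  map_id n := by
    refine Pointed.Hom.ext (funext ?_)
    rintro ⟨a⟩
    exact congrArg (Quot.mk _) (by simp)
  map_comp f g := by
    refine Pointed.Hom.ext (funext ?_)
    rintro ⟨a⟩
    exact congrArg (Quot.mk _) (by simp)

/-- The simplicial interval `Δ^1`, pointed by its vertex `0`. -/
def interval : PSSet.{u} where
  obj n := ⟨(Δ[1] : SSet.{u}).obj n, constOne n 0⟩
  map f := ⟨fun a => (Δ[1] : SSet.{u}).map f a, rfl⟩
  map_id n := Pointed.Hom.ext (funext fun a => by simp)
  map_comp f g := Pointed.Hom.ext (funext fun a => by simp)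

/-- The simplex of `S^1` given by a monotone map to `[1]`. -/
def circleMk {n : ℕ} (g : ⦋n⦌ ⟶ ⦋1⦌) : (circle.{u}.obj (op ⦋n⦌)).X :=
  Quot.mk _ (SSet.stdSimplex.objEquiv.symm g)

/-- The quotient map `Δ^1 → S^1`. -/
def intervalToCircle : interval.{u} ⟶ circle.{u} where
  app _ := ⟨fun a => Quot.mk _ a, rfl⟩
  naturality _ _ _ := rfl

/-- The inclusion `K → K ∧ Δ^1`, `x ↦ x ∧ 1`, of the base of the cone on `K`. -/
def coneBase (K : PSSet.{u}) : K ⟶ smash K interval.{u} where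
  app n := ⟨fun x => smk x (constOne n 1), smk_left _⟩
  naturality _ _ _ := rfl

/-! ### Reduced chains and the Eilenberg-Zilber map -/

/-- The reduced free abelian group `ℤP/ℤpt` on a pointed set. -/
abbrev RedFree (P : Pointed.{u}) : Type u :=
  (P.X →₀ ℤ) ⧸ Submodule.span ℤ {Finsupp.single P.point (1 : ℤ)}

/-- The generator of `ℤP/ℤpt` given by a point of `P`. -/
noncomputable def gen {P : Pointed.{u}} (x : P.X) : RedFree P :=
  Submodule.Quotient.mk (Finsupp.single x 1)

lemma gen_point (P : Pointed.{u}) : gen P.point = 0 :=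
  (Submodule.Quotient.mk_eq_zero _).2 (Submodule.mem_span_singleton_self _)

/-- The linear extension of a function that vanishes at the base point. -/
noncomputable def redLift {P : Pointed.{u}} {A : Type*} [AddCommGroup A] (f : P.X → A)
    (h : f P.point = 0) : RedFree P →ₗ[ℤ] A :=
  Submodule.liftQ _ (Finsupp.lift A ℤ P.X f) (by
    rw [Submodule.span_singleton_le_iff_mem, LinearMap.mem_ker]
    simp [h])

@[simp] lemma redLift_gen {P : Pointed.{u}} {A : Type*} [AddCommGroup A] (f : P.X → A)
    (h : f P.point = 0) (x : P.X) : redLift f h (gen x) = f x := by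
  simp [redLift, gen]

lemma redFree_ext {P : Pointed.{u}} {A : Type*} [AddCommGroup A] {f g : RedFree P →ₗ[ℤ] A}
    (h : ∀ x, f (gen x) = g (gen x)) : f = g := by
  apply Submodule.linearMap_qext
  apply Finsupp.lhom_ext'
  intro x
  apply LinearMap.ext_ring
  exact h x

/-- The map `ℤP/ℤpt → ℤQ/ℤpt` induced by a pointed map. -/
noncomputable def redMap {P Q : Pointed.{u}} (f : P ⟶ Q) : RedFree P →ₗ[ℤ] RedFree Q :=
  redLift (fun x => gen (f.toFun x)) (by rw [f.map_point, gen_point])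

@[simp] lemma redMap_gen {P Q : Pointed.{u}} (f : P ⟶ Q) (x : P.X) :
    redMap f (gen x) = gen (f.toFun x) := redLift_gen _ _ _

/-- The reduced `i`-chains `C(K)_i = ℤK_i/ℤpt` of a pointed simplicial set. -/
abbrev Chains (K : PSSet.{u}) (i : ℕ) : Type u := RedFree (K.obj (op ⦋i⦌))

/-- The boundary `∂ = ∑ (-1)^a d_a` of the Moore complex. -/
noncomputable def bd (K : PSSet.{u}) (i : ℕ) : Chains K (i + 1) →ₗ[ℤ] Chains K i :=
  ∑ a : Fin (i + 2), (-1 : ℤ) ^ (a : ℕ) • redMap (K.δ a)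

/-- The chain map `C(K) → C(L)` induced by a map of pointed simplicial sets. -/
noncomputable def chainMap {K L : PSSet.{u}} (φ : K ⟶ L) (i : ℕ) : Chains K i →ₗ[ℤ] Chains L i :=
  redMap (φ.app (op ⦋i⦌))

lemma bd_chainMap {K L : PSSet.{u}} (φ : K ⟶ L) (i : ℕ) :
    bd L i ∘ₗ chainMap φ (i + 1) = chainMap φ i ∘ₗ bd K i := by
  apply redFree_ext
  intro x
  simp only [bd, chainMap, LinearMap.comp_apply, redMap_gen, LinearMap.sum_apply,
    LinearMap.smul_apply, map_sum, map_smul]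
  refine Finset.sum_congr rfl fun a _ => ?_
  congr 2
  exact (naturality_toFun φ _ x).symm

/-- For a set `s` of `p` of the `n` steps `j → j + 1` of `[n]`, the monotone surjection
`[n] → [p]` which increases exactly at the steps in `s`. -/
def stepMap {n p : ℕ} (s : Finset (Fin n)) (hs : s.card = p) : ⦋n⦌ ⟶ ⦋p⦌ :=
  SimplexCategory.Hom.mk
    { toFun := fun i => ⟨(s.filter fun j => j.castSucc < i).card,
        Nat.lt_succ_of_le (hs ▸ Finset.card_filter_le _ _)⟩
      monotone' := fun a b hab => Finset.card_le_card fun j hj => by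
        simp only [Finset.mem_filter] at hj ⊢
        exact ⟨hj.1, hj.2.trans_le hab⟩ }

/-- `(p, q)`-shuffles `(μ, ν)`, encoded by the `p`-element subset `μ` of the steps of `[p + q]`. -/
abbrev Shuffle (p q : ℕ) : Type := {s : Finset (Fin (p + q)) // s.card = p}

lemma Shuffle.card_compl {p q : ℕ} (s : Shuffle p q) : (s.1ᶜ).card = q := by
  rw [Finset.card_compl, s.2, Fintype.card_fin]; omega

/-- The sign of a shuffle `(μ, ν)`: the parity of the number of pairs `a ∈ μ`, `b ∈ ν`, `b < a`. -/
def Shuffle.sign {p q : ℕ} (s : Shuffle p q) : ℤ :=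
  (-1) ^ ((s.1 ×ˢ s.1ᶜ).filter fun x => x.2 < x.1).card

/-- The Eilenberg-Zilber map on simplices: the signed sum over all shuffles `(μ, ν)` of
`s_ν x ∧ s_μ y`. -/
noncomputable def ezGen (K L : PSSet.{u}) (p q : ℕ) (x : (K.obj (op ⦋p⦌)).X)
    (y : (L.obj (op ⦋q⦌)).X) : Chains (smash K L) (p + q) :=
  ∑ s : Shuffle p q, s.sign •
    gen (P := (smash K L).obj (op ⦋p + q⦌))
      (smk ((K.map (stepMap s.1 s.2).op).toFun x)
        ((L.map (stepMap s.1ᶜ s.card_compl).op).toFun y))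

lemma gen_smk_left {P Q : Pointed.{u}} (y : Q.X) : gen (smk P.point y) = 0 := by
  rw [smk_left, gen_point]

lemma gen_smk_right {P Q : Pointed.{u}} (x : P.X) : gen (smk x Q.point) = 0 := by
  rw [smk_right, gen_point]

lemma ezGen_left (K L : PSSet.{u}) (p q : ℕ) (y : (L.obj (op ⦋q⦌)).X) :
    ezGen K L p q (K.obj (op ⦋p⦌)).point y = 0 :=
  Finset.sum_eq_zero fun s _ => by
    rw [Pointed.Hom.map_point]; exact smul_eq_zero_of_right _ (gen_smk_left _)

lemma ezGen_right (K L : PSSet.{u}) (p q : ℕ) (x : (K.obj (op ⦋p⦌)).X) :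
    ezGen K L p q x (L.obj (op ⦋q⦌)).point = 0 :=
  Finset.sum_eq_zero fun s _ => by
    rw [Pointed.Hom.map_point]; exact smul_eq_zero_of_right _ (gen_smk_right _)

/-- The Eilenberg-Zilber (shuffle) map `C(K)_p ⊗ C(L)_q → C(K ∧ L)_{p+q}`, as a bilinear map. -/
noncomputable def EZ (K L : PSSet.{u}) (p q : ℕ) :
    Chains K p →ₗ[ℤ] Chains L q →ₗ[ℤ] Chains (smash K L) (p + q) :=
  redLift (fun x => redLift (ezGen K L p q x) (ezGen_right K L p q x))
    (redFree_ext fun y => by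
      rw [redLift_gen, LinearMap.zero_apply, ezGen_left])

lemma EZ_gen (K L : PSSet.{u}) (p q : ℕ) (x : (K.obj (op ⦋p⦌)).X) (y : (L.obj (op ⦋q⦌)).X) :
    EZ K L p q (gen x) (gen y) = ezGen K L p q x y := by
  simp [EZ]

lemma EZ_natural {K K' L L' : PSSet.{u}} (φ : K ⟶ K') (χ : L ⟶ L') (p q : ℕ)
    (c : Chains K p) (d : Chains L q) :
    EZ K' L' p q (chainMap φ p c) (chainMap χ q d) =
      chainMap (smashMap φ χ) (p + q) (EZ K L p q c d) := by
  suffices h : (EZ K' L' p q).compl₁₂ (chainMap φ p) (chainMap χ q) =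
      (EZ K L p q).compr₂ (chainMap (smashMap φ χ) (p + q)) from
    LinearMap.congr_fun₂ h c d
  apply redFree_ext
  intro x
  apply redFree_ext
  intro y
  simp only [LinearMap.compl₁₂_apply, LinearMap.compr₂_apply, chainMap, redMap_gen, EZ_gen, ezGen,
    map_sum, map_smul]
  refine Finset.sum_congr rfl fun s _ => ?_
  congr 2
  exact congrArg₂ smk (naturality_toFun φ _ x).symm (naturality_toFun χ _ y).symm

/-- The nondegenerate simplex of `Δ^m_+`. -/
def topSimplex (m : ℕ) : ((simplexPlus.{u}.obj ⦋m⦌).obj (op ⦋m⦌)).X :=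
  some (SSet.stdSimplex.objEquiv.symm (𝟙 ⦋m⦌))

/-- The canonical chain `[Δ^k_+] ∈ C_k(Δ^k_+)`. -/
noncomputable def simplexChain (k : ℕ) : Chains (simplexPlus.{u}.obj ⦋k⦌) k :=
  gen (topSimplex k)

/-- The canonical chain `[S^1] ∈ C_1(S^1)`. -/
noncomputable def circleChain : Chains circle.{u} 1 :=
  gen (P := circle.{u}.obj (op ⦋1⦌)) (circleMk (𝟙 ⦋1⦌))


set_option linter.unusedSimpArgs false

/-- The simplex `(f^* x) ∧ [g]` of `K ∧ S^1`, as a pointed map in `x`. -/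
def prismHom (K : PSSet.{u}) {m a : ℕ} (f : ⦋a⦌ ⟶ ⦋m⦌) (g : ⦋a⦌ ⟶ ⦋1⦌) :
    K.obj (op ⦋m⦌) ⟶ (smash K circle.{u}).obj (op ⦋a⦌) :=
  ⟨fun x => smk ((K.map f.op).toFun x) (circleMk g), by
    rw [Pointed.Hom.map_point, smk_left]⟩

lemma prismHom_comp (K : PSSet.{u}) {m a b : ℕ} (f : ⦋a⦌ ⟶ ⦋m⦌) (g : ⦋a⦌ ⟶ ⦋1⦌)
    (θ : ⦋b⦌ ⟶ ⦋a⦌) :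
    prismHom K f g ≫ (smash K circle.{u}).map θ.op = prismHom K (θ ≫ f) (θ ≫ g) := by
  refine Pointed.Hom.ext (funext fun x => ?_)
  exact congrArg₂ smk (map_comp_toFun K f.op θ.op x) rfl

lemma comp_prismHom (K : PSSet.{u}) {m m' a : ℕ} (f : ⦋a⦌ ⟶ ⦋m⦌) (g : ⦋a⦌ ⟶ ⦋1⦌)
    (θ : ⦋m⦌ ⟶ ⦋m'⦌) :
    K.map θ.op ≫ prismHom K f g = prismHom K (f ≫ θ) g := by
  refine Pointed.Hom.ext (funext fun x => ?_)
  exact congrArg₂ smk (map_comp_toFun K θ.op f.op x) rfl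

lemma circleMk_eq_point {n : ℕ} (g : ⦋n⦌ ⟶ ⦋1⦌) (e : Fin 2)
    (h : ∀ j, g.toOrderHom j = e) : circleMk.{u} g = (circle.{u}.obj (op ⦋n⦌)).point := by
  have key : ∀ e : Fin 2, e ≠ 1 - e := by decide
  apply Quot.sound
  refine ⟨fun hs => ?_, fun hs => ?_⟩
  · obtain ⟨j, hj⟩ := hs (1 - e)
    exact key e ((h j).symm.trans hj)
  · obtain ⟨j, hj⟩ := hs 1
    exact key 0 hj

lemma redMap_prismHom_eq_zero (K : PSSet.{u}) {m a : ℕ} (f : ⦋a⦌ ⟶ ⦋m⦌) (g : ⦋a⦌ ⟶ ⦋1⦌)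
    (e : Fin 2) (h : ∀ j, g.toOrderHom j = e) : redMap (prismHom K f g) = 0 :=
  redFree_ext fun x => by
    rw [redMap_gen, LinearMap.zero_apply]
    change gen (smk _ (circleMk g)) = 0
    rw [circleMk_eq_point g e h, gen_smk_right]

/-- The functor `P ↦ ℤP/ℤpt`. -/
noncomputable def redFunctor : Pointed.{u} ⥤ ModuleCat.{u} ℤ where
  obj P := ModuleCat.of ℤ (RedFree P)
  map f := ModuleCat.ofHom (redMap f)
  map_id P := by
    ext1; exact redFree_ext fun x => by simp
  map_comp f g := by
    ext1; exact redFree_ext fun x => by simp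

/-- The monotone map `[n + 1] → [1]` with its jump at the step `i`. -/
abbrev jump {n : ℕ} (i : Fin (n + 1)) : ⦋n + 1⦌ ⟶ ⦋1⦌ :=
  stepMap (n := n + 1) (p := 1) {i} (Finset.card_singleton _)

lemma jump_apply {n : ℕ} (i : Fin (n + 1)) (j : Fin (n + 2)) :
    (((jump i).toOrderHom j : Fin 2) : ℕ) = if i.castSucc < j then 1 else 0 := by
  change (Finset.filter (fun l : Fin (n + 1) => l.castSucc < j) {i}).card = _
  rw [Finset.filter_singleton]
  split_ifs <;> simp

lemma jump_comp_apply {n a : ℕ} (i : Fin (n + 1)) (θ : ⦋a⦌ ⟶ ⦋n + 1⦌) (j : Fin (a + 1)) :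
    ((((θ ≫ jump i)).toOrderHom j : Fin 2) : ℕ) =
      if (i : ℕ) < ((θ.toOrderHom j : Fin (n + 2)) : ℕ) then 1 else 0 :=
  jump_apply i _

lemma δ_val {n : ℕ} (i : Fin (n + 2)) (j : Fin (n + 1)) :
    (((SimplexCategory.δ i).toOrderHom j : Fin (n + 2)) : ℕ) =
      if (j : ℕ) < i then (j : ℕ) else j + 1 := by
  change ((i.succAbove j : Fin (n + 2)) : ℕ) = _
  rw [Fin.succAbove]
  simp only [Fin.lt_def, Fin.val_castSucc]
  split_ifs <;> rfl

lemma σ_val {n : ℕ} (i : Fin (n + 1)) (j : Fin (n + 2)) :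
    (((SimplexCategory.σ i).toOrderHom j : Fin (n + 1)) : ℕ) =
      if (i : ℕ) < j then (j : ℕ) - 1 else j := by
  change ((i.predAbove j : Fin (n + 1)) : ℕ) = _
  rw [Fin.predAbove]
  simp only [Fin.lt_def, Fin.val_castSucc]
  split_ifs <;> rfl

lemma hom_to_one_ext {n : ℕ} {f g : ⦋n⦌ ⟶ ⦋1⦌}
    (h : ∀ j, ((f.toOrderHom j : Fin 2) : ℕ) = (g.toOrderHom j : Fin 2)) : f = g := by
  ext j
  exact congrArg Fin.val (Fin.ext (h j))

/-- The prism decomposition, as a simplicial homotopy from `0` to `0`. -/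
noncomputable def prismHomotopy (K : PSSet.{u}) :
    SimplicialObject.Homotopy
      (0 : ((SimplicialObject.whiskering _ _).obj redFunctor.{u}).obj K ⟶
        ((SimplicialObject.whiskering _ _).obj redFunctor.{u}).obj (smash K circle.{u})) 0 where
  h i := redFunctor.map (prismHom K (SimplexCategory.σ i) (jump i))
  h_zero_comp_δ_zero n := by
    change redFunctor.map _ ≫ redFunctor.map _ = _
    rw [← Functor.map_comp]
    erw [prismHom_comp]
    refine ModuleCat.hom_ext (redMap_prismHom_eq_zero K _ _ 1 fun j => Fin.ext ?_)
    rw [jump_comp_apply, δ_val]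
    simp
  h_last_comp_δ_last n := by
    change redFunctor.map _ ≫ redFunctor.map _ = _
    rw [← Functor.map_comp]
    erw [prismHom_comp]
    refine ModuleCat.hom_ext (redMap_prismHom_eq_zero K _ _ 0 fun j => Fin.ext ?_)
    rw [jump_comp_apply, δ_val]
    have := j.2
    simp only [Fin.val_last]
    change (j : ℕ) < n + 1 at this
    simp [this]; omega
  h_succ_comp_δ_castSucc_of_lt i j hij := by
    change redFunctor.map _ ≫ redFunctor.map _ = redFunctor.map _ ≫ redFunctor.map _
    rw [← Functor.map_comp, ← Functor.map_comp]
    congr 1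
    refine (prismHom_comp _ _ _ _).trans (Eq.trans ?_ (comp_prismHom _ _ _ _).symm)
    congr 1
    · exact SimplexCategory.δ_comp_σ_of_le hij
    · refine hom_to_one_ext fun l => ?_
      simp only [Fin.lt_def, Fin.le_def, Fin.val_castSucc] at hij
      simp only [jump_comp_apply, jump_apply, δ_val, σ_val, Fin.lt_def, Fin.val_succ,
        Fin.val_castSucc]
      split_ifs <;> omega
  h_succ_comp_δ_castSucc_succ j := by
    change redFunctor.map _ ≫ redFunctor.map _ = redFunctor.map _ ≫ redFunctor.map _
    rw [← Functor.map_comp, ← Functor.map_comp]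
    congr 1
    refine (prismHom_comp _ _ _ _).trans (Eq.trans ?_ (prismHom_comp _ _ _ _).symm)
    congr 1
    · exact SimplexCategory.δ_comp_σ_self.trans SimplexCategory.δ_comp_σ_succ.symm
    · refine hom_to_one_ext fun l => ?_
      simp only [jump_comp_apply, jump_apply, δ_val, σ_val, Fin.lt_def, Fin.val_succ,
        Fin.val_castSucc]
      split_ifs <;> omega
  h_castSucc_comp_δ_succ_of_lt i j hij := by
    change redFunctor.map _ ≫ redFunctor.map _ = redFunctor.map _ ≫ redFunctor.map _
    rw [← Functor.map_comp, ← Functor.map_comp]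
    congr 1
    refine (prismHom_comp _ _ _ _).trans (Eq.trans ?_ (comp_prismHom _ _ _ _).symm)
    congr 1
    · exact SimplexCategory.δ_comp_σ_of_gt hij
    · refine hom_to_one_ext fun l => ?_
      simp only [Fin.lt_def, Fin.le_def, Fin.val_castSucc] at hij
      simp only [jump_comp_apply, jump_apply, δ_val, σ_val, Fin.lt_def, Fin.val_succ,
        Fin.val_castSucc]
      split_ifs <;> omega
  h_comp_σ_castSucc_of_le i j hij := by
    change redFunctor.map _ ≫ redFunctor.map _ = redFunctor.map _ ≫ redFunctor.map _
    rw [← Functor.map_comp, ← Functor.map_comp]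
    congr 1
    refine (prismHom_comp _ _ _ _).trans (Eq.trans ?_ (comp_prismHom _ _ _ _).symm)
    congr 1
    · exact SimplexCategory.σ_comp_σ hij
    · refine hom_to_one_ext fun l => ?_
      simp only [Fin.lt_def, Fin.le_def, Fin.val_castSucc] at hij
      simp only [jump_comp_apply, jump_apply, δ_val, σ_val, Fin.lt_def, Fin.val_succ,
        Fin.val_castSucc]
      split_ifs <;> omega
  h_comp_σ_succ_of_lt i j hij := by
    change redFunctor.map _ ≫ redFunctor.map _ = redFunctor.map _ ≫ redFunctor.map _
    rw [← Functor.map_comp, ← Functor.map_comp]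
    congr 1
    refine (prismHom_comp _ _ _ _).trans (Eq.trans ?_ (comp_prismHom _ _ _ _).symm)
    congr 1
    · exact (SimplexCategory.σ_comp_σ hij).symm
    · refine hom_to_one_ext fun l => ?_
      simp only [Fin.lt_def, Fin.le_def, Fin.val_castSucc] at hij
      simp only [jump_comp_apply, jump_apply, δ_val, σ_val, Fin.lt_def, Fin.val_succ,
        Fin.val_castSucc]
      split_ifs <;> omega

/-- The shuffles in `EZ(x ⊗ [S^1])` are indexed by the step that the second factor takes. -/
noncomputable def shuffleOne (m : ℕ) : Fin (m + 1) ≃ Shuffle m 1 :=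
  Equiv.ofBijective
    (fun i => ⟨{i}ᶜ, by rw [Finset.card_compl, Finset.card_singleton, Fintype.card_fin]; rfl⟩) (by
      constructor
      · intro i j h
        simpa using congrArg Subtype.val h
      · intro s
        obtain ⟨i, hi⟩ := Finset.card_eq_one.1 s.card_compl
        exact ⟨i, Subtype.ext ((congrArg compl hi.symm).trans (compl_compl _))⟩)

lemma shuffleOne_sign (m : ℕ) (i : Fin (m + 1)) :
    (shuffleOne m i).sign = (-1) ^ m * (-1) ^ (i : ℕ) := by
  have h : ((({i}ᶜ : Finset (Fin (m + 1))) ×ˢ ({i}ᶜ : Finset (Fin (m + 1)))ᶜ).filter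
      fun x => x.2 < x.1) = (Finset.Ioi i).map ⟨fun a => (a, i), fun a b h => by simpa using h⟩ := by
    ext ⟨a, b⟩
    constructor
    · intro h
      simp only [Finset.mem_filter, Finset.mem_product, Finset.mem_compl, Finset.mem_singleton,
        compl_compl] at h
      obtain ⟨⟨h₁, rfl⟩, h₂⟩ := h
      exact Finset.mem_map.2 ⟨a, Finset.mem_Ioi.2 h₂, rfl⟩
    · intro h
      obtain ⟨a', h₂, h'⟩ := Finset.mem_map.1 h
      obtain ⟨rfl, rfl⟩ := Prod.mk.inj h'
      have h₃ := Finset.mem_Ioi.1 h₂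
      simp [h₃, h₃.ne']
  unfold Shuffle.sign
  change (-1 : ℤ) ^ (((({i}ᶜ : Finset (Fin (m + 1))) ×ˢ ({i}ᶜ : Finset (Fin (m + 1)))ᶜ).filter
      fun x => x.2 < x.1)).card = _
  rw [h, Finset.card_map, Fin.card_Ioi, ← pow_add]
  obtain ⟨d, hd⟩ : ∃ d, m = i + d := ⟨m - i, by have := i.2; omega⟩
  have h₁ : m + 1 - 1 - (i : ℕ) = d := by omega
  have h₂ : m + (i : ℕ) = d + 2 * i := by omega
  rw [h₁, h₂, pow_add, pow_mul]; simp

lemma stepMap_compl_singleton {m : ℕ} (i : Fin (m + 1)) (h : ({i}ᶜ : Finset (Fin (m + 1))).card = m) :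
    stepMap (n := m + 1) {i}ᶜ h = SimplexCategory.σ i := by
  ext j
  rw [σ_val]
  change (Finset.filter (fun l : Fin (m + 1) => l.castSucc < j) {i}ᶜ).card = _
  have h₁ : (Finset.univ.filter fun l : Fin (m + 1) => l.castSucc < j).card = j := by
    have h : (Finset.univ.filter fun l : Fin (m + 1) => l.castSucc < j).map Fin.valEmbedding =
        Finset.range j := by
      ext l
      simp only [Finset.mem_map, Finset.mem_filter, Finset.mem_univ, true_and, Finset.mem_range,
        Fin.lt_def, Fin.val_castSucc, Fin.valEmbedding_apply]
      constructor
      · rintro ⟨l, hl, rfl⟩; exact hl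
      · intro hl
        have := j.2
        change (j : ℕ) < m + 1 + 1 at this
        exact ⟨⟨l, by omega⟩, hl, rfl⟩
    rw [← Finset.card_map, h, Finset.card_range]
  have h₂ : (Finset.filter (fun l : Fin (m + 1) => l.castSucc < j) {i}ᶜ) =
      (Finset.univ.filter fun l : Fin (m + 1) => l.castSucc < j).erase i := by
    ext l; simp [and_comm]
  rw [h₂, Finset.card_erase_eq_ite, h₁]
  simp [Fin.lt_def]

lemma EZ_circle_gen (K : PSSet.{u}) (m : ℕ) (x : (K.obj (op ⦋m⦌)).X) :
    EZ K circle m 1 (gen x) circleChain.{u} =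
      ∑ i : Fin (m + 1), ((-1 : ℤ) ^ m * (-1) ^ (i : ℕ)) •
        redMap (prismHom K (SimplexCategory.σ i) (jump i)) (gen x) := by
  rw [circleChain, EZ_gen, ezGen, ← (shuffleOne m).sum_comp]
  refine Finset.sum_congr rfl fun i _ => ?_
  rw [shuffleOne_sign, redMap_gen]
  congr 2
  refine congrArg₂ smk ?_ ?_
  · change (K.map (stepMap (n := m + 1) {i}ᶜ _).op).toFun x = _
    exact congrArg (fun f => (K.map f.op).toFun x) (stepMap_compl_singleton i _)
  · have h : stepMap (n := m + 1) (p := 1) {i}ᶜᶜ (by rw [compl_compl]; rfl) = jump i := by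
      simp only [compl_compl]
    exact congrArg circleMk h

/-- The signed sum of the prisms. -/
noncomputable def prismSum (K : PSSet.{u}) (m : ℕ) :
    Chains K m →ₗ[ℤ] Chains (smash K circle.{u}) (m + 1) :=
  ∑ i : Fin (m + 1), (-1 : ℤ) ^ (i : ℕ) • redMap (prismHom K (SimplexCategory.σ i) (jump i))

lemma EZ_circle_eq (K : PSSet.{u}) (m : ℕ) (c : Chains K m) :
    EZ K circle m 1 c circleChain.{u} = (-1 : ℤ) ^ m • prismSum K m c := by
  suffices h : (EZ K circle m 1).flip circleChain.{u} = (-1 : ℤ) ^ m • prismSum K m from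
    LinearMap.congr_fun h c
  refine redFree_ext fun x => ?_
  rw [LinearMap.flip_apply, EZ_circle_gen]
  simp only [prismSum, LinearMap.smul_apply, LinearMap.sum_apply, Finset.smul_sum, mul_smul]

lemma prismHomotopy_hom (K : PSSet.{u}) (m : ℕ) :
    (prismHomotopy K).toChainHomotopy.hom m (m + 1) = ModuleCat.ofHom (-prismSum K m) := by
  change SimplicialObject.Homotopy.ToChainHomotopy.hom (prismHomotopy K) m (m + 1) = _
  rw [SimplicialObject.Homotopy.ToChainHomotopy.hom_eq]
  apply ModuleCat.hom_ext
  rw [ModuleCat.hom_neg, ModuleCat.hom_sum]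
  rfl

lemma alternating_d (K : PSSet.{u}) (m : ℕ) :
    ((AlgebraicTopology.alternatingFaceMapComplex (ModuleCat.{u} ℤ)).obj
      (((SimplicialObject.whiskering _ _).obj redFunctor.{u}).obj K)).d (m + 1) m =
        ModuleCat.ofHom (bd K m) := by
  rw [AlgebraicTopology.alternatingFaceMapComplex_obj_d]
  apply ModuleCat.hom_ext
  rw [AlgebraicTopology.AlternatingFaceMapComplex.objD, ModuleCat.hom_sum]
  rfl

lemma bd_prismSum (K : PSSet.{u}) (m : ℕ) :
    bd (smash K circle.{u}) (m + 1) ∘ₗ prismSum K (m + 1) = -(prismSum K m ∘ₗ bd K m) := by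
  have h := (prismHomotopy K).toChainHomotopy.comm (m + 1)
  rw [dNext_eq (i' := m) (w := by simp), prevD_eq (j' := m + 2) (w := by simp),
    prismHomotopy_hom, prismHomotopy_hom, alternating_d, alternating_d, Functor.map_zero] at h
  have h' : (0 : Chains K (m + 1) →ₗ[ℤ] Chains (smash K circle.{u}) (m + 1)) =
      (-prismSum K m) ∘ₗ bd K m + bd (smash K circle.{u}) (m + 1) ∘ₗ (-prismSum K (m + 1)) + 0 :=
    congrArg ModuleCat.Hom.hom h
  rw [LinearMap.neg_comp, LinearMap.comp_neg, add_zero, ← neg_add, eq_comm, neg_eq_zero] at h'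
  exact eq_neg_of_add_eq_zero_right h'

lemma bd_prismSum_zero (K : PSSet.{u}) : bd (smash K circle.{u}) 0 ∘ₗ prismSum K 0 = 0 := by
  have h := (prismHomotopy K).toChainHomotopy.comm 0
  rw [dNext_eq_zero _ _ (by simp), prevD_eq (j' := 1) (w := by simp),
    prismHomotopy_hom, alternating_d, Functor.map_zero] at h
  have h' : (0 : Chains K 0 →ₗ[ℤ] Chains (smash K circle.{u}) 0) =
      0 + bd (smash K circle.{u}) 0 ∘ₗ (-prismSum K 0) + 0 :=
    congrArg ModuleCat.Hom.hom h
  rw [LinearMap.comp_neg, add_zero, zero_add, eq_comm, neg_eq_zero] at h'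
  exact h'

/-- The map `c ↦ EZ(c ⊗ [S^1])` commutes with the boundary. -/
lemma bd_EZ_circle (K : PSSet.{u}) (m : ℕ) (c : Chains K (m + 1)) :
    bd (smash K circle.{u}) (m + 1) (EZ K circle (m + 1) 1 c circleChain) =
      EZ K circle m 1 (bd K m c) circleChain := by
  have h : bd (smash K circle.{u}) (m + 1) (prismSum K (m + 1) c) = -prismSum K m (bd K m c) :=
    LinearMap.congr_fun (bd_prismSum K m) c
  rw [EZ_circle_eq, EZ_circle_eq]
  refine (map_smul (bd (smash K circle.{u}) (m + 1)) _ (prismSum K (m + 1) c)).trans ?_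
  rw [h, pow_succ]
  simp

lemma bd_EZ_circle_zero (K : PSSet.{u}) (c : Chains K 0) :
    bd (smash K circle.{u}) 0 (EZ K circle 0 1 c circleChain) = 0 := by
  have h : bd (smash K circle.{u}) 0 (prismSum K 0 c) = 0 :=
    LinearMap.congr_fun (bd_prismSum_zero K) c
  rw [EZ_circle_eq]
  refine (map_smul (bd (smash K circle.{u}) 0) _ (prismSum K 0 c)).trans ?_
  rw [h, smul_zero]

/-! ### Cochains, cocycles and cohomology with coefficients in a graded vector space -/

lemma chainMap_gen {K L : PSSet.{u}} (φ : K ⟶ L) (i : ℕ) (x : (K.obj (op ⦋i⦌)).X) :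
    chainMap φ i (gen x) = gen ((φ.app (op ⦋i⦌)).toFun x) := redMap_gen _ _

/-- Pairs `(i, j)` with `i + j = n` and `i ≥ 0`. -/
abbrev Bideg (n : ℤ) : Type := {p : ℕ × ℤ // (p.1 : ℤ) + p.2 = n}

/-- The pair `(i + k, j)`. -/
abbrev Bideg.right {m n : ℤ} (p : Bideg m) (k : ℕ) (h : m + k = n) : Bideg n :=
  ⟨(p.1.1 + k, p.1.2), by have := p.2; push_cast; omega⟩

/-- The pair `(k + i, j)`. -/
abbrev Bideg.left {m n : ℤ} (p : Bideg m) (k : ℕ) (h : m + k = n) : Bideg n :=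
  ⟨(k + p.1.1, p.1.2), by have := p.2; push_cast; omega⟩

/-- Reduced cochains of total degree `n`, `C^n(K; V) = ∏_{i + j = n} Hom(C(K)_i, V^j)`. -/
abbrev Cochain (V : ℤ → Type u) [∀ j, AddCommGroup (V j)] (n : ℤ) (K : PSSet.{u}) : Type u :=
  ∀ p : Bideg n, Chains K p.1.1 →ₗ[ℤ] V p.1.2

lemma cochain_ext {V : ℤ → Type u} [∀ j, AddCommGroup (V j)] {n : ℤ} {K : PSSet.{u}}
    {u v : Cochain V n K} (h : ∀ p x, u p (gen x) = v p (gen x)) : u = v := by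
  funext p
  exact redFree_ext (h p)

section Cochains

variable (V : ℤ → Type u) [∀ j, AddCommGroup (V j)] [∀ j, Module ℝ (V j)]

variable {V}

/-- Pullback of cochains along a map of pointed simplicial sets. -/
noncomputable def pull {n : ℤ} {K L : PSSet.{u}} (φ : K ⟶ L) : Cochain V n L →ₗ[ℝ] Cochain V n K where
  toFun u p := u p ∘ₗ chainMap φ p.1.1
  map_add' _ _ := rfl
  map_smul' _ _ := rfl

/-- The coboundary `δu = u ∘ ∂`. -/
noncomputable def cobd {n' n : ℤ} (h : n' + 1 = n) (K : PSSet.{u}) :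
    Cochain V n' K →ₗ[ℝ] Cochain V n K where
  toFun u p := match p with
    | ⟨(0, _), _⟩ => 0
    | ⟨(i + 1, j), hj⟩ => u ⟨(i, j), by push_cast at hj ⊢; omega⟩ ∘ₗ bd K i
  map_add' u v := by
    funext ⟨⟨i, j⟩, hj⟩
    cases i with
    | zero => exact (add_zero 0).symm
    | succ i => rfl
  map_smul' r u := by
    funext ⟨⟨i, j⟩, hj⟩
    cases i with
    | zero => exact (smul_zero r).symm
    | succ i => rfl

variable (V)

/-- The cocycles `Z^n(K; V) = ∏_{i + j = n} Z^i(K; V^j)`; equivalently the chain maps from `C(K)` to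
the non-negative complex `V[-n]_i = V^{n-i}`, `i ≥ 0`, with zero differential. -/
def cocycles (n : ℤ) (K : PSSet.{u}) : Submodule ℝ (Cochain V n K) where
  carrier := {u | ∀ p : Bideg n, u p ∘ₗ bd K p.1.1 = 0}
  add_mem' {u v} hu hv p := by
    change (u p + v p) ∘ₗ bd K p.1.1 = 0
    rw [LinearMap.add_comp, hu, hv, add_zero]
  zero_mem' p := LinearMap.zero_comp _
  smul_mem' r u hu p := by
    change r • (u p ∘ₗ bd K p.1.1) = 0
    rw [hu, smul_zero]

/-- The cohomology `H^n(K; V) = ∏_{i + j = n} H^i(K; V^j)`, cocycles modulo coboundaries. -/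
abbrev Coh (n : ℤ) (K : PSSet.{u}) : Type u :=
  cocycles V n K ⧸ (LinearMap.range (cobd (V := V) (sub_add_cancel n 1) K)).submoduleOf
    (cocycles V n K)

variable {V}

/-- The cohomology class of a cocycle. -/
noncomputable def coh {n : ℤ} {K : PSSet.{u}} (u : Cochain V n K) (hu : u ∈ cocycles V n K) : Coh V n K :=
  Submodule.Quotient.mk ⟨u, hu⟩

lemma pull_mem {n : ℤ} {K L : PSSet.{u}} (φ : K ⟶ L) (u : Cochain V n L)
    (hu : u ∈ cocycles V n L) : pull φ u ∈ cocycles V n K := by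
  intro p
  change (u p ∘ₗ chainMap φ p.1.1) ∘ₗ bd K p.1.1 = 0
  rw [LinearMap.comp_assoc, ← bd_chainMap, ← LinearMap.comp_assoc, hu, LinearMap.zero_comp]

/-- Pullback of cocycles. -/
noncomputable def cocyclesPull {n : ℤ} {K L : PSSet.{u}} (φ : K ⟶ L) :
    cocycles V n L →ₗ[ℝ] cocycles V n K :=
  (pull φ).restrict (pull_mem φ)

/-- The slant product `u/e`, `(u/e)(d) = u(EZ(d ⊗ e))`, with a chain `e ∈ C_k(L)`. -/
noncomputable def slant {K L : PSSet.{u}} {k : ℕ} (e : Chains L k) {m n : ℤ} (h : m + k = n) :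
    Cochain V n (smash K L) →ₗ[ℝ] Cochain V m K where
  toFun u p :=
    LinearMap.comp (M₂ := Chains (smash K L) (p.1.1 + k)) (u (p.right k h))
      ((EZ K L p.1.1 k).flip e)
  map_add' _ _ := funext fun _ => LinearMap.ext fun _ => rfl
  map_smul' _ _ := funext fun _ => LinearMap.ext fun _ => rfl

/-- The variant of the slant product with the chain in front, `d ↦ u(EZ(e ⊗ d))`. -/
noncomputable def slantFront {K L : PSSet.{u}} {k : ℕ} (e : Chains L k) {m n : ℤ} (h : m + k = n) :
    Cochain V n (smash L K) →ₗ[ℝ] Cochain V m K where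
  toFun u p :=
    LinearMap.comp (M₂ := Chains (smash L K) (k + p.1.1)) (u (p.left k h)) (EZ L K k p.1.1 e)
  map_add' _ _ := funext fun _ => LinearMap.ext fun _ => rfl
  map_smul' _ _ := funext fun _ => LinearMap.ext fun _ => rfl

lemma slant_circle_mem {K : PSSet.{u}} {m n : ℤ} (h : m + (1 : ℕ) = n)
    (u : Cochain V n (smash K circle)) (hu : u ∈ cocycles V n (smash K circle)) :
    slant circleChain h u ∈ cocycles V m K := by
  rintro ⟨⟨i, j⟩, hj⟩
  refine LinearMap.ext fun c => ?_
  change u ⟨(i + 1, j), _⟩ (EZ K circle i 1 (bd K i c) circleChain) = 0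
  rw [← bd_EZ_circle]
  exact LinearMap.congr_fun (hu ⟨(i + 1, j), _⟩) _

/-- The slant product of cocycles with `[S^1]`. -/
noncomputable def slantCircle (K : PSSet.{u}) {m n : ℤ} (h : m + (1 : ℕ) = n) :
    cocycles V n (smash K circle) →ₗ[ℝ] cocycles V m K :=
  (slant circleChain h).restrict (slant_circle_mem h)

lemma slant_circle_cobd {K : PSSet.{u}} {l m n : ℤ} (h : m + (1 : ℕ) = n) (hl : l + 1 = m)
    (h' : l + (1 : ℕ) = m) (h'' : m + 1 = n) (g : Cochain V m (smash K circle)) :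
    slant circleChain h (cobd h'' _ g) = cobd hl K (slant circleChain h' g) := by
  funext ⟨⟨i, j⟩, hj⟩
  refine LinearMap.ext fun c => ?_
  cases i with
  | zero =>
    change g ⟨(0, j), _⟩ (bd (smash K circle) 0 (EZ K circle 0 1 c circleChain)) = 0
    rw [bd_EZ_circle_zero, map_zero]
  | succ i =>
    change g ⟨(i + 1, j), _⟩ (bd (smash K circle) (i + 1) (EZ K circle (i + 1) 1 c circleChain)) =
      g ⟨(i + 1, j), _⟩ (EZ K circle i 1 (bd K i c) circleChain)
    rw [bd_EZ_circle]

/-- The suspension `H^n(K ∧ S^1; V) → H^{n-1}(K; V)`, the slant product with `[S^1]`. -/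
noncomputable def suspension (V : ℤ → Type u) [∀ j, AddCommGroup (V j)] [∀ j, Module ℝ (V j)]
    (K : PSSet.{u}) (n : ℤ) :
    Coh V n (smash K circle) →ₗ[ℝ] Coh V (n - 1) K :=
  Submodule.mapQ _ _ (slantCircle K (by push_cast; omega)) (by
    rintro ⟨u, hu⟩ ⟨g, hg⟩
    exact ⟨slant circleChain (by push_cast; omega) g,
      (slant_circle_cobd (by push_cast; omega) _ _ _ g).symm.trans (congrArg _ hg)⟩)

/-- Multiplication by `(-1)^i` on the component of cochain degree `i`. -/
noncomputable def signTwist {n : ℤ} {K : PSSet.{u}} (u : Cochain V n K) : Cochain V n K :=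
  fun p => (-1 : ℤ) ^ p.1.1 • u p

/-- The classes `x ∈ H^n(K ∧ S^1; V)` and `y ∈ H^{n-1}(K; V)` correspond to each other under the
connecting homomorphism of the cofibre sequence `K → K ∧ Δ^1 → K ∧ S^1`, with the sign `(-1)^i` on
the component of degree `i` coming from the placement of `S^1` to the right of `K`: some cochain
`g` on the cone `K ∧ Δ^1` has as coboundary the pullback of a representative of `x` and restricts
(up to that sign) to a representative of `y` on the base of the cone. -/
def IsSuspensionOf {K : PSSet.{u}} {n : ℤ} (x : Coh V n (smash K circle)) (y : Coh V (n - 1) K) :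
    Prop :=
  ∃ (u : Cochain V n (smash K circle)) (hu : u ∈ cocycles V n (smash K circle))
    (g : Cochain V (n - 1) (smash K interval))
    (hw : signTwist (pull (coneBase K) g) ∈ cocycles V (n - 1) K),
    cobd (sub_add_cancel n 1) _ g = pull (smashMap (𝟙 K) intervalToCircle) u ∧
    coh u hu = x ∧ coh _ hw = y

end Cochains

/-! ### The cocycle spectrum and its costructure maps -/

section Spectrum

variable (V : ℤ → Type u) [∀ j, AddCommGroup (V j)] [∀ j, Module ℝ (V j)]

/-- The contravariant functor `K ↦ Z^n(K; V)`. -/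
noncomputable def cocyclesFunctor (n : ℤ) : PSSet.{u}ᵒᵖ ⥤ ModuleCat.{u} ℝ where
  obj K := ModuleCat.of ℝ (cocycles V n K.unop)
  map φ := ModuleCat.ofHom (cocyclesPull φ.unop)
  map_id K := by
    refine ModuleCat.hom_ext (LinearMap.ext fun u => Subtype.ext (cochain_ext fun p x => ?_))
    exact congrArg (u.1 p) (chainMap_gen _ _ _)
  map_comp φ χ := by
    refine ModuleCat.hom_ext (LinearMap.ext fun u => Subtype.ext (cochain_ext fun p x => ?_))
    refine congrArg (u.1 p) ?_
    rw [chainMap_gen, chainMap_gen, chainMap_gen]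
    rfl

/-- The functor `k ↦ K ∧ Δ^k_+`. -/
noncomputable def cylinders (K : PSSet.{u}) : SimplexCategory ⥤ PSSet.{u} where
  obj k := smash K (simplexPlus.obj k)
  map θ := smashMap (𝟙 K) (simplexPlus.map θ)
  map_id k := by
    refine (congrArg (smashMap (𝟙 K)) (simplexPlus.map_id k)).trans ?_
    exact SimplicialObject.hom_ext _ _ fun _ => smash_hom_ext fun _ _ => rfl
  map_comp θ η := by
    refine (congrArg (smashMap (𝟙 K)) (simplexPlus.map_comp θ η)).trans ?_
    exact SimplicialObject.hom_ext _ _ fun _ => smash_hom_ext fun _ _ => rfl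

/-- The functor `L ↦ L ∧ S^1`. -/
def suspend : PSSet.{u} ⥤ PSSet.{u} where
  obj L := smash L circle
  map φ := smashMap φ (𝟙 _)
  map_id _ := SimplicialObject.hom_ext _ _ fun _ => smash_hom_ext fun _ _ => rfl
  map_comp _ _ := SimplicialObject.hom_ext _ _ fun _ => smash_hom_ext fun _ _ => rfl

/-- The `n`-th space `Z^n(K ∧ Δ^•_+)` of the cocycle spectrum, a simplicial vector space. -/
noncomputable def cocycleSpace (n : ℤ) (K : PSSet.{u}) : SimplicialObject (ModuleCat.{u} ℝ) :=
  (cylinders K).op ⋙ cocyclesFunctor V n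

/-- The simplicial vector space `Z^n(K ∧ Δ^•_+ ∧ S^1)`. -/
noncomputable def suspCocycleSpace (n : ℤ) (K : PSSet.{u}) : SimplicialObject (ModuleCat.{u} ℝ) :=
  (cylinders K ⋙ suspend).op ⋙ cocyclesFunctor V n

/-- The map `Z^n(K' ∧ Δ^•_+) → Z^n(K ∧ Δ^•_+)` induced by `φ : K → K'`. -/
noncomputable def cocycleSpaceMap (n : ℤ) {K K' : PSSet.{u}} (φ : K ⟶ K') :
    cocycleSpace V n K' ⟶ cocycleSpace V n K where
  app k := (cocyclesFunctor V n).map (smashMap φ (𝟙 (simplexPlus.obj k.unop))).op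
  naturality a b θ := by
    refine ((cocyclesFunctor V n).map_comp _ _).symm.trans
      (Eq.trans (congrArg _ (Quiver.Hom.unop_inj ?_)) ((cocyclesFunctor V n).map_comp _ _))
    exact SimplicialObject.hom_ext _ _ fun _ => smash_hom_ext fun _ _ => rfl

variable {V} in
lemma slantCircle_natural {K L : PSSet.{u}} (φ : K ⟶ L) {m n : ℤ} (h : m + (1 : ℕ) = n)
    (u : cocycles V n (smash L circle)) :
    cocyclesPull φ (slantCircle L h u) =
      slantCircle K h (cocyclesPull (smashMap φ (𝟙 circle)) u) := by
  apply Subtype.ext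
  funext p
  refine LinearMap.ext fun c => congrArg (u.1 (p.right 1 h)) ?_
  have h := EZ_natural φ (𝟙 circle.{u}) p.1.1 1 c circleChain
  rwa [show chainMap (𝟙 circle.{u}) 1 circleChain = circleChain from chainMap_gen _ _ _] at h

/-- The linear part of the costructure map: pullback along
`C(K ∧ Δ^k_+) ⊗ ℤ[1] → C(K ∧ Δ^k_+) ⊗ C(S^1) → C(K ∧ Δ^k_+ ∧ S^1)`, that is,
`(psiLin f)(c) = f(EZ(c ⊗ [S^1]))`. -/
noncomputable def psiLin (n : ℤ) (K : PSSet.{u}) :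
    suspCocycleSpace V n K ⟶ cocycleSpace V (n - 1) K where
  app k := ModuleCat.ofHom (slantCircle (smash K (simplexPlus.obj k.unop)) (by push_cast; omega))
  naturality a b θ := ModuleCat.hom_ext (LinearMap.ext fun u =>
    (slantCircle_natural (smashMap (𝟙 K) (simplexPlus.map θ.unop)) (by push_cast; omega) u).symm)

/-- The pointed set underlying a vector space, with base point `0`. -/
def ptFunctor : ModuleCat.{u} ℝ ⥤ Pointed.{u} where
  obj M := ⟨M, 0⟩
  map f := ⟨fun x => f.hom x, map_zero _⟩

/-- The pointed simplicial set underlying a simplicial vector space, with base point `0`. -/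
def toPSSet : SimplicialObject (ModuleCat.{u} ℝ) ⥤ PSSet.{u} :=
  (SimplicialObject.whiskering _ _).obj ptFunctor.{u}

/-- The constant map at the base point. -/
def constHom (K L : PSSet.{u}) : K ⟶ L where
  app n := ⟨fun _ => (L.obj n).point, rfl⟩
  naturality _ _ f := Pointed.Hom.ext (funext fun _ => ((L.map f).map_point).symm)

/-- The loop space `ΩL` of a pointed simplicial set, `(ΩL)_k = Hom_*(Δ^k_+ ∧ S^1, L)`. -/
def loop : PSSet.{u} ⥤ PSSet.{u} where
  obj L :=
    { obj := fun k => ⟨smash (simplexPlus.obj k.unop) circle ⟶ L, constHom _ _⟩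
      map := fun θ => ⟨fun F => smashMap (simplexPlus.map θ.unop) (𝟙 circle) ≫ F, rfl⟩
      map_id := fun k => Pointed.Hom.ext (funext fun F => by
        refine Eq.trans (congrArg (fun φ => smashMap φ (𝟙 circle) ≫ F)
          (simplexPlus.map_id k.unop)) ?_
        exact SimplicialObject.hom_ext _ _ fun _ => smash_hom_ext fun _ _ => rfl)
      map_comp := fun θ η => Pointed.Hom.ext (funext fun F => by
        refine Eq.trans (congrArg (fun φ => smashMap φ (𝟙 circle) ≫ F)
          (simplexPlus.map_comp η.unop θ.unop)) ?_
        exact SimplicialObject.hom_ext _ _ fun _ => smash_hom_ext fun _ _ => rfl) }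
  map {L L'} φ :=
    { app := fun k => ⟨fun F => F ≫ φ,
        SimplicialObject.hom_ext _ _ fun n => Pointed.Hom.ext (funext fun _ => (φ.app n).map_point)⟩
      naturality := fun _ _ _ => rfl }

/-- The associativity map `(K ∧ L) ∧ M → K ∧ (L ∧ M)`. -/
def smashAssocInv (K L M : PSSet.{u}) : smash (smash K L) M ⟶ smash K (smash L M) where
  app n := smashHom
    (smashLift (fun x y z => smk x (smk y z)) (fun _ => (smashPt (K.obj n) _).point)
      (fun y => funext fun z => smk_left _)
      (fun x => funext fun z => by rw [smk_left]; exact smk_right _))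
    (fun z => by exact smk_left _)
    (smash_ind fun x y => by
      change smk x (smk y (M.obj n).point) = _
      rw [smk_right]; exact smk_right _)
  naturality _ _ _ :=
    Pointed.Hom.ext (funext (smash_ind (smash_ind fun _ _ _ => rfl)))

/-- The pointed map `Δ^m_+ → L` classifying an `m`-simplex `l` of `L`. -/
def classify {L : PSSet.{u}} {m : SimplexCategoryᵒᵖ} (l : (L.obj m).X) :
    simplexPlus.obj m.unop ⟶ L where
  app n := ⟨fun o => Option.elim o (L.obj n).point
    fun a => (L.map (SSet.stdSimplex.objEquiv a).op).toFun l, rfl⟩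
  naturality n n' f := by
    refine Pointed.Hom.ext (funext fun o => ?_)
    cases o with
    | none => exact ((L.map f).map_point).symm
    | some a => exact (map_comp_toFun L (SSet.stdSimplex.objEquiv a).op f l).symm

variable {V}

lemma cocyclesPull_gen {n : ℤ} {K L : PSSet.{u}} (φ : K ⟶ L) (u : cocycles V n L) (p : Bideg n)
    (x : (K.obj (op ⦋p.1.1⦌)).X) :
    (cocyclesPull φ u).1 p (gen x) = u.1 p (gen ((φ.app (op ⦋p.1.1⦌)).toFun x)) :=
  congrArg (u.1 p) (chainMap_gen φ p.1.1 x)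

/-- The map `Z^n(K ∧ L) → Hom_*(L, Z^n(K ∧ Δ^•_+))`. -/
noncomputable def curry {n : ℤ} {K L : PSSet.{u}} (u : cocycles V n (smash K L)) :
    L ⟶ toPSSet.obj (cocycleSpace V n K) where
  app m := ⟨fun l => cocyclesPull (smashMap (𝟙 K) (classify l)) u, by
    refine Subtype.ext (cochain_ext fun p => smash_ind fun x o => ?_)
    rw [cocyclesPull_gen]
    refine Eq.trans (congrArg (u.1 p) ?_) (map_zero (u.1 p))
    cases o with
    | none => exact gen_smk_right _
    | some a =>
      refine Eq.trans ?_ (gen_smk_right x)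
      exact congrArg (fun l => gen (smk x l)) (L.map (SSet.stdSimplex.objEquiv a).op).map_point⟩
  naturality m m' f := by
    refine Pointed.Hom.ext (funext fun l => Subtype.ext ?_)
    refine cochain_ext fun p => smash_ind fun x o => ?_
    refine (cocyclesPull_gen _ _ _ _).trans (Eq.trans ?_ (cocyclesPull_gen _ _ _ _).symm)
    refine Eq.trans (congrArg (u.1 p) ?_) (cocyclesPull_gen _ _ _ _).symm
    cases o with
    | none => rfl
    | some a =>
      exact congrArg (fun l => gen (smk x l))
        (map_comp_toFun L f (SSet.stdSimplex.objEquiv a).op l)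

/-- The cocycle on `K ∧ Δ^m_+` that a map `F : L → Z^n(K ∧ Δ^•_+)` assigns to an `m`-simplex. -/
def valAt {n : ℤ} {K L : PSSet.{u}} (F : L ⟶ toPSSet.obj (cocycleSpace V n K))
    {m : SimplexCategoryᵒᵖ} (l : (L.obj m).X) : cocycles V n (smash K (simplexPlus.obj m.unop)) :=
  (F.app m).toFun l

lemma valAt_point {n : ℤ} {K L : PSSet.{u}} (F : L ⟶ toPSSet.obj (cocycleSpace V n K))
    (m : SimplexCategoryᵒᵖ) : valAt F (L.obj m).point = 0 :=
  (F.app m).map_point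

lemma valAt_map {n : ℤ} {K L : PSSet.{u}} (F : L ⟶ toPSSet.obj (cocycleSpace V n K))
    {m m' : SimplexCategoryᵒᵖ} (f : m ⟶ m') (l : (L.obj m).X) :
    valAt F ((L.map f).toFun l) =
      cocyclesPull (smashMap (𝟙 K) (simplexPlus.map f.unop)) (valAt F l) :=
  naturality_toFun F f l

/-- The value on `x ∧ l` of the cocycle associated with a map `F : L → Z^n(K ∧ Δ^•_+)`. -/
noncomputable def uncurryVal {n : ℤ} {K L : PSSet.{u}} (F : L ⟶ toPSSet.obj (cocycleSpace V n K))
    (p : Bideg n) (x : (K.obj (op ⦋p.1.1⦌)).X) (l : (L.obj (op ⦋p.1.1⦌)).X) : V p.1.2 :=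
  (valAt F l).1 p (gen (smk x (topSimplex p.1.1)))

lemma uncurryVal_left {n : ℤ} {K L : PSSet.{u}} (F : L ⟶ toPSSet.obj (cocycleSpace V n K))
    (p : Bideg n) (l : (L.obj (op ⦋p.1.1⦌)).X) : uncurryVal F p (K.obj _).point l = 0 := by
  refine (congrArg ((valAt F l).1 p) (gen_smk_left _)).trans (map_zero _)

lemma uncurryVal_right {n : ℤ} {K L : PSSet.{u}} (F : L ⟶ toPSSet.obj (cocycleSpace V n K))
    (p : Bideg n) (x : (K.obj (op ⦋p.1.1⦌)).X) : uncurryVal F p x (L.obj _).point = 0 := by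
  unfold uncurryVal
  rw [valAt_point]; rfl

/-- The cochain associated with a map `F : L → Z^n(K ∧ Δ^•_+)`. -/
noncomputable def uncurryCochain {n : ℤ} {K L : PSSet.{u}}
    (F : L ⟶ toPSSet.obj (cocycleSpace V n K)) : Cochain V n (smash K L) :=
  fun p => redLift (smashLift (uncurryVal F p) 0 (uncurryVal_left F p) (uncurryVal_right F p))
    (uncurryVal_left F p _)

lemma uncurryCochain_gen {n : ℤ} {K L : PSSet.{u}} (F : L ⟶ toPSSet.obj (cocycleSpace V n K))
    (p : Bideg n) (x : (K.obj (op ⦋p.1.1⦌)).X) (l : (L.obj (op ⦋p.1.1⦌)).X) :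
    uncurryCochain F p (gen (smk x l)) = (valAt F l).1 p (gen (smk x (topSimplex p.1.1))) :=
  redLift_gen _ _ _

lemma uncurry_mem {n : ℤ} {K L : PSSet.{u}} (F : L ⟶ toPSSet.obj (cocycleSpace V n K)) :
    uncurryCochain F ∈ cocycles V n (smash K L) := by
  intro p
  refine redFree_ext (smash_ind fun x l => ?_)
  refine Eq.trans ?_ (LinearMap.congr_fun ((valAt F l).2 p) (gen (smk x (topSimplex _))))
  simp only [bd, LinearMap.comp_apply, LinearMap.sum_apply, LinearMap.smul_apply, map_sum, map_smul,
    redMap_gen]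
  refine Finset.sum_congr rfl fun a _ => congrArg _ ?_
  refine (uncurryCochain_gen F p ((K.δ a).toFun x) ((L.δ a).toFun l)).trans ?_
  refine (congrArg (fun u : cocycles V n _ => u.1 p _)
    (valAt_map F (SimplexCategory.δ a).op l)).trans ?_
  refine (cocyclesPull_gen _ _ _ _).trans ?_
  rfl

/-- The inverse map `Hom_*(L, Z^n(K ∧ Δ^•_+)) → Z^n(K ∧ L)`. -/
noncomputable def uncurry {n : ℤ} {K L : PSSet.{u}} (F : L ⟶ toPSSet.obj (cocycleSpace V n K)) :
    cocycles V n (smash K L) :=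
  ⟨uncurryCochain F, uncurry_mem F⟩

lemma uncurry_curry {n : ℤ} {K L : PSSet.{u}} (u : cocycles V n (smash K L)) :
    uncurry (curry u) = u := by
  refine Subtype.ext (cochain_ext fun p => smash_ind fun x l => ?_)
  refine (uncurryCochain_gen _ _ _ _).trans ?_
  refine (cocyclesPull_gen _ _ _ _).trans ?_
  exact congrArg (fun l => u.1 p (gen (smk x l))) (map_id_toFun L l)

lemma curry_uncurry {n : ℤ} {K L : PSSet.{u}} (F : L ⟶ toPSSet.obj (cocycleSpace V n K)) :
    curry (uncurry F) = F := by
  refine SimplicialObject.hom_ext _ _ fun m => Pointed.Hom.ext (funext fun l => ?_)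
  change cocyclesPull (smashMap (𝟙 K) (classify l)) (uncurry F) = valAt F l
  refine Subtype.ext (cochain_ext fun p => smash_ind fun x o => ?_)
  refine (cocyclesPull_gen _ _ _ _).trans ?_
  cases o with
  | none =>
    refine ((congrArg ((uncurry F).1 p) (gen_smk_right _)).trans (map_zero _)).trans ?_
    exact ((congrArg ((valAt F l).1 p) (gen_smk_right _)).trans (map_zero _)).symm
  | some a =>
    refine (uncurryCochain_gen _ _ _ _).trans ?_
    refine (congrArg (fun u : cocycles V n _ => u.1 p _)
      (valAt_map F (SSet.stdSimplex.objEquiv a).op l)).trans ?_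
    refine (cocyclesPull_gen _ _ _ _).trans ?_
    refine congrArg (fun b => (valAt F l).1 p (gen (smk x (some b)))) ?_
    change SSet.stdSimplex.objEquiv.symm (𝟙 _ ≫ SSet.stdSimplex.objEquiv a) = a
    rw [Category.id_comp]
    exact Equiv.symm_apply_apply _ a

variable (V)

/-- The isomorphism `ΩZ^n(K ∧ Δ^•_+) ≅ Z^n(K ∧ Δ^•_+ ∧ S^1)`: a `k`-simplex of the loop space is a
pointed map `F : Δ^k_+ ∧ S^1 → Z^n(K ∧ Δ^•_+)`, and the corresponding cocycle has the value
`F(a ∧ t)(x ∧ id)` on `x ∧ a ∧ t`. -/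
noncomputable def loopIso (n : ℤ) (K : PSSet.{u}) :
    loop.obj (toPSSet.obj (cocycleSpace V n K)) ≅ toPSSet.obj (suspCocycleSpace V n K) :=
  NatIso.ofComponents
    (fun k => Pointed.Iso.mk
      { toFun := fun F => cocyclesPull (smashAssocInv K (simplexPlus.obj k.unop) circle) (uncurry F)
        invFun := fun u => curry (cocyclesPull (smashAssoc K (simplexPlus.obj k.unop) circle) u)
        left_inv := fun F => by
          refine (congrArg curry ?_).trans (curry_uncurry F)
          refine Subtype.ext (cochain_ext fun p => smash_ind fun x => smash_ind fun a t => ?_)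
          exact (cocyclesPull_gen _ _ _ _).trans (cocyclesPull_gen _ _ _ _)
        right_inv := fun u => by
          refine Eq.trans (congrArg
            (cocyclesPull (smashAssocInv K (simplexPlus.obj k.unop) circle))
            (uncurry_curry (cocyclesPull (smashAssoc K (simplexPlus.obj k.unop) circle) u))) ?_
          refine Subtype.ext (cochain_ext fun p => smash_ind (smash_ind fun x a t => ?_))
          exact (cocyclesPull_gen _ _ _ _).trans (cocyclesPull_gen _ _ _ _) }
      (by
        refine Subtype.ext (cochain_ext fun p => smash_ind (smash_ind fun x a t => ?_))
        exact (cocyclesPull_gen _ _ _ _).trans (uncurryCochain_gen _ _ _ _)))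
    (fun θ => by
      refine Pointed.Hom.ext (funext fun F => ?_)
      change cocyclesPull (smashAssocInv K _ circle)
          (uncurry (smashMap (simplexPlus.map θ.unop) (𝟙 circle) ≫ F)) =
        cocyclesPull (smashMap (smashMap (𝟙 K) (simplexPlus.map θ.unop)) (𝟙 circle))
          (cocyclesPull (smashAssocInv K _ circle) (uncurry F))
      refine Subtype.ext (cochain_ext fun p => smash_ind (smash_ind fun x a t => ?_))
      rw [cocyclesPull_gen, cocyclesPull_gen, cocyclesPull_gen]
      refine (uncurryCochain_gen _ p _ _).trans (Eq.trans ?_ (uncurryCochain_gen F p _ _).symm)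
      rfl)

/-- The costructure map `ψ : ΩZ^n(K ∧ Δ^•_+) ≅ Z^n(K ∧ Δ^•_+ ∧ S^1) → Z^{n-1}(K ∧ Δ^•_+)`. -/
noncomputable def psi (n : ℤ) (K : PSSet.{u}) :
    loop.obj (toPSSet.obj (cocycleSpace V n K)) ⟶ toPSSet.obj (cocycleSpace V (n - 1) K) :=
  (loopIso V n K).hom ≫ toPSSet.map (psiLin V n K)

end Spectrum

/-! ### Homotopy classes and weak equivalences -/

/-- The simplicial set underlying a pointed simplicial set. -/
def toSSet (L : PSSet.{u}) : SSet.{u} where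
  obj n := (L.obj n).X
  map f := ↾(L.map f).toFun
  map_id n := by ext x; exact map_id_toFun L x
  map_comp f g := by ext x; exact (map_comp_toFun L f g x).symm

/-- The map of simplicial sets underlying a map of pointed simplicial sets. -/
def toSSetMap {L L' : PSSet.{u}} (φ : L ⟶ L') : toSSet L ⟶ toSSet L' where
  app n := ↾(φ.app n).toFun
  naturality a b f := by ext x; exact naturality_toFun φ f x

/-- `π_k(X, x)`: homotopy classes, relative to the boundary, of maps `Δ^k → X` which are constant
with value `x` on `∂Δ^k`. (These are the simplicial homotopy groups when `X` is a Kan complex.) -/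
abbrev PiAt (k : ℕ) (X : SSet.{u}) (x : X _⦋0⦌) : Type u :=
  SSet.RelativeMorphism.HomotopyClass (SSet.boundary k) (SSet.Subcomplex.ofSimplex x)
    (SSet.const ⟨x, SSet.Subcomplex.mem_ofSimplex_obj x⟩)

/-- The map `π_k(X, x) → π_k(Y, y)` induced by `f : X → Y` with `f(x) = y`. -/
def piAtMap (k : ℕ) {X Y : SSet.{u}} (f : X ⟶ Y) (x : X _⦋0⦌) (y : Y _⦋0⦌)
    (h : f.app _ x = y) (c : PiAt k X x) : PiAt k Y y :=
  c.postcomp (SSet.RelativeMorphism.ofSimplex₀ f x y h) (by subst h; rfl)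

/-- A map of Kan complexes is a weak equivalence if it induces a bijection on path components and
on all homotopy groups at all vertices. -/
structure IsKanWeakEquivalence {X Y : SSet.{u}} (f : X ⟶ Y) : Prop where
  kan_source : SSet.KanComplex X
  kan_target : SSet.KanComplex Y
  bijective_zero : Function.Bijective (SSet.mapπ₀ f)
  bijective_succ : ∀ (k : ℕ) (x : X _⦋0⦌),
    Function.Bijective (piAtMap (k + 1) f x (f.app _ x) rfl)

/-- The homotopy classes `π_k(X, 0)` of a simplicial vector space, at the base point `0`. -/
abbrev PiVect (k : ℕ) (X : SimplicialObject (ModuleCat.{u} ℝ)) : Type u :=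
  PiAt k (toSSet (toPSSet.obj X)) (0 : X.obj (op ⦋0⦌))

/-- The map `π_k(X, 0) → π_k(Y, 0)` induced by a map of simplicial vector spaces. -/
def piVectMap (k : ℕ) {X Y : SimplicialObject (ModuleCat.{u} ℝ)} (f : X ⟶ Y)
    (c : PiVect k X) : PiVect k Y :=
  piAtMap k (toSSetMap (toPSSet.map f)) _ _ (map_zero (f.app (op ⦋0⦌)).hom) c

section SlantIsomorphisms

variable {V : ℤ → Type u} [∀ j, AddCommGroup (V j)] [∀ j, Module ℝ (V j)]

/-- `Φ : π_k(X, 0) → H^m(K; V)` is an isomorphism that sends the class of a `k`-simplex `f` with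
trivial boundary to the cohomology class of the cochain `S f` (which is a cocycle), and which is
additive for the composition of homotopy classes when `k ≥ 1`. -/
structure IsIsoInducedBy {k : ℕ} {X : SimplicialObject (ModuleCat.{u} ℝ)} {m : ℤ} {K : PSSet.{u}}
    (S : X.obj (op ⦋k⦌) → Cochain V m K) (Φ : PiVect k X → Coh V m K) : Prop where
  bijective : Function.Bijective Φ
  apply_class : ∀ f : (toSSet (toPSSet.obj X)).PtSimplex k (0 : X.obj (op ⦋0⦌)),
    ∃ hf : S (SSet.yonedaEquiv f.map) ∈ cocycles V m K, Φ f.homotopyClass = coh _ hf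
  map_mul : ∀ (i : Fin k) (f g fg : (toSSet (toPSSet.obj X)).PtSimplex k (0 : X.obj (op ⦋0⦌))),
    Nonempty (SSet.PtSimplex.MulStruct f g fg i) →
      Φ fg.homotopyClass = Φ f.homotopyClass + Φ g.homotopyClass

/-- The slant product `f ↦ f/[Δ^k_+]` on the `k`-simplices of `Z^n(K ∧ Δ^•_+)`. -/
noncomputable def slantSimplex {m n : ℤ} (k : ℕ) (h : m + k = n) (K : PSSet.{u})
    (f : (cocycleSpace V n K).obj (op ⦋k⦌)) : Cochain V m K :=
  slant (simplexChain k) h (Subtype.val (p := (· ∈ cocycles V n _)) f)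

/-- The slant product `f ↦ f/[Δ^k_+]` on the `k`-simplices of
`Z^n(K ∧ Δ^•_+ ∧ S^1) ≅ Z^n((K ∧ S^1) ∧ Δ^•_+)`. -/
noncomputable def slantSimplexSusp {m n : ℤ} (k : ℕ) (h : m + k = n) (K : PSSet.{u})
    (f : (suspCocycleSpace V n K).obj (op ⦋k⦌)) : Cochain V m (smash K circle) :=
  slant (simplexChain k) h
    (pull (smashAssocInv K circle (simplexPlus.obj ⦋k⦌) ≫
      smashMap (𝟙 K) (smashSwap circle (simplexPlus.obj ⦋k⦌)) ≫
      smashAssoc K (simplexPlus.obj ⦋k⦌) circle) (Subtype.val (p := (· ∈ cocycles V n _)) f))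

/-- The slant product `σ ↦ f(EZ(Δ^k ⊗ σ))` with `[Δ^k_+]` in front on the `k`-simplices of
`Z^n(K ∧ Δ^•_+) ≅ Z^n(Δ^•_+ ∧ K)`. -/
noncomputable def slantSimplexFront {m n : ℤ} (k : ℕ) (h : m + k = n) (K : PSSet.{u})
    (f : (cocycleSpace V n K).obj (op ⦋k⦌)) : Cochain V m K :=
  slantFront (simplexChain k) h
    (pull (smashSwap (simplexPlus.obj ⦋k⦌) K) (Subtype.val (p := (· ∈ cocycles V n _)) f))

/-- The slant product `σ ↦ f(EZ(Δ^k ⊗ σ))` with `[Δ^k_+]` in front on the `k`-simplices of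
`Z^n(K ∧ Δ^•_+ ∧ S^1) ≅ Z^n(Δ^•_+ ∧ (K ∧ S^1))`. -/
noncomputable def slantSimplexSuspFront {m n : ℤ} (k : ℕ) (h : m + k = n) (K : PSSet.{u})
    (f : (suspCocycleSpace V n K).obj (op ⦋k⦌)) : Cochain V m (smash K circle) :=
  slantFront (simplexChain k) h
    (pull (smashAssoc (simplexPlus.obj ⦋k⦌) K circle ≫
      smashMap (smashSwap (simplexPlus.obj ⦋k⦌) K) (𝟙 circle))
      (Subtype.val (p := (· ∈ cocycles V n _)) f))

end SlantIsomorphisms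

end CocycleSpectrum

/-!
The costructure map slants with `[S^1]`, and homotopy groups of the cocycle spaces are read off by
slanting with `[Δ^k_+]`. The two operations act on different factors, so they commute up to a sign
and up to coboundaries, and the proposition reduces to two facts: slanting with `[Δ^k_+]` identifies
`π_k` of a cocycle space with cohomology, and slanting with `[S^1]` is the suspension isomorphism.

The common tool is the Leibniz rule `bd_ezN` for the Eilenberg-Zilber map, an identity between
signed sums over lattice paths (`sum_shuffle_faces`). Dually it gives Stokes' formulas for slant
products (`slant_cobd`, `slantFront_cobd`) and the homotopy invariance of cohomology
(`exists_homotopy_cobd`) by an explicit cochain homotopy, which is natural and hence vanishes where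
the cocycle does. The two slant products with `[Δ^k_+]` are treated together: `IsSimplexSlant ε`
records the normalization for `k = 0` and Stokes' formula, whose only difference is a sign `ε = ±1`.

*Slanting with simplices.* A `k`-simplex of the cocycle space with zero boundary is a cocycle `f` on
`K ∧ Δ^k_+` that vanishes on `K ∧ ∂Δ^k_+`. Contracting `Δ^k` to its vertex `0` yields a cochain `G`
with `δG = f` that vanishes on all faces but the one opposite to `0` (`exists_primitive`), and by
Stokes' formula `f` slanted with `[Δ^k_+]` is cohomologous to the remaining face of `G` slanted with
`[Δ^{k-1}_+]` (`IsSimplexSlant.step`). Conversely, a cochain on the face opposite to `0` that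
vanishes on the boundary extends by zero to `Δ^k` (`extendFace`). Induction on `k` shows that
slanting takes such cocycles to cocycles, that each cohomology class is attained, that `f` is null
homotopic if its slant product is a coboundary, and that slanting commutes with `[S^1]` up to
`ε^k` (`IsSimplexSlant.isCobd_desuspend`).

*The suspension.* The cone `K ∧ Δ^1` is contractible, so the pullback of a cocycle `u` on `K ∧ S^1`
is some `δg`, and since `∂[Δ^1]` is the vertex `1`, Stokes' formula computes the slant product of
`u` with `[S^1]` as the restriction of `g` to `K`, up to signs and a coboundary
(`slantCircle_of_cone`). Bijectivity follows by extending cochains on the base of the cone by zero.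

*Homotopy groups.* A simplicial vector space is a Kan complex by Moore's argument. Homotopic
simplices differ by an alternating sum of faces, by evaluating a homotopy on the shuffle product of
`[Δ^k_+]` and `[Δ^1_+]` (`exists_of_homotopy`); conversely a difference that is the face opposite to
`0` of a simplex with no other nonzero face yields a homotopy by contracting `Δ^{k+1}`
(`homotopyClass_eq`). Hence a linear map with the properties `Detects` induces an isomorphism from
`π_k` to cohomology, and because differences of simplices with equal constant boundary are simplices
with zero boundary, it also controls `π_k` at every other base vertex (`bijective_piAtMap`).
-/

namespace CocycleSpectrum

set_option linter.unusedSectionVars false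

/-! ### The Leibniz rule for the Eilenberg-Zilber map -/

/-- The sign of a shuffle, for an arbitrary set of steps. -/
def stepSign {N : ℕ} (s : Finset (Fin N)) : ℤ :=
  (-1) ^ ((s ×ˢ sᶜ).filter fun x => x.2 < x.1).card

/-- The number of steps in `s` that precede the vertex `i`. -/
def stepCount {N : ℕ} (s : Finset (Fin N)) (i : Fin (N + 1)) : ℕ :=
  (s.filter fun j => j.castSucc < i).card

/-- The lattice path of a shuffle: its vertices count the steps in `s` and in `sᶜ`. -/
def latticePath {N : ℕ} (s : Finset (Fin N)) (i : Fin (N + 1)) : ℕ × ℕ :=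
  (stepCount s i, stepCount sᶜ i)

/-- The set of steps `t`, followed by one more step that is not in the set. -/
def skipLast {N : ℕ} (t : Finset (Fin N)) : Finset (Fin (N + 1)) := t.map Fin.castSuccEmb

/-- The set of steps `t`, followed by one more step in the set. -/
def takeLast {N : ℕ} (t : Finset (Fin N)) : Finset (Fin (N + 1)) :=
  insert (Fin.last N) (skipLast t)

lemma mem_skipLast {N : ℕ} (t : Finset (Fin N)) (j : Fin N) : j.castSucc ∈ skipLast t ↔ j ∈ t := by
  simp [skipLast]

lemma last_notMem_skipLast {N : ℕ} (t : Finset (Fin N)) : Fin.last N ∉ skipLast t := by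
  simp [skipLast, Fin.castSucc_ne_last]

lemma mem_takeLast {N : ℕ} (t : Finset (Fin N)) (j : Fin N) : j.castSucc ∈ takeLast t ↔ j ∈ t := by
  simp [takeLast, mem_skipLast, Fin.castSucc_ne_last]

lemma last_mem_takeLast {N : ℕ} (t : Finset (Fin N)) : Fin.last N ∈ takeLast t := by
  simp [takeLast]

lemma compl_skipLast {N : ℕ} (t : Finset (Fin N)) : (skipLast t)ᶜ = takeLast tᶜ := by
  ext j
  induction j using Fin.lastCases with
  | last => simp [last_notMem_skipLast, last_mem_takeLast]
  | cast j => simp [mem_skipLast, mem_takeLast]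

lemma compl_takeLast {N : ℕ} (t : Finset (Fin N)) : (takeLast t)ᶜ = skipLast tᶜ := by
  rw [compl_eq_comm, compl_skipLast, compl_compl]

lemma card_skipLast {N : ℕ} (t : Finset (Fin N)) : (skipLast t).card = t.card :=
  Finset.card_map _

lemma card_takeLast {N : ℕ} (t : Finset (Fin N)) : (takeLast t).card = t.card + 1 := by
  rw [takeLast, Finset.card_insert_of_notMem (last_notMem_skipLast t), card_skipLast]

lemma sum_finset_succ {N : ℕ} {A : Type*} [AddCommMonoid A] (g : Finset (Fin (N + 1)) → A) :
    ∑ s, g s = ∑ t, (g (skipLast t) + g (takeLast t)) := by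
  have e : (Finset.univ : Finset (Finset (Fin (N + 1)))) =
      (Finset.univ : Finset (Finset (Fin N))).image skipLast ∪
        (Finset.univ : Finset (Finset (Fin N))).image takeLast := by
    ext s
    simp only [Finset.mem_univ, Finset.mem_union, Finset.mem_image, true_and, true_iff]
    by_cases h : Fin.last N ∈ s
    · refine Or.inr ⟨Finset.univ.filter fun j => j.castSucc ∈ s, ?_⟩
      ext j
      induction j using Fin.lastCases with
      | last => simp [h, last_mem_takeLast]
      | cast j => simp [mem_takeLast]
    · refine Or.inl ⟨Finset.univ.filter fun j => j.castSucc ∈ s, ?_⟩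
      ext j
      induction j using Fin.lastCases with
      | last => simp [h, last_notMem_skipLast]
      | cast j => simp [mem_skipLast]
  rw [e, Finset.sum_union, Finset.sum_image, Finset.sum_image, Finset.sum_add_distrib]
  · intro s _ t _ h
    ext j
    rw [← mem_takeLast s, h, mem_takeLast]
  · intro s _ t _ h
    ext j
    rw [← mem_skipLast s, h, mem_skipLast]
  · rw [Finset.disjoint_left]
    intro s hs ht
    obtain ⟨a, -, rfl⟩ := Finset.mem_image.1 hs
    obtain ⟨b, -, h⟩ := Finset.mem_image.1 ht
    exact last_notMem_skipLast a (h ▸ last_mem_takeLast b)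

lemma stepCount_skipLast_castSucc {N : ℕ} (t : Finset (Fin N)) (i : Fin (N + 1)) :
    stepCount (skipLast t) i.castSucc = stepCount t i := by
  unfold stepCount skipLast
  rw [Finset.filter_map, Finset.card_map]
  rfl

lemma stepCount_takeLast_castSucc {N : ℕ} (t : Finset (Fin N)) (i : Fin (N + 1)) :
    stepCount (takeLast t) i.castSucc = stepCount t i := by
  refine Eq.trans ?_ (stepCount_skipLast_castSucc t i)
  rw [stepCount, takeLast, Finset.filter_insert,
    if_neg (Fin.castSucc_lt_castSucc_iff.not.2 (Fin.le_last _).not_gt)]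
  rfl

lemma stepCount_last {N : ℕ} (t : Finset (Fin N)) : stepCount t (Fin.last N) = t.card := by
  unfold stepCount
  rw [Finset.filter_true_of_mem fun j _ => Fin.castSucc_lt_last j]

lemma stepCount_le {N : ℕ} (t : Finset (Fin N)) (i : Fin (N + 1)) : stepCount t i ≤ t.card :=
  Finset.card_filter_le _ _

lemma latticePath_skipLast {N : ℕ} (t : Finset (Fin N)) :
    latticePath (skipLast t) =
      Fin.snoc (α := fun _ => ℕ × ℕ) (latticePath t) (t.card, tᶜ.card + 1) := by
  funext i
  induction i using Fin.lastCases with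
  | last =>
    rw [Fin.snoc_last, latticePath, stepCount_last, stepCount_last, compl_skipLast, card_skipLast,
      card_takeLast]
  | cast i =>
    rw [Fin.snoc_castSucc, latticePath, compl_skipLast, stepCount_skipLast_castSucc,
      stepCount_takeLast_castSucc]
    rfl

lemma latticePath_takeLast {N : ℕ} (t : Finset (Fin N)) :
    latticePath (takeLast t) =
      Fin.snoc (α := fun _ => ℕ × ℕ) (latticePath t) (t.card + 1, tᶜ.card) := by
  funext i
  induction i using Fin.lastCases with
  | last =>
    rw [Fin.snoc_last, latticePath, stepCount_last, stepCount_last, compl_takeLast, card_skipLast,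
      card_takeLast]
  | cast i =>
    rw [Fin.snoc_castSucc, latticePath, compl_takeLast, stepCount_skipLast_castSucc,
      stepCount_takeLast_castSucc]
    rfl

lemma stepSign_skipLast {N : ℕ} (t : Finset (Fin N)) : stepSign (skipLast t) = stepSign t := by
  unfold stepSign
  congr 1
  symm
  refine Finset.card_bij (fun x _ => (x.1.castSucc, x.2.castSucc)) ?_ ?_ ?_
  · rintro ⟨a, b⟩ h
    simp only [Finset.mem_filter, Finset.mem_product, compl_skipLast, mem_skipLast,
      mem_takeLast] at h ⊢
    exact h
  · rintro ⟨a, b⟩ _ ⟨c, d⟩ _ h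
    simpa using h
  · rintro ⟨a, b⟩ h
    simp only [Finset.mem_filter, Finset.mem_product, compl_skipLast] at h
    induction a using Fin.lastCases with
    | last => exact absurd h.1.1 (last_notMem_skipLast t)
    | cast a =>
      induction b using Fin.lastCases with
      | last => exact absurd h.2 (Fin.castSucc_lt_last a).not_gt
      | cast b =>
        simp only [mem_skipLast, mem_takeLast] at h
        exact ⟨(a, b), by simpa using h, rfl⟩

lemma stepSign_takeLast {N : ℕ} (t : Finset (Fin N)) :
    stepSign (takeLast t) = (-1) ^ tᶜ.card * stepSign t := by
  unfold stepSign
  rw [compl_takeLast, takeLast, Finset.insert_eq, Finset.union_product, Finset.filter_union,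
    Finset.card_union_of_disjoint, pow_add]
  · congr 1
    · congr 1
      rw [Finset.filter_true_of_mem, Finset.card_product, Finset.card_singleton, one_mul,
        card_skipLast]
      rintro ⟨a, b⟩ hx
      obtain ⟨ha, hb⟩ := Finset.mem_product.1 hx
      obtain rfl := Finset.mem_singleton.1 ha
      obtain ⟨b, -, rfl⟩ := Finset.mem_map.1 hb
      exact Fin.castSucc_lt_last b
    · congr 1
      symm
      refine Finset.card_bij (fun x _ => (x.1.castSucc, x.2.castSucc)) ?_ ?_ ?_
      · rintro ⟨a, b⟩ h
        simp only [Finset.mem_filter, Finset.mem_product, mem_skipLast] at h ⊢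
        exact h
      · rintro ⟨a, b⟩ _ ⟨c, d⟩ _ h
        simpa using h
      · rintro ⟨a, b⟩ h
        simp only [Finset.mem_filter, Finset.mem_product] at h
        obtain ⟨⟨ha, hb⟩, h⟩ := h
        obtain ⟨a, ha, rfl⟩ := Finset.mem_map.1 ha
        obtain ⟨b, hb, rfl⟩ := Finset.mem_map.1 hb
        exact ⟨(a, b), Finset.mem_filter.2 ⟨Finset.mem_product.2 ⟨(mem_skipLast t a).1 ha,
          (mem_skipLast _ b).1 hb⟩, h⟩, rfl⟩
  · rw [Finset.disjoint_left]
    rintro ⟨a, b⟩ h h'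
    simp only [Finset.mem_filter, Finset.mem_product, Finset.mem_singleton] at h h'
    rw [h.1.1] at h'
    exact last_notMem_skipLast t h'.1.1

/-- The coface map `δ_b` on natural numbers. -/
def coface (b n : ℕ) : ℕ := if n < b then n else n + 1

lemma snoc_comp_succAbove_castSucc {M : ℕ} {B : Type*} (f : Fin (M + 1) → B) (v : B)
    (a : Fin (M + 1)) :
    (Fin.snoc (α := fun _ => B) f v : Fin (M + 2) → B) ∘ a.castSucc.succAbove =
      Fin.snoc (α := fun _ => B) (f ∘ a.succAbove) v := by
  funext i
  induction i using Fin.lastCases with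
  | last =>
    have : a.castSucc.succAbove (Fin.last M) = Fin.last (M + 1) :=
      Fin.succAbove_castSucc_of_le _ _ (Fin.le_last a)
    simp only [Function.comp_apply, this, Fin.snoc_last]
  | cast i =>
    have : a.castSucc.succAbove i.castSucc = (a.succAbove i).castSucc := by
      simp only [Fin.succAbove, Fin.lt_def, Fin.val_castSucc, Fin.succ_castSucc]
      split_ifs <;> rfl
    simp only [Function.comp_apply, this, Fin.snoc_castSucc]

lemma snoc_comp_succAbove_last {M : ℕ} {B : Type*} (f : Fin (M + 1) → B) (v : B) :
    (Fin.snoc (α := fun _ => B) f v : Fin (M + 2) → B) ∘ (Fin.last (M + 1)).succAbove = f := by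
  funext i
  simp

lemma endo_comp_snoc {M : ℕ} {B : Type*} (g : B → B) (f : Fin (M + 1) → B) (v : B) :
    g ∘ (Fin.snoc (α := fun _ => B) f v : Fin (M + 2) → B) =
      Fin.snoc (α := fun _ => B) (g ∘ f) (g v) := by
  funext i
  induction i using Fin.lastCases with
  | last => simp
  | cast i => simp

lemma coface_comp_latticePath_fst {N : ℕ} (t : Finset (Fin N)) :
    Prod.map (coface (t.card + 1)) id ∘ latticePath t = latticePath t := by
  funext i
  refine Prod.ext (if_pos ?_) rfl
  exact Nat.lt_succ_of_le (stepCount_le t i)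

lemma coface_comp_latticePath_snd {N : ℕ} (t : Finset (Fin N)) :
    Prod.map id (coface (tᶜ.card + 1)) ∘ latticePath t = latticePath t := by
  funext i
  refine Prod.ext rfl (if_pos ?_)
  exact Nat.lt_succ_of_le (stepCount_le tᶜ i)

lemma finset_fin_zero_sum {A : Type*} [AddCommMonoid A] (g : Finset (Fin 0) → A) :
    ∑ s, g s = g ∅ := by
  rw [Fintype.sum_unique]
  exact congrArg g (Subsingleton.elim _ _)

/-- The Leibniz rule as an identity between signed sums over lattice paths, for arbitrary
coefficients `Φ`: the faces of the paths in a `p × q` grid cancel in pairs across the corners, and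
what remains are the paths in the two smaller grids, embedded by the cofaces. The proof is by
induction on the length, splitting the paths by their last step. -/
lemma sum_shuffle_faces (M : ℕ) {A : Type*} [AddCommGroup A]
    (Φ : ℕ → ℕ → (Fin (M + 1) → ℕ × ℕ) → A) :
    ∑ s : Finset (Fin (M + 1)), stepSign s • ∑ a : Fin (M + 2),
        (-1 : ℤ) ^ (a : ℕ) • Φ s.card sᶜ.card (latticePath s ∘ a.succAbove) =
      ∑ t : Finset (Fin M), stepSign t •
        (∑ b ∈ Finset.range (t.card + 2), (-1 : ℤ) ^ b •
            Φ (t.card + 1) tᶜ.card (Prod.map (coface b) id ∘ latticePath t) +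
          (-1 : ℤ) ^ t.card • ∑ c ∈ Finset.range (tᶜ.card + 2), (-1 : ℤ) ^ c •
            Φ t.card (tᶜ.card + 1) (Prod.map id (coface c) ∘ latticePath t)) := by
  induction M generalizing A with
  | zero =>
    rw [sum_finset_succ, finset_fin_zero_sum, finset_fin_zero_sum]
    have h1 : ∀ f g : Fin 1 → ℕ × ℕ, f 0 = g 0 → f = g := fun f g h => by
      funext i; rwa [Subsingleton.elim i 0]
    have e0 : stepSign (∅ : Finset (Fin 0)) = 1 := rfl
    have e1 : stepSign (skipLast (∅ : Finset (Fin 0))) = 1 := rfl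
    have e2 : stepSign (takeLast (∅ : Finset (Fin 0))) = 1 := rfl
    have p1 : latticePath (skipLast (∅ : Finset (Fin 0))) ∘ (0 : Fin 2).succAbove =
        Prod.map id (coface 0) ∘ latticePath (∅ : Finset (Fin 0)) := h1 _ _ rfl
    have p2 : latticePath (skipLast (∅ : Finset (Fin 0))) ∘ (1 : Fin 2).succAbove =
        Prod.map id (coface 1) ∘ latticePath (∅ : Finset (Fin 0)) := h1 _ _ rfl
    have p3 : latticePath (takeLast (∅ : Finset (Fin 0))) ∘ (0 : Fin 2).succAbove =
        Prod.map (coface 0) id ∘ latticePath (∅ : Finset (Fin 0)) := h1 _ _ rfl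
    have p4 : latticePath (takeLast (∅ : Finset (Fin 0))) ∘ (1 : Fin 2).succAbove =
        Prod.map (coface 1) id ∘ latticePath (∅ : Finset (Fin 0)) := h1 _ _ rfl
    have c0 : ((∅ : Finset (Fin 0))ᶜ).card = 0 := rfl
    rw [Fin.sum_univ_two, Fin.sum_univ_two, p1, p2, p3, p4, e0, e1, e2, compl_skipLast,
      compl_takeLast, card_skipLast, card_skipLast, card_takeLast, card_takeLast, c0,
      Finset.card_empty]
    simp only [Finset.sum_range_succ, Finset.sum_range_zero, Fin.val_zero, Fin.val_one, pow_zero,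
      pow_one, one_smul, zero_add]
    abel
  | succ M ih =>
    -- the paths without their last step, with `Φ` modified to append that step
    have ih1 := ih (fun P Q f => Φ P (Q + 1) (Fin.snoc (α := fun _ => ℕ × ℕ) f (P, Q + 1)))
    have ih2 := ih (fun P Q f => (-1 : ℤ) ^ Q • Φ (P + 1) Q
      (Fin.snoc (α := fun _ => ℕ × ℕ) f (P + 1, Q)))
    -- split off the face at the last vertex, which drops the last step
    have hL : ∀ s : Finset (Fin (M + 1)),
        stepSign (skipLast s) • ∑ a : Fin (M + 3), (-1 : ℤ) ^ (a : ℕ) •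
            Φ (skipLast s).card (skipLast s)ᶜ.card (latticePath (skipLast s) ∘ a.succAbove) +
          stepSign (takeLast s) • ∑ a : Fin (M + 3), (-1 : ℤ) ^ (a : ℕ) •
            Φ (takeLast s).card (takeLast s)ᶜ.card (latticePath (takeLast s) ∘ a.succAbove) =
        (stepSign s • ∑ a : Fin (M + 2), (-1 : ℤ) ^ (a : ℕ) • Φ s.card (sᶜ.card + 1)
            (Fin.snoc (α := fun _ => ℕ × ℕ) (latticePath s ∘ a.succAbove) (s.card, sᶜ.card + 1)) +
          stepSign s • ∑ a : Fin (M + 2), (-1 : ℤ) ^ (a : ℕ) • ((-1 : ℤ) ^ sᶜ.card •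
            Φ (s.card + 1) sᶜ.card (Fin.snoc (α := fun _ => ℕ × ℕ)
              (latticePath s ∘ a.succAbove) (s.card + 1, sᶜ.card)))) +
        stepSign s • ((-1 : ℤ) ^ (s.card + 1) • Φ (s.card + 1) sᶜ.card (latticePath s) +
          (-1 : ℤ) ^ s.card • (-1 : ℤ) ^ (sᶜ.card + 1) • Φ s.card (sᶜ.card + 1) (latticePath s)) := by
      intro s
      rw [stepSign_skipLast, stepSign_takeLast, compl_skipLast, compl_takeLast, card_skipLast,
        card_skipLast, card_takeLast, card_takeLast, latticePath_skipLast, latticePath_takeLast,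
        Fin.sum_univ_castSucc (n := M + 2), Fin.sum_univ_castSucc (n := M + 2)]
      simp only [snoc_comp_succAbove_castSucc, snoc_comp_succAbove_last, Fin.val_castSucc,
        Fin.val_last]
      have hc : s.card + sᶜ.card = M + 1 := by rw [Finset.card_add_card_compl, Fintype.card_fin]
      have hM : ∀ m, s.card + sᶜ.card = m →
          (-1 : ℤ) ^ (m + 1) = -((-1) ^ s.card * (-1) ^ sᶜ.card) := by
        rintro m rfl
        rw [pow_succ, pow_add]; ring
      have hS : ∑ a : Fin (M + 2), (-1 : ℤ) ^ (a : ℕ) • ((-1 : ℤ) ^ sᶜ.card •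
            Φ (s.card + 1) sᶜ.card (Fin.snoc (α := fun _ => ℕ × ℕ)
              (latticePath s ∘ a.succAbove) (s.card + 1, sᶜ.card))) =
          (-1 : ℤ) ^ sᶜ.card • ∑ a : Fin (M + 2), (-1 : ℤ) ^ (a : ℕ) •
            Φ (s.card + 1) sᶜ.card (Fin.snoc (α := fun _ => ℕ × ℕ)
              (latticePath s ∘ a.succAbove) (s.card + 1, sᶜ.card)) := by
        rw [Finset.smul_sum]
        exact Finset.sum_congr rfl fun a _ => smul_comm _ _ _
      rw [hS, hM _ hc, pow_succ, pow_succ]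
      generalize (∑ a : Fin (M + 2), (-1 : ℤ) ^ (a : ℕ) • Φ (s.card + 1) sᶜ.card
        (Fin.snoc (α := fun _ => ℕ × ℕ) (latticePath s ∘ a.succAbove) (s.card + 1, sᶜ.card))) = X
      generalize (∑ a : Fin (M + 2), (-1 : ℤ) ^ (a : ℕ) • Φ s.card (sᶜ.card + 1)
        (Fin.snoc (α := fun _ => ℕ × ℕ) (latticePath s ∘ a.succAbove) (s.card, sᶜ.card + 1))) = Y
      rcases neg_one_pow_eq_or ℤ s.card with h1 | h1 <;>
        rcases neg_one_pow_eq_or ℤ sᶜ.card with h2 | h2 <;> rw [h1, h2] <;> module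
    -- the top cofaces fix the lattice path, and match the faces at the last vertex
    have hR : ∀ s : Finset (Fin (M + 1)),
        stepSign s • (∑ b ∈ Finset.range (s.card + 2), (-1 : ℤ) ^ b •
            Φ (s.card + 1) sᶜ.card (Prod.map (coface b) id ∘ latticePath s) +
          (-1 : ℤ) ^ s.card • ∑ c ∈ Finset.range (sᶜ.card + 2), (-1 : ℤ) ^ c •
            Φ s.card (sᶜ.card + 1) (Prod.map id (coface c) ∘ latticePath s)) =
        stepSign s • (∑ b ∈ Finset.range (s.card + 1), (-1 : ℤ) ^ b •
            Φ (s.card + 1) sᶜ.card (Prod.map (coface b) id ∘ latticePath s) +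
          (-1 : ℤ) ^ s.card • ∑ c ∈ Finset.range (sᶜ.card + 1), (-1 : ℤ) ^ c •
            Φ s.card (sᶜ.card + 1) (Prod.map id (coface c) ∘ latticePath s)) +
        stepSign s • ((-1 : ℤ) ^ (s.card + 1) • Φ (s.card + 1) sᶜ.card (latticePath s) +
          (-1 : ℤ) ^ s.card • (-1 : ℤ) ^ (sᶜ.card + 1) • Φ s.card (sᶜ.card + 1) (latticePath s)) := by
      intro s
      rw [Finset.sum_range_succ, Finset.sum_range_succ _ (sᶜ.card + 1),
        coface_comp_latticePath_fst, coface_comp_latticePath_snd]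
      module
    rw [sum_finset_succ, Finset.sum_congr rfl fun s _ => hL s, Finset.sum_congr rfl fun s _ => hR s]
    refine (Finset.sum_add_distrib.trans (congrArg₂ (· + ·) ?_ rfl)).trans
      Finset.sum_add_distrib.symm
    rw [Finset.sum_add_distrib, ih1, ih2, sum_finset_succ, ← Finset.sum_add_distrib]
    refine Finset.sum_congr rfl fun t _ => ?_
    rw [stepSign_skipLast, stepSign_takeLast, compl_skipLast, compl_takeLast, card_skipLast,
      card_skipLast, card_takeLast, card_takeLast, latticePath_skipLast, latticePath_takeLast]
    simp only [endo_comp_snoc, Prod.map_apply, id]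
    -- the cofaces `δ_b` with `b ≤ p` raise the last vertex `p` to `p + 1`
    have hb : ∀ p : ℕ, ∀ f : ℕ → ℕ → A, ∑ b ∈ Finset.range (p + 1), (-1 : ℤ) ^ b • f b (coface b p) =
        ∑ b ∈ Finset.range (p + 1), (-1 : ℤ) ^ b • f b (p + 1) := fun p f =>
      Finset.sum_congr rfl fun b hb => by
        rw [coface, if_neg (by simp only [Finset.mem_range] at hb; omega)]
    rw [hb t.card fun b x => Φ (t.card + 1) (tᶜ.card + 1) (Fin.snoc (α := fun _ => ℕ × ℕ)
        (Prod.map (coface b) id ∘ latticePath t) (x, tᶜ.card + 1)),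
      hb (tᶜ.card + 1) fun c x => Φ t.card (tᶜ.card + 1 + 1) (Fin.snoc (α := fun _ => ℕ × ℕ)
        (Prod.map id (coface c) ∘ latticePath t) (t.card, x)),
      hb (t.card + 1) fun b x => Φ (t.card + 1 + 1) tᶜ.card (Fin.snoc (α := fun _ => ℕ × ℕ)
        (Prod.map (coface b) id ∘ latticePath t) (x, tᶜ.card)),
      hb tᶜ.card fun c x => Φ (t.card + 1) (tᶜ.card + 1) (Fin.snoc (α := fun _ => ℕ × ℕ)
        (Prod.map id (coface c) ∘ latticePath t) (t.card + 1, x))]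
    have hs : ∀ (r : ℤ) (m : ℕ) (f : ℕ → A), ∑ b ∈ Finset.range m, (-1 : ℤ) ^ b • r • f b =
        r • ∑ b ∈ Finset.range m, (-1 : ℤ) ^ b • f b := fun r m f => by
      rw [Finset.smul_sum]
      exact Finset.sum_congr rfl fun b _ => smul_comm _ _ _
    rw [hs, hs, Finset.sum_range_succ (fun b => (-1 : ℤ) ^ b • Φ (t.card + 1) (tᶜ.card + 1)
        (Fin.snoc (α := fun _ => ℕ × ℕ) (Prod.map (coface b) id ∘ latticePath t)
          (t.card + 1, tᶜ.card + 1))) (t.card + 1),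
      Finset.sum_range_succ (fun c => (-1 : ℤ) ^ c • Φ (t.card + 1) (tᶜ.card + 1)
        (Fin.snoc (α := fun _ => ℕ × ℕ) (Prod.map id (coface c) ∘ latticePath t)
          (t.card + 1, tᶜ.card + 1))) (tᶜ.card + 1),
      coface_comp_latticePath_fst, coface_comp_latticePath_snd]
    simp only [pow_succ, mul_neg, mul_one]
    rcases neg_one_pow_eq_or ℤ t.card with h1 | h1 <;>
      rcases neg_one_pow_eq_or ℤ tᶜ.card with h2 | h2 <;> rw [h1, h2] <;> module

open Classical in
/-- The map `[N] → [p]` with the given values on vertices; constant if there is no such map. -/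
noncomputable def vertexMap (p : ℕ) {N : ℕ} (f : Fin (N + 1) → ℕ) : ⦋N⦌ ⟶ ⦋p⦌ :=
  if h : Monotone f ∧ ∀ i, f i ≤ p then
    SimplexCategory.Hom.mk ⟨fun i => ⟨f i, Nat.lt_succ_of_le (h.2 i)⟩, fun _ _ hij => h.1 hij⟩
  else SimplexCategory.const ⦋N⦌ ⦋p⦌ 0

lemma vertexMap_eq {p N : ℕ} (g : ⦋N⦌ ⟶ ⦋p⦌) (f : Fin (N + 1) → ℕ)
    (h : ∀ i, f i = ((g.toOrderHom i : Fin (p + 1)) : ℕ)) : vertexMap p f = g := by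
  have h' : Monotone f ∧ ∀ i, f i ≤ p := by
    refine ⟨fun i j hij => ?_, fun i => ?_⟩
    · rw [h, h]; exact g.toOrderHom.monotone hij
    · rw [h]; exact Nat.lt_succ_iff.1 (g.toOrderHom i).2
  rw [vertexMap, dif_pos h']
  ext i
  exact congrArg Fin.val (Fin.ext (h i))

lemma stepMap_val {N p : ℕ} (s : Finset (Fin N)) (hs : s.card = p) (i : Fin (N + 1)) :
    (((stepMap s hs).toOrderHom i : Fin (p + 1)) : ℕ) = stepCount s i := rfl

lemma δ_coface {n : ℕ} (b : Fin (n + 2)) (j : Fin (n + 1)) :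
    (((SimplexCategory.δ b).toOrderHom j : Fin (n + 2)) : ℕ) = coface b j := δ_val b j

/-- The Eilenberg-Zilber map on simplices `x ∈ K_p` and `y ∈ L_q`, with values in chains of an
arbitrary degree `N`; it is zero unless `N = p + q`. -/
noncomputable def ezSum (K L : PSSet.{u}) (p q N : ℕ) (x : (K.obj (op ⦋p⦌)).X)
    (y : (L.obj (op ⦋q⦌)).X) : Chains (smash K L) N :=
  ∑ s : Finset (Fin N), if h : s.card = p ∧ sᶜ.card = q then
    stepSign s • gen (P := (smash K L).obj (op ⦋N⦌))
      (smk ((K.map (stepMap s h.1).op).toFun x) ((L.map (stepMap sᶜ h.2).op).toFun y)) else 0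

lemma ezSum_eq_ezGen (K L : PSSet.{u}) (p q : ℕ) (x : (K.obj (op ⦋p⦌)).X)
    (y : (L.obj (op ⦋q⦌)).X) : ezSum K L p q (p + q) x y = ezGen K L p q x y := by
  symm
  refine Fintype.sum_of_injective Subtype.val Subtype.val_injective _ _ ?_ ?_
  · intro s hs
    refine dif_neg fun h => hs ⟨⟨s, h.1⟩, rfl⟩
  · intro s
    rw [dif_pos (⟨s.2, Shuffle.card_compl s⟩ : s.1.card = p ∧ s.1ᶜ.card = q)]
    rfl

lemma ezSum_left (K L : PSSet.{u}) (p q N : ℕ) (y : (L.obj (op ⦋q⦌)).X) :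
    ezSum K L p q N (K.obj (op ⦋p⦌)).point y = 0 :=
  Finset.sum_eq_zero fun s _ => by
    split_ifs with h
    · rw [Pointed.Hom.map_point]; exact smul_eq_zero_of_right _ (gen_smk_left _)
    · rfl

lemma ezSum_right (K L : PSSet.{u}) (p q N : ℕ) (x : (K.obj (op ⦋p⦌)).X) :
    ezSum K L p q N x (L.obj (op ⦋q⦌)).point = 0 :=
  Finset.sum_eq_zero fun s _ => by
    split_ifs with h
    · rw [Pointed.Hom.map_point]; exact smul_eq_zero_of_right _ (gen_smk_right _)
    · rfl

/-- The Eilenberg-Zilber map `C(K)_p ⊗ C(L)_q → C(K ∧ L)_N`, zero unless `N = p + q`. The free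
target degree avoids transports along equalities such as `(p + 1) + q = (p + q) + 1`. -/
noncomputable def ezN (K L : PSSet.{u}) (p q N : ℕ) :
    Chains K p →ₗ[ℤ] Chains L q →ₗ[ℤ] Chains (smash K L) N :=
  redLift (fun x => redLift (ezSum K L p q N x) (ezSum_right K L p q N x))
    (redFree_ext fun y => by rw [redLift_gen, LinearMap.zero_apply, ezSum_left])

lemma ezN_gen (K L : PSSet.{u}) (p q N : ℕ) (x : (K.obj (op ⦋p⦌)).X)
    (y : (L.obj (op ⦋q⦌)).X) : ezN K L p q N (gen x) (gen y) = ezSum K L p q N x y := by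
  simp [ezN]

lemma chains_ext₂ {P Q : Pointed.{u}} {A : Type*} [AddCommGroup A]
    {f g : RedFree P →ₗ[ℤ] RedFree Q →ₗ[ℤ] A}
    (h : ∀ x y, f (gen x) (gen y) = g (gen x) (gen y)) : f = g :=
  redFree_ext fun x => redFree_ext fun y => h x y

lemma ezN_eq_EZ (K L : PSSet.{u}) (p q : ℕ) : ezN K L p q (p + q) = EZ K L p q :=
  chains_ext₂ fun x y => by rw [ezN_gen, EZ_gen, ezSum_eq_ezGen]

/-- The contribution of the lattice paths with `p` and `q` steps to a sum over lattice paths. -/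
noncomputable def pathSimplex (K L : PSSet.{u}) {p q : ℕ} (x : (K.obj (op ⦋p⦌)).X)
    (y : (L.obj (op ⦋q⦌)).X) (M P Q : ℕ) (f : Fin (M + 1) → ℕ × ℕ) : Chains (smash K L) M :=
  if P = p ∧ Q = q then gen (P := (smash K L).obj (op ⦋M⦌))
    (smk ((K.map (vertexMap p fun i => (f i).1).op).toFun x)
      ((L.map (vertexMap q fun i => (f i).2).op).toFun y)) else 0

lemma bd_gen (K : PSSet.{u}) (i : ℕ) (x : (K.obj (op ⦋i + 1⦌)).X) :
    bd K i (gen x) = ∑ a : Fin (i + 2), (-1 : ℤ) ^ (a : ℕ) • gen ((K.δ a).toFun x) := by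
  simp only [bd, LinearMap.sum_apply, LinearMap.smul_apply, redMap_gen]

lemma bd_ezSum (K L : PSSet.{u}) (p q M : ℕ) (x : (K.obj (op ⦋p⦌)).X)
    (y : (L.obj (op ⦋q⦌)).X) :
    bd (smash K L) M (ezSum K L p q (M + 1) x y) =
      ∑ s : Finset (Fin (M + 1)), stepSign s • ∑ a : Fin (M + 2),
        (-1 : ℤ) ^ (a : ℕ) • pathSimplex K L x y M s.card sᶜ.card
          (latticePath s ∘ a.succAbove) := by
  rw [ezSum, map_sum]
  refine Finset.sum_congr rfl fun s _ => ?_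
  by_cases h : s.card = p ∧ sᶜ.card = q
  · rw [dif_pos h, map_zsmul, bd_gen]
    congr 1
    refine Finset.sum_congr rfl fun a _ => ?_
    rw [pathSimplex, if_pos h]
    congr 2
    have h1 : vertexMap p (fun i => ((latticePath s ∘ a.succAbove) i).1) =
        SimplexCategory.δ a ≫ stepMap s h.1 := vertexMap_eq _ _ fun i => rfl
    have h2 : vertexMap q (fun i => ((latticePath s ∘ a.succAbove) i).2) =
        SimplexCategory.δ a ≫ stepMap sᶜ h.2 := vertexMap_eq _ _ fun i => rfl
    rw [h1, h2]
    exact congrArg₂ smk (map_comp_toFun K _ _ x) (map_comp_toFun L _ _ y)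
  · rw [dif_neg h, map_zero]
    refine (smul_eq_zero_of_right _ (Finset.sum_eq_zero fun a _ => ?_)).symm
    rw [pathSimplex, if_neg h, smul_zero]

lemma sum_coface_left (K L : PSSet.{u}) (p q M : ℕ) (x : (K.obj (op ⦋p + 1⦌)).X)
    (y : (L.obj (op ⦋q⦌)).X) :
    ∑ t : Finset (Fin M), stepSign t • ∑ b ∈ Finset.range (t.card + 2), (-1 : ℤ) ^ b •
      pathSimplex K L x y M (t.card + 1) tᶜ.card (Prod.map (coface b) id ∘ latticePath t) =
    ezN K L p q M (bd K p (gen x)) (gen y) := by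
  rw [bd_gen, map_sum, LinearMap.sum_apply]
  simp only [map_zsmul, LinearMap.smul_apply, ezN_gen, ezSum, Finset.smul_sum]
  rw [Finset.sum_comm]
  refine Finset.sum_congr rfl fun t _ => ?_
  by_cases h : t.card = p ∧ tᶜ.card = q
  · rw [← Fin.sum_univ_eq_sum_range (fun b => stepSign t • (-1 : ℤ) ^ b •
      pathSimplex K L x y M (t.card + 1) tᶜ.card (Prod.map (coface b) id ∘ latticePath t))]
    obtain ⟨rfl, rfl⟩ := h
    refine Finset.sum_congr rfl fun b _ => ?_
    rw [pathSimplex, if_pos ⟨rfl, rfl⟩, dif_pos ⟨rfl, rfl⟩, smul_comm]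
    congr 3
    have h1 : vertexMap (t.card + 1)
        (fun i => ((Prod.map (coface b) id ∘ latticePath t) i).1) =
        stepMap t rfl ≫ SimplexCategory.δ b :=
      vertexMap_eq _ _ fun i => (δ_coface b ((stepMap t rfl).toOrderHom i)).symm
    have h2 : vertexMap tᶜ.card (fun i => ((Prod.map (coface b) id ∘ latticePath t) i).2) =
        stepMap tᶜ rfl := vertexMap_eq _ _ fun i => rfl
    rw [h1, h2]
    exact congrArg₂ smk (map_comp_toFun K _ _ x).symm rfl
  · simp [pathSimplex, h]

lemma sum_coface_left_zero (K L : PSSet.{u}) (q M : ℕ) (x : (K.obj (op ⦋0⦌)).X)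
    (y : (L.obj (op ⦋q⦌)).X) :
    ∑ t : Finset (Fin M), stepSign t • ∑ b ∈ Finset.range (t.card + 2), (-1 : ℤ) ^ b •
      pathSimplex K L x y M (t.card + 1) tᶜ.card (Prod.map (coface b) id ∘ latticePath t) = 0 := by
  simp [pathSimplex]

lemma sum_coface_right (K L : PSSet.{u}) (p q M : ℕ) (x : (K.obj (op ⦋p⦌)).X)
    (y : (L.obj (op ⦋q + 1⦌)).X) :
    ∑ t : Finset (Fin M), stepSign t • (-1 : ℤ) ^ t.card •
      ∑ c ∈ Finset.range (tᶜ.card + 2), (-1 : ℤ) ^ c •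
        pathSimplex K L x y M t.card (tᶜ.card + 1) (Prod.map id (coface c) ∘ latticePath t) =
    (-1 : ℤ) ^ p • ezN K L p q M (gen x) (bd L q (gen y)) := by
  rw [bd_gen, map_sum]
  simp only [map_zsmul, ezN_gen, ezSum, Finset.smul_sum]
  rw [Finset.sum_comm]
  refine Finset.sum_congr rfl fun t _ => ?_
  by_cases h : t.card = p ∧ tᶜ.card = q
  · rw [← Fin.sum_univ_eq_sum_range (fun c => stepSign t • (-1 : ℤ) ^ t.card • (-1 : ℤ) ^ c •
      pathSimplex K L x y M t.card (tᶜ.card + 1) (Prod.map id (coface c) ∘ latticePath t))]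
    obtain ⟨rfl, rfl⟩ := h
    refine Finset.sum_congr rfl fun b _ => ?_
    rw [pathSimplex, if_pos ⟨rfl, rfl⟩, dif_pos ⟨rfl, rfl⟩, smul_comm (stepSign t),
      smul_comm (stepSign t)]
    congr 4
    have h1 : vertexMap t.card (fun i => ((Prod.map id (coface b) ∘ latticePath t) i).1) =
        stepMap t rfl := vertexMap_eq _ _ fun i => rfl
    have h2 : vertexMap (tᶜ.card + 1)
        (fun i => ((Prod.map id (coface b) ∘ latticePath t) i).2) =
        stepMap tᶜ rfl ≫ SimplexCategory.δ b :=
      vertexMap_eq _ _ fun i => (δ_coface b ((stepMap tᶜ rfl).toOrderHom i)).symm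
    rw [h1, h2]
    exact congrArg₂ smk rfl (map_comp_toFun L _ _ y).symm
  · simp [pathSimplex, h]

lemma sum_coface_right_zero (K L : PSSet.{u}) (p M : ℕ) (x : (K.obj (op ⦋p⦌)).X)
    (y : (L.obj (op ⦋0⦌)).X) :
    ∑ t : Finset (Fin M), stepSign t • (-1 : ℤ) ^ t.card •
      ∑ c ∈ Finset.range (tᶜ.card + 2), (-1 : ℤ) ^ c •
        pathSimplex K L x y M t.card (tᶜ.card + 1) (Prod.map id (coface c) ∘ latticePath t) = 0 := by
  simp [pathSimplex]

lemma bd_ezN_gen (K L : PSSet.{u}) (p q M : ℕ) (x : (K.obj (op ⦋p⦌)).X)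
    (y : (L.obj (op ⦋q⦌)).X) :
    bd (smash K L) M (ezN K L p q (M + 1) (gen x) (gen y)) =
      ∑ t : Finset (Fin M), stepSign t • ∑ b ∈ Finset.range (t.card + 2), (-1 : ℤ) ^ b •
        pathSimplex K L x y M (t.card + 1) tᶜ.card (Prod.map (coface b) id ∘ latticePath t) +
      ∑ t : Finset (Fin M), stepSign t • (-1 : ℤ) ^ t.card •
        ∑ c ∈ Finset.range (tᶜ.card + 2), (-1 : ℤ) ^ c •
          pathSimplex K L x y M t.card (tᶜ.card + 1)
            (Prod.map id (coface c) ∘ latticePath t) := by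
  rw [ezN_gen, bd_ezSum, sum_shuffle_faces, ← Finset.sum_add_distrib]
  exact Finset.sum_congr rfl fun t _ => smul_add _ _ _

/-- The Leibniz rule for the Eilenberg-Zilber map. -/
lemma bd_ezN (K L : PSSet.{u}) (p q M : ℕ) (c : Chains K (p + 1)) (d : Chains L (q + 1)) :
    bd (smash K L) M (ezN K L (p + 1) (q + 1) (M + 1) c d) =
      ezN K L p (q + 1) M (bd K p c) d + (-1 : ℤ) ^ (p + 1) • ezN K L (p + 1) q M c (bd L q d) := by
  suffices h : (ezN K L (p + 1) (q + 1) (M + 1)).compr₂ (bd (smash K L) M) =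
      (ezN K L p (q + 1) M).comp (bd K p) +
        (-1 : ℤ) ^ (p + 1) • (ezN K L (p + 1) q M).compl₂ (bd L q) from
    LinearMap.congr_fun₂ h c d
  refine chains_ext₂ fun x y => ?_
  refine (bd_ezN_gen K L (p + 1) (q + 1) M x y).trans ?_
  rw [sum_coface_left, sum_coface_right]
  rfl

lemma bd_ezN_zero_right (K L : PSSet.{u}) (p M : ℕ) (c : Chains K (p + 1)) (d : Chains L 0) :
    bd (smash K L) M (ezN K L (p + 1) 0 (M + 1) c d) = ezN K L p 0 M (bd K p c) d := by
  suffices h : (ezN K L (p + 1) 0 (M + 1)).compr₂ (bd (smash K L) M) =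
      (ezN K L p 0 M).comp (bd K p) from LinearMap.congr_fun₂ h c d
  refine chains_ext₂ fun x y => ?_
  refine (bd_ezN_gen K L (p + 1) 0 M x y).trans ?_
  rw [sum_coface_left, sum_coface_right_zero, add_zero]
  rfl

lemma bd_ezN_zero_left (K L : PSSet.{u}) (q M : ℕ) (c : Chains K 0) (d : Chains L (q + 1)) :
    bd (smash K L) M (ezN K L 0 (q + 1) (M + 1) c d) = ezN K L 0 q M c (bd L q d) := by
  suffices h : (ezN K L 0 (q + 1) (M + 1)).compr₂ (bd (smash K L) M) =
      (ezN K L 0 q M).compl₂ (bd L q) from LinearMap.congr_fun₂ h c d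
  refine chains_ext₂ fun x y => ?_
  refine (bd_ezN_gen K L 0 (q + 1) M x y).trans ?_
  rw [sum_coface_left_zero, sum_coface_right, zero_add, pow_zero, one_smul]
  rfl

lemma stepCount_univ {N : ℕ} (i : Fin (N + 1)) : stepCount Finset.univ i = i := by
  have h : (Finset.univ.filter fun j : Fin N => j.castSucc < i).map Fin.valEmbedding =
      Finset.range i := by
    ext j
    simp only [Finset.mem_map, Finset.mem_filter, Finset.mem_univ, true_and, Finset.mem_range,
      Fin.lt_def, Fin.val_castSucc, Fin.valEmbedding_apply]
    exact ⟨fun ⟨j, hj, e⟩ => e ▸ hj, fun hj => ⟨⟨j, by omega⟩, hj, rfl⟩⟩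
  rw [stepCount, ← Finset.card_map, h, Finset.card_range]

/-- The product with a vertex `y`: the only `(p, 0)`-shuffle pairs `x` with the degenerate
`p`-simplex at `y`. -/
lemma ezN_zero_right (K L : PSSet.{u}) (p : ℕ) (x : (K.obj (op ⦋p⦌)).X)
    (y : (L.obj (op ⦋0⦌)).X) :
    ezN K L p 0 p (gen x) (gen y) = gen (P := (smash K L).obj (op ⦋p⦌))
      (smk x ((L.map (SimplexCategory.const ⦋p⦌ ⦋0⦌ 0).op).toFun y)) := by
  rw [ezN_gen, ezSum, Finset.sum_eq_single Finset.univ]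
  · rw [dif_pos (by simp)]
    have h0 : stepSign (Finset.univ : Finset (Fin p)) = 1 := by simp [stepSign]
    have h1 : ∀ h, stepMap (Finset.univ : Finset (Fin p)) h = 𝟙 ⦋p⦌ := by
      intro h
      ext i
      refine (stepMap_val _ h i).trans ?_
      exact stepCount_univ i
    rw [h0, one_smul, h1]
    congr 1
    refine congrArg₂ smk (map_id_toFun K x) ?_
    exact congrArg (fun f : ⦋p⦌ ⟶ ⦋0⦌ => (L.map f.op).toFun y) (Subsingleton.elim _ _)
  · intro s _ hs
    refine dif_neg fun h => hs ?_
    rw [← Finset.card_eq_iff_eq_univ, h.1, Fintype.card_fin]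
  · simp

lemma ezN_zero_left (K L : PSSet.{u}) (q : ℕ) (x : (K.obj (op ⦋0⦌)).X)
    (y : (L.obj (op ⦋q⦌)).X) :
    ezN K L 0 q q (gen x) (gen y) = gen (P := (smash K L).obj (op ⦋q⦌))
      (smk ((K.map (SimplexCategory.const ⦋q⦌ ⦋0⦌ 0).op).toFun x) y) := by
  rw [ezN_gen, ezSum, Finset.sum_eq_single ∅]
  · rw [dif_pos (by simp)]
    have h0 : stepSign (∅ : Finset (Fin q)) = 1 := by simp [stepSign]
    have h1 : ∀ h, stepMap (∅ : Finset (Fin q))ᶜ h = 𝟙 ⦋q⦌ := by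
      intro h
      ext i
      refine (stepMap_val _ h i).trans ?_
      rw [Finset.compl_empty]
      exact stepCount_univ i
    rw [h0, one_smul, h1]
    congr 1
    refine congrArg₂ smk ?_ (map_id_toFun L y)
    exact congrArg (fun f : ⦋q⦌ ⟶ ⦋0⦌ => (K.map f.op).toFun x) (Subsingleton.elim _ _)
  · intro s _ hs
    exact dif_neg fun h => hs (Finset.card_eq_zero.1 h.1)
  · simp

lemma ezN_natural {K K' L L' : PSSet.{u}} (φ : K ⟶ K') (χ : L ⟶ L') (p q N : ℕ)
    (c : Chains K p) (d : Chains L q) :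
    ezN K' L' p q N (chainMap φ p c) (chainMap χ q d) =
      chainMap (smashMap φ χ) N (ezN K L p q N c d) := by
  suffices h : (ezN K' L' p q N).compl₁₂ (chainMap φ p) (chainMap χ q) =
      (ezN K L p q N).compr₂ (chainMap (smashMap φ χ) N) from
    LinearMap.congr_fun₂ h c d
  refine chains_ext₂ fun x y => ?_
  simp only [LinearMap.compl₁₂_apply, LinearMap.compr₂_apply, chainMap, redMap_gen, ezN_gen, ezSum,
    map_sum]
  refine Finset.sum_congr rfl fun s _ => ?_
  split_ifs with h
  · rw [map_zsmul, redMap_gen]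
    congr 2
    exact congrArg₂ smk (naturality_toFun φ _ x).symm (naturality_toFun χ _ y).symm
  · rw [map_zero]

/-! ### Coboundaries and Stokes' formula for slant products -/

section

variable {V : ℤ → Type u} [∀ j, AddCommGroup (V j)] [∀ j, Module ℝ (V j)]

lemma cochain_degree_ext {n : ℤ} {K : PSSet.{u}} {u v : Cochain V n K}
    (h₀ : ∀ j (h : ((0 : ℕ) : ℤ) + j = n) c, u ⟨(0, j), h⟩ c = v ⟨(0, j), h⟩ c)
    (h₁ : ∀ i j (h : ((i + 1 : ℕ) : ℤ) + j = n) c,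
      u ⟨(i + 1, j), h⟩ c = v ⟨(i + 1, j), h⟩ c) : u = v := by
  funext ⟨⟨i, j⟩, h⟩
  cases i with
  | zero => exact LinearMap.ext (h₀ j h)
  | succ i => exact LinearMap.ext (h₁ i j h)

lemma bd_bd (K : PSSet.{u}) (i : ℕ) (c : Chains K (i + 2)) : bd K i (bd K (i + 1) c) = 0 := by
  have h := ((AlgebraicTopology.alternatingFaceMapComplex (ModuleCat.{u} ℤ)).obj
    (((SimplicialObject.whiskering _ _).obj redFunctor.{u}).obj K)).d_comp_d (i + 2) (i + 1) i
  rw [alternating_d, alternating_d] at h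
  exact LinearMap.congr_fun (congrArg ModuleCat.Hom.hom h) c

lemma cobd_mem {n' n : ℤ} (h : n' + 1 = n) {K : PSSet.{u}} (g : Cochain V n' K) :
    cobd h K g ∈ cocycles V n K := by
  rintro ⟨⟨i, j⟩, hj⟩
  cases i with
  | zero => rfl
  | succ i =>
    refine LinearMap.ext fun c => ?_
    change g ⟨(i, j), _⟩ (bd K i (bd K (i + 1) c)) = 0
    rw [bd_bd, map_zero]

lemma cobd_eq_zero_iff {n' n : ℤ} (h : n' + 1 = n) {K : PSSet.{u}} (u : Cochain V n' K) :
    cobd h K u = 0 ↔ u ∈ cocycles V n' K := by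
  constructor
  · rintro hu ⟨⟨i, j⟩, hj⟩
    exact congrFun hu ⟨(i + 1, j), by push_cast at hj ⊢; omega⟩
  · intro hu
    funext ⟨⟨i, j⟩, hj⟩
    cases i with
    | zero => rfl
    | succ i => exact hu ⟨(i, j), by push_cast at hj ⊢; omega⟩

lemma pull_cobd {n' n : ℤ} (h : n' + 1 = n) {K L : PSSet.{u}} (φ : K ⟶ L) (g : Cochain V n' L) :
    pull φ (cobd h L g) = cobd h K (pull φ g) := by
  refine cochain_degree_ext (fun j hj c => rfl) fun i j hj c => ?_
  exact congrArg (g _) (LinearMap.congr_fun (bd_chainMap φ i) c)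

lemma pull_gen {n : ℤ} {K L : PSSet.{u}} (φ : K ⟶ L) (u : Cochain V n L) (p : Bideg n)
    (x : (K.obj (op ⦋p.1.1⦌)).X) :
    pull φ u p (gen x) = u p (gen ((φ.app (op ⦋p.1.1⦌)).toFun x)) :=
  congrArg (u p) (chainMap_gen φ p.1.1 x)

lemma pull_pull {n : ℤ} {K L M : PSSet.{u}} (φ : K ⟶ L) (χ : L ⟶ M) (u : Cochain V n M) :
    pull φ (pull χ u) = pull (φ ≫ χ) u :=
  cochain_ext fun p x => by rw [pull_gen, pull_gen, pull_gen]; rfl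

/-- A cochain is a coboundary. -/
def IsCobd {n : ℤ} {K : PSSet.{u}} (u : Cochain V n K) : Prop :=
  ∃ (l : ℤ) (h : l + 1 = n) (g : Cochain V l K), cobd h K g = u

lemma isCobd_cobd {l n : ℤ} (h : l + 1 = n) {K : PSSet.{u}} (g : Cochain V l K) :
    IsCobd (cobd h K g) := ⟨l, h, g, rfl⟩

lemma isCobd_iff {n l : ℤ} (h : l + 1 = n) {K : PSSet.{u}} (u : Cochain V n K) :
    IsCobd u ↔ ∃ g : Cochain V l K, cobd h K g = u := by
  constructor
  · rintro ⟨l', h', g, hg⟩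
    obtain rfl : l' = l := by omega
    exact ⟨g, hg⟩
  · rintro ⟨g, hg⟩
    exact ⟨l, h, g, hg⟩

lemma IsCobd.zero {n : ℤ} {K : PSSet.{u}} : IsCobd (0 : Cochain V n K) :=
  ⟨n - 1, by omega, 0, map_zero _⟩

lemma IsCobd.add {n : ℤ} {K : PSSet.{u}} {u v : Cochain V n K} (hu : IsCobd u) (hv : IsCobd v) :
    IsCobd (u + v) := by
  obtain ⟨l, h, g, rfl⟩ := hu
  obtain ⟨g', rfl⟩ := (isCobd_iff h _).1 hv
  exact ⟨l, h, g + g', map_add _ _ _⟩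

lemma IsCobd.zsmul {n : ℤ} {K : PSSet.{u}} {u : Cochain V n K} (hu : IsCobd u) (c : ℤ) :
    IsCobd (c • u) := by
  obtain ⟨l, h, g, rfl⟩ := hu
  exact ⟨l, h, c • g, map_zsmul _ _ _⟩

lemma IsCobd.neg {n : ℤ} {K : PSSet.{u}} {u : Cochain V n K} (hu : IsCobd u) : IsCobd (-u) := by
  simpa using hu.zsmul (-1)

lemma IsCobd.sub {n : ℤ} {K : PSSet.{u}} {u v : Cochain V n K} (hu : IsCobd u) (hv : IsCobd v) :
    IsCobd (u - v) := by
  rw [sub_eq_add_neg]; exact hu.add hv.neg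

lemma IsCobd.mem {n : ℤ} {K : PSSet.{u}} {u : Cochain V n K} (hu : IsCobd u) :
    u ∈ cocycles V n K := by
  obtain ⟨l, h, g, rfl⟩ := hu
  exact cobd_mem h g

lemma coh_eq_iff {n : ℤ} {K : PSSet.{u}} {u v : Cochain V n K} (hu : u ∈ cocycles V n K)
    (hv : v ∈ cocycles V n K) : coh u hu = coh v hv ↔ IsCobd (u - v) := by
  rw [coh, coh, Submodule.Quotient.eq, isCobd_iff (sub_add_cancel n 1)]
  rfl

lemma coh_surjective {n : ℤ} {K : PSSet.{u}} (x : Coh V n K) : ∃ u hu, coh u hu = x := by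
  obtain ⟨⟨u, hu⟩, rfl⟩ := Submodule.Quotient.mk_surjective _ x
  exact ⟨u, hu, rfl⟩

/-- Multiplication by `ε^i` on the component of cochain degree `i`. -/
noncomputable def twist (ε : ℤ) {n : ℤ} {K : PSSet.{u}} (u : Cochain V n K) : Cochain V n K :=
  fun p => ε ^ p.1.1 • u p

lemma twist_sub (ε : ℤ) {n : ℤ} {K : PSSet.{u}} (u v : Cochain V n K) :
    twist ε (u - v) = twist ε u - twist ε v := funext fun _ => smul_sub _ _ _

lemma twist_zsmul (ε c : ℤ) {n : ℤ} {K : PSSet.{u}} (u : Cochain V n K) :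
    twist ε (c • u) = c • twist ε u := funext fun p => smul_comm (ε ^ p.1.1) c (u p)

lemma twist_twist {ε : ℤ} (hε : ε * ε = 1) {n : ℤ} {K : PSSet.{u}} (u : Cochain V n K) :
    twist ε (twist ε u) = u := by
  funext p
  change ε ^ p.1.1 • ε ^ p.1.1 • u p = u p
  rw [smul_smul, ← mul_pow, hε, one_pow, one_smul]

lemma twist_cobd (ε : ℤ) {n' n : ℤ} (h : n' + 1 = n) {K : PSSet.{u}} (g : Cochain V n' K) :
    twist ε (cobd h K g) = ε • cobd h K (twist ε g) := by
  refine cochain_degree_ext (fun j hj c => ?_) fun i j hj c => ?_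
  · change ε ^ 0 • (0 : V j) = ε • (0 : V j)
    rw [smul_zero, smul_zero]
  · change ε ^ (i + 1) • g ⟨(i, j), _⟩ (bd K i c) = ε • ε ^ i • g ⟨(i, j), _⟩ (bd K i c)
    rw [pow_succ', mul_smul]

lemma IsCobd.twist (ε : ℤ) {n : ℤ} {K : PSSet.{u}} {u : Cochain V n K} (hu : IsCobd u) :
    IsCobd (twist ε u) := by
  obtain ⟨l, h, g, rfl⟩ := hu
  rw [twist_cobd]
  exact (isCobd_cobd _ _).zsmul _

lemma twist_mem (ε : ℤ) {n : ℤ} {K : PSSet.{u}} {u : Cochain V n K} (hu : u ∈ cocycles V n K) :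
    twist ε u ∈ cocycles V n K := by
  intro p
  change (ε ^ p.1.1 • u p) ∘ₗ bd K p.1.1 = 0
  rw [LinearMap.smul_comp, hu, smul_zero]

lemma cochain_ezN {n : ℤ} {K L : PSSet.{u}} (u : Cochain V n (smash K L)) {p q N : ℕ}
    (hN : p + q = N) (j : ℤ) (h : (N : ℤ) + j = n) (c : Chains K p) (d : Chains L q) :
    u ⟨(N, j), h⟩ (ezN K L p q N c d) = u ⟨(p + q, j), by rw [hN]; exact h⟩ (EZ K L p q c d) := by
  subst hN
  rw [ezN_eq_EZ]

/-- Stokes' formula for the slant product with a chain of positive degree. -/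
lemma slant_cobd {K L : PSSet.{u}} {k : ℕ} (e : Chains L (k + 1)) {m' m n' n : ℤ}
    (hm : m' + 1 = m) (hn : n' + 1 = n) (h : m + (k + 1 : ℕ) = n) (h' : m' + (k + 1 : ℕ) = n')
    (h'' : m + (k : ℕ) = n') (g : Cochain V n' (smash K L)) :
    slant e h (cobd hn _ g) = cobd hm K (slant e h' g) + twist (-1) (slant (bd L k e) h'' g) := by
  refine cochain_degree_ext (fun j hj c => ?_) fun i j hj c => ?_
  · change g ⟨(0 + k, j), _⟩ (bd _ (0 + k) (EZ K L 0 (k + 1) c e)) =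
      0 + (-1 : ℤ) ^ 0 • g ⟨(0 + k, j), _⟩ (EZ K L 0 k c (bd L k e))
    rw [← ezN_eq_EZ, ← ezN_eq_EZ]
    refine Eq.trans ?_ ((zero_add _).trans (one_smul ℤ _)).symm
    exact congrArg _ (bd_ezN_zero_left K L k (0 + k) c e)
  · change g ⟨(i + 1 + k, j), _⟩ (bd _ (i + 1 + k) (EZ K L (i + 1) (k + 1) c e)) =
      g ⟨(i + (k + 1), j), _⟩ (EZ K L i (k + 1) (bd K i c) e) +
        (-1 : ℤ) ^ (i + 1) • g ⟨(i + 1 + k, j), _⟩ (EZ K L (i + 1) k c (bd L k e))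
    rw [← ezN_eq_EZ K L (i + 1), ← ezN_eq_EZ K L (i + 1)]
    refine (congrArg _ (bd_ezN K L i k (i + 1 + k) c e)).trans ?_
    rw [map_add, map_zsmul, cochain_ezN g (by omega : i + (k + 1) = i + 1 + k)]

/-- Stokes' formula for the slant product with a chain of positive degree in front. -/
lemma slantFront_cobd {K L : PSSet.{u}} {k : ℕ} (e : Chains L (k + 1)) {m' m n' n : ℤ}
    (hm : m' + 1 = m) (hn : n' + 1 = n) (h : m + (k + 1 : ℕ) = n) (h' : m' + (k + 1 : ℕ) = n')
    (h'' : m + (k : ℕ) = n') (g : Cochain V n' (smash L K)) :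
    slantFront e h (cobd hn _ g) =
      (-1 : ℤ) ^ (k + 1) • cobd hm K (slantFront e h' g) + slantFront (bd L k e) h'' g := by
  refine cochain_degree_ext (fun j hj c => ?_) fun i j hj c => ?_
  · change g ⟨(k, j), _⟩ (bd _ k (EZ L K (k + 1) 0 e c)) =
      (-1 : ℤ) ^ (k + 1) • 0 + g ⟨(k, j), _⟩ (EZ L K k 0 (bd L k e) c)
    rw [← ezN_eq_EZ, ← ezN_eq_EZ, smul_zero, zero_add]
    exact congrArg _ (bd_ezN_zero_right L K k k e c)
  · change g ⟨(k + 1 + i, j), _⟩ (bd _ (k + 1 + i) (EZ L K (k + 1) (i + 1) e c)) =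
      (-1 : ℤ) ^ (k + 1) • g ⟨(k + 1 + i, j), _⟩ (EZ L K (k + 1) i e (bd K i c)) +
        g ⟨(k + (i + 1), j), _⟩ (EZ L K k (i + 1) (bd L k e) c)
    rw [← ezN_eq_EZ L K (k + 1), ← ezN_eq_EZ L K (k + 1)]
    refine (congrArg _ (bd_ezN L K k i (k + 1 + i) e c)).trans ?_
    rw [map_add, map_zsmul, cochain_ezN g (by omega : k + (i + 1) = k + 1 + i)]
    exact add_comm _ _

lemma pull_slant {K K' L L' : PSSet.{u}} (φ : K ⟶ K') (χ : L ⟶ L') {k : ℕ} (e : Chains L k)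
    {m n : ℤ} (h : m + k = n) (u : Cochain V n (smash K' L')) :
    pull φ (slant (chainMap χ k e) h u) = slant e h (pull (smashMap φ χ) u) := by
  funext p
  exact LinearMap.ext fun c => congrArg (u (p.right k h)) (EZ_natural φ χ p.1.1 k c e)

lemma pull_slantFront {K K' L L' : PSSet.{u}} (φ : K ⟶ K') (χ : L ⟶ L') {k : ℕ}
    (e : Chains L k) {m n : ℤ} (h : m + k = n) (u : Cochain V n (smash L' K')) :
    pull φ (slantFront (chainMap χ k e) h u) = slantFront e h (pull (smashMap χ φ) u) := by
  funext p
  exact LinearMap.ext fun c => congrArg (u (p.left k h)) (EZ_natural χ φ k p.1.1 e c)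

lemma pull_id {n : ℤ} {K : PSSet.{u}} (u : Cochain V n K) : pull (𝟙 K) u = u :=
  cochain_ext fun p x => by rw [pull_gen]; rfl

end

/-! ### Slant products with simplices and homotopy invariance -/

section

variable {V : ℤ → Type u} [∀ j, AddCommGroup (V j)] [∀ j, Module ℝ (V j)]

/-- The inclusion `K → K ∧ L`, `x ↦ x ∧ y`, at a vertex `y` of `L`. -/
def pointIncl (K : PSSet.{u}) {L : PSSet.{u}} (y : (L.obj (op ⦋0⦌)).X) : K ⟶ smash K L where
  app n := ⟨fun x => smk x ((L.map (SimplexCategory.const n.unop ⦋0⦌ 0).op).toFun y), smk_left _⟩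
  naturality _ m f := Pointed.Hom.ext (funext fun _ => congrArg (smk _)
    ((congrArg (fun g : m.unop ⟶ ⦋0⦌ => (L.map g.op).toFun y) (Subsingleton.elim _ _)).trans
      (map_comp_toFun L _ f y).symm))

lemma slant_gen_zero {K L : PSSet.{u}} (y : (L.obj (op ⦋0⦌)).X) {n : ℤ} (h : n + (0 : ℕ) = n)
    (u : Cochain V n (smash K L)) : slant (gen y) h u = pull (pointIncl K y) u := by
  refine cochain_ext fun p x => ?_
  rw [pull_gen]
  change u p (EZ K L p.1.1 0 (gen x) (gen y)) = _
  rw [← ezN_eq_EZ]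
  exact congrArg (u p) (ezN_zero_right K L p.1.1 x y)

lemma slantFront_gen_zero {K L : PSSet.{u}} (y : (L.obj (op ⦋0⦌)).X) {n : ℤ}
    (h : n + (0 : ℕ) = n) (u : Cochain V n (smash L K)) :
    slantFront (gen y) h u = pull (pointIncl K y ≫ smashSwap K L) u := by
  refine cochain_ext fun p x => ?_
  rw [pull_gen]
  refine (cochain_ezN u (zero_add p.1.1) p.1.2 p.2 (gen y) (gen x)).symm.trans ?_
  exact congrArg (u p) (ezN_zero_left L K p.1.1 y x)

lemma slant_chainMap {K L L' : PSSet.{u}} (χ : L ⟶ L') {k : ℕ} (e : Chains L k)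
    {m n : ℤ} (h : m + k = n) (u : Cochain V n (smash K L')) :
    slant (chainMap χ k e) h u = slant e h (pull (smashMap (𝟙 K) χ) u) := by
  rw [← pull_slant, pull_id]

lemma slantFront_chainMap {K L L' : PSSet.{u}} (χ : L ⟶ L') {k : ℕ} (e : Chains L k)
    {m n : ℤ} (h : m + k = n) (u : Cochain V n (smash L' K)) :
    slantFront (chainMap χ k e) h u = slantFront e h (pull (smashMap χ (𝟙 K)) u) := by
  rw [← pull_slantFront, pull_id]

lemma slant_sum {K L : PSSet.{u}} {k : ℕ} {ι : Type*} (s : Finset ι) (c : ι → ℤ)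
    (e : ι → Chains L k) {m n : ℤ} (h : m + k = n) (u : Cochain V n (smash K L)) :
    slant (∑ a ∈ s, c a • e a) h u = ∑ a ∈ s, c a • slant (e a) h u := by
  funext p
  refine LinearMap.ext fun x => ?_
  rw [Finset.sum_apply, LinearMap.sum_apply]
  change u (p.right k h) (EZ K L p.1.1 k x (∑ a ∈ s, c a • e a)) =
    ∑ a ∈ s, c a • u (p.right k h) (EZ K L p.1.1 k x (e a))
  rw [map_sum]
  refine (map_sum (u (p.right k h)) _ _).trans (Finset.sum_congr rfl fun a _ => ?_)
  rw [map_zsmul]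
  exact map_zsmul (u (p.right k h)) _ _

lemma slantFront_sum {K L : PSSet.{u}} {k : ℕ} {ι : Type*} (s : Finset ι) (c : ι → ℤ)
    (e : ι → Chains L k) {m n : ℤ} (h : m + k = n) (u : Cochain V n (smash L K)) :
    slantFront (∑ a ∈ s, c a • e a) h u = ∑ a ∈ s, c a • slantFront (e a) h u := by
  funext p
  refine LinearMap.ext fun x => ?_
  rw [Finset.sum_apply, LinearMap.sum_apply]
  change u (p.left k h) (EZ L K k p.1.1 (∑ a ∈ s, c a • e a) x) =
    ∑ a ∈ s, c a • u (p.left k h) (EZ L K k p.1.1 (e a) x)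
  rw [map_sum, LinearMap.sum_apply]
  refine (map_sum (u (p.left k h)) _ _).trans (Finset.sum_congr rfl fun a _ => ?_)
  rw [map_zsmul]
  exact map_zsmul (u (p.left k h)) _ _

lemma bd_simplexChain (k : ℕ) :
    bd (simplexPlus.{u}.obj ⦋k + 1⦌) k (simplexChain (k + 1)) =
      ∑ a : Fin (k + 2), (-1 : ℤ) ^ (a : ℕ) •
        chainMap (simplexPlus.map (SimplexCategory.δ a)) k (simplexChain k) := by
  rw [simplexChain, bd_gen]
  refine Finset.sum_congr rfl fun a _ => ?_
  rw [simplexChain, chainMap_gen]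
  congr 2

/-- The pullback of cochains on `K ∧ Δ^k_+` along a simplicial operator. -/
noncomputable def operator {n : ℤ} {K : PSSet.{u}} {m k : ℕ} (θ : ⦋m⦌ ⟶ ⦋k⦌) :
    Cochain V n (smash K (simplexPlus.obj ⦋k⦌)) →ₗ[ℝ]
      Cochain V n (smash K (simplexPlus.obj ⦋m⦌)) :=
  pull (smashMap (𝟙 K) (simplexPlus.map θ))

lemma operator_comp {n : ℤ} {K : PSSet.{u}} {l m k : ℕ} (η : ⦋l⦌ ⟶ ⦋m⦌) (θ : ⦋m⦌ ⟶ ⦋k⦌)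
    (f : Cochain V n (smash K (simplexPlus.obj ⦋k⦌))) :
    operator (η ≫ θ) f = operator η (operator θ f) := by
  unfold operator
  rw [pull_pull]
  exact congrArg (fun φ => pull φ f)
    (SimplicialObject.hom_ext _ _ fun _ => smash_hom_ext fun x y => by cases y <;> rfl)

lemma operator_cobd {n' n : ℤ} (h : n' + 1 = n) {K : PSSet.{u}} {m k : ℕ} (θ : ⦋m⦌ ⟶ ⦋k⦌)
    (g : Cochain V n' (smash K (simplexPlus.obj ⦋k⦌))) :
    operator θ (cobd h _ g) = cobd h _ (operator θ g) := pull_cobd _ _ _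

lemma operator_gen {n : ℤ} {K : PSSet.{u}} {m k : ℕ} (θ : ⦋m⦌ ⟶ ⦋k⦌)
    (f : Cochain V n (smash K (simplexPlus.obj ⦋k⦌))) (p : Bideg n)
    (x : (K.obj (op ⦋p.1.1⦌)).X) (a : ⦋p.1.1⦌ ⟶ ⦋m⦌) :
    operator θ f p (gen (smk x (some (SSet.stdSimplex.objEquiv.symm a)))) =
      f p (gen (smk x (some (SSet.stdSimplex.objEquiv.symm (a ≫ θ))))) := by
  unfold operator
  rw [pull_gen]
  rfl

/-- The alternating sum of the faces. -/
noncomputable def altFace {n : ℤ} {K : PSSet.{u}} {k : ℕ}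
    (g : Cochain V n (smash K (simplexPlus.obj ⦋k + 1⦌))) :
    Cochain V n (smash K (simplexPlus.obj ⦋k⦌)) :=
  ∑ a : Fin (k + 2), (-1 : ℤ) ^ (a : ℕ) • operator (SimplexCategory.δ a) g

/-- The properties of the slant products with the chains `[Δ^k_+]` that determine them up to
coboundaries: the normalization in degree `0` and Stokes' formula. For the slant product with
`[Δ^k_+]` behind, `ε = -1`; with `[Δ^k_+]` in front, `ε = 1`. -/
structure IsSimplexSlant (ε : ℤ) (S : ∀ (k : ℕ) {m n : ℤ} (_ : m + k = n) (K : PSSet.{u}),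
    Cochain V n (smash K (simplexPlus.obj ⦋k⦌)) →ₗ[ℝ] Cochain V m K) : Prop where
  mul_self : ε * ε = 1
  zero : ∀ {n : ℤ} (h : n + (0 : ℕ) = n) (K : PSSet.{u}) (f),
    S 0 h K f = pull (pointIncl K (topSimplex 0)) f
  stokes : ∀ (k : ℕ) {m' m n' n : ℤ} (hm : m' + 1 = m) (hn : n' + 1 = n)
    (h : m + (k + 1 : ℕ) = n) (h' : m' + (k + 1 : ℕ) = n') (h'' : m + (k : ℕ) = n')
    (K : PSSet.{u}) (g : Cochain V n' (smash K (simplexPlus.obj ⦋k + 1⦌))),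
    ∃ c : ℤ, S (k + 1) h K (cobd hn _ g) =
      c • cobd hm K (S (k + 1) h' K g) + twist ε (S k h'' K (altFace g))

/-- The slant product with `[Δ^k_+]` behind. -/
lemma isSimplexSlant_slant :
    IsSimplexSlant (V := V) (-1) fun k {_ _} h _ => slant (simplexChain k) h where
  mul_self := rfl
  zero h K f := slant_gen_zero _ h f
  stokes k m' m n' n hm hn h h' h'' K g := by
    refine ⟨1, ?_⟩
    rw [slant_cobd _ hm hn h h' h'', bd_simplexChain, slant_sum, one_smul, altFace, map_sum]
    congr 2
    refine Finset.sum_congr rfl fun a _ => ?_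
    rw [slant_chainMap, map_zsmul]
    rfl

/-- The slant product with `[Δ^k_+]` in front. -/
lemma isSimplexSlant_slantFront :
    IsSimplexSlant (V := V) 1 fun k {_ _} h K =>
      slantFront (simplexChain k) h ∘ₗ pull (smashSwap (simplexPlus.obj ⦋k⦌) K) where
  mul_self := rfl
  zero h K f := by
    rw [LinearMap.comp_apply, simplexChain, slantFront_gen_zero, pull_pull]
    rfl
  stokes k m' m n' n hm hn h h' h'' K g := by
    refine ⟨(-1) ^ (k + 1), ?_⟩
    rw [LinearMap.comp_apply, pull_cobd, slantFront_cobd _ hm hn h h' h'', bd_simplexChain,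
      slantFront_sum, altFace, map_sum]
    congr 1
    have h1 : ∀ u : Cochain V m K, twist 1 u = u := fun u => by
      funext p
      change (1 : ℤ) ^ p.1.1 • u p = u p
      rw [one_pow, one_smul]
    rw [h1]
    refine Finset.sum_congr rfl fun a _ => ?_
    rw [slantFront_chainMap, map_zsmul, LinearMap.comp_apply, pull_pull, operator, pull_pull]
    have h2 : smashMap (simplexPlus.map (SimplexCategory.δ a)) (𝟙 K) ≫ smashSwap _ K =
        smashSwap _ K ≫ smashMap (𝟙 K) (simplexPlus.map (SimplexCategory.δ a)) :=
      SimplicialObject.hom_ext _ _ fun _ => smash_hom_ext fun _ _ => rfl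
    exact congrArg (fun φ => (-1 : ℤ) ^ (a : ℕ) • slantFront (simplexChain k) h'' (pull φ g)) h2

/-- The inclusion of an end of the cylinder `K ∧ Δ^1_+`: the vertex `1` for `a = 0`, and the
vertex `0` for `a = 1`. -/
def cylinderEnd (K : PSSet.{u}) (a : Fin 2) : K ⟶ smash K (simplexPlus.obj ⦋1⦌) :=
  pointIncl K (topSimplex 0) ≫ smashMap (𝟙 K) (simplexPlus.map (SimplexCategory.δ a))

/-- Pullbacks of a cocycle along homotopic maps are cohomologous, by a cochain that is natural in
the source of the homotopy. -/
lemma exists_homotopy_cobd {L L' : PSSet.{u}} (H : smash L (simplexPlus.obj ⦋1⦌) ⟶ L')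
    {n' n : ℤ} (hn : n' + 1 = n) {u : Cochain V n L'} (hu : u ∈ cocycles V n L') :
    ∃ g : Cochain V n' L,
      cobd hn L g = pull (cylinderEnd L 0 ≫ H) u - pull (cylinderEnd L 1 ≫ H) u ∧
      ∀ {L₀ : PSSet.{u}} (φ : L₀ ⟶ L),
        pull (smashMap φ (𝟙 (simplexPlus.obj ⦋1⦌)) ≫ H) u = 0 → pull φ g = 0 := by
  refine ⟨twist (-1) (slant (simplexChain 1) (by push_cast; omega) (pull H u)), ?_, ?_⟩
  · have h := slant_cobd (simplexChain.{u} 1) hn (rfl : n + 1 = n + 1) (by push_cast; omega)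
      (by push_cast; omega) (by simp) (pull H u)
    have h0 : ∀ w : Cochain V n (smash L (simplexPlus.obj ⦋0⦌)),
        slant (simplexChain 0) (by simp) w = pull (pointIncl L (topSimplex 0)) w :=
      fun w => slant_gen_zero _ _ w
    rw [(cobd_eq_zero_iff _ _).2 (pull_mem H u hu), map_zero, bd_simplexChain, slant_sum] at h
    have h' := congrArg (twist (-1)) (eq_neg_of_add_eq_zero_left h.symm)
    rw [twist_cobd, neg_one_smul, ← neg_one_smul ℤ (twist (-1) (Finset.sum _ _)),
      twist_zsmul, twist_twist rfl, neg_one_smul, neg_inj] at h'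
    rw [h', Fin.sum_univ_two, slant_chainMap, slant_chainMap, h0, h0, pull_pull, pull_pull,
      pull_pull, pull_pull, sub_eq_add_neg, ← neg_one_smul ℤ (pull (cylinderEnd L 1 ≫ H) u)]
    exact congrArg₂ (· + ·) (one_smul _ _) rfl
  · intro L₀ φ h
    have h1 : pull φ (slant (simplexChain.{u} 1) (by push_cast; omega) (pull H u) :
        Cochain V n' L) = 0 := by
      have := pull_slant φ (𝟙 (simplexPlus.{u}.obj ⦋1⦌)) (simplexChain 1)
        (by push_cast; omega : n' + (1 : ℕ) = n) (pull H u)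
      rw [pull_pull, h, map_zero] at this
      refine Eq.trans (congrArg (fun e => pull φ (slant e _ (pull H u))) ?_) this
      exact (chainMap_gen (𝟙 (simplexPlus.{u}.obj ⦋1⦌)) 1 (topSimplex 1)).symm
    funext p
    have h2 := congrFun h1 p
    refine LinearMap.ext fun c => ?_
    exact (congrArg (fun v => (-1 : ℤ) ^ p.1.1 • v) (LinearMap.congr_fun h2 c)).trans (smul_zero _)

end

/-! ### Contractions of simplices -/

/-- The contraction of `Δ^k` to its vertex `0`: the map `i ↦ θ(i)` where `t(i) = 1`, and `0` where
`t(i) = 0`. -/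
def contrHom {m : SimplexCategory} {k : ℕ} (θ : m ⟶ ⦋k⦌) (t : m ⟶ ⦋1⦌) : m ⟶ ⦋k⦌ :=
  SimplexCategory.Hom.mk
    { toFun := fun i => if t.toOrderHom i = (0 : Fin 2) then (0 : Fin (k + 1)) else θ.toOrderHom i
      monotone' := fun a b hab => by
        dsimp only
        by_cases ha : t.toOrderHom a = (0 : Fin 2)
        · rw [if_pos ha]; exact Fin.zero_le _
        · have hb : t.toOrderHom b ≠ (0 : Fin 2) := fun hb => ha (by
            have := t.toOrderHom.monotone hab
            rw [hb] at this
            exact Fin.le_zero_iff.1 this)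
          rw [if_neg ha, if_neg hb]
          exact θ.toOrderHom.monotone hab }

lemma contrHom_apply {m : SimplexCategory} {k : ℕ} (θ : m ⟶ ⦋k⦌) (t : m ⟶ ⦋1⦌)
    (i : Fin (m.len + 1)) : (contrHom θ t).toOrderHom i =
      if t.toOrderHom i = (0 : Fin 2) then (0 : Fin (k + 1)) else θ.toOrderHom i := rfl

lemma comp_contrHom {m m' : SimplexCategory} {k : ℕ} (η : m' ⟶ m) (θ : m ⟶ ⦋k⦌) (t : m ⟶ ⦋1⦌) :
    η ≫ contrHom θ t = contrHom (η ≫ θ) (η ≫ t) := rfl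

lemma contrHom_const_one {m : SimplexCategory} {k : ℕ} (θ : m ⟶ ⦋k⦌) :
    contrHom θ (SimplexCategory.const m ⦋1⦌ 1) = θ := by
  ext i
  change ((if (1 : Fin 2) = 0 then (0 : Fin (k + 1)) else θ.toOrderHom i : Fin (k + 1)) : ℕ) = _
  rw [if_neg one_ne_zero]

lemma contrHom_const_zero {m : SimplexCategory} {k : ℕ} (θ : m ⟶ ⦋k⦌) :
    contrHom θ (SimplexCategory.const m ⦋1⦌ 0) = SimplexCategory.const m ⦋k⦌ 0 := rfl

lemma contrHom_zero_left {m : SimplexCategory} {k : ℕ} (t : m ⟶ ⦋1⦌) :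
    contrHom (SimplexCategory.const m ⦋k⦌ 0) t = SimplexCategory.const m ⦋k⦌ 0 := by
  ext i
  change ((if t.toOrderHom i = (0 : Fin 2) then (0 : Fin (k + 1)) else 0 : Fin (k + 1)) : ℕ) = 0
  split_ifs <;> rfl

lemma contrHom_comp {m : SimplexCategory} {k k' : ℕ} (θ : m ⟶ ⦋k⦌) (t : m ⟶ ⦋1⦌)
    (η : ⦋k⦌ ⟶ ⦋k'⦌) (h : η.toOrderHom (0 : Fin (k + 1)) = (0 : Fin (k' + 1))) :
    contrHom (θ ≫ η) t = contrHom θ t ≫ η := by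
  ext i
  change ((if t.toOrderHom i = (0 : Fin 2) then (0 : Fin (k' + 1)) else
      η.toOrderHom (θ.toOrderHom i) : Fin (k' + 1)) : ℕ) =
    (η.toOrderHom (if t.toOrderHom i = (0 : Fin 2) then (0 : Fin (k + 1)) else θ.toOrderHom i) :
      Fin (k' + 1))
  split_ifs
  · rw [h]
  · rfl

/-- The contraction of `Δ^k` to its vertex `0`, as a map `Δ^k_+ ∧ Δ^1_+ → Δ^k_+`. -/
def simplexContr (k : ℕ) :
    smash (simplexPlus.{u}.obj ⦋k⦌) (simplexPlus.obj ⦋1⦌) ⟶ simplexPlus.obj ⦋k⦌ where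
  app _ := smashHom
    (Option.map₂ fun a b => SSet.stdSimplex.objEquiv.symm
      (contrHom (SSet.stdSimplex.objEquiv a) (SSet.stdSimplex.objEquiv b)))
    (fun _ => rfl) (fun x => by cases x <;> rfl)
  naturality _ _ _ := smash_hom_ext fun x y => by
    cases x <;> cases y <;> rfl

/-- The contraction of `K ∧ Δ^k_+` to the vertex `0` of `Δ^k`. -/
def contraction (K : PSSet.{u}) (k : ℕ) :
    smash (smash K (simplexPlus.{u}.obj ⦋k⦌)) (simplexPlus.obj ⦋1⦌) ⟶
      smash K (simplexPlus.obj ⦋k⦌) :=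
  smashAssocInv K _ _ ≫ smashMap (𝟙 K) (simplexContr k)

lemma cylinderEnd_contraction_zero (K : PSSet.{u}) (k : ℕ) :
    cylinderEnd _ 0 ≫ contraction K k = 𝟙 _ := by
  refine SimplicialObject.hom_ext _ _ fun n => smash_hom_ext fun x y => ?_
  cases y with
  | none => rfl
  | some a =>
    exact congrArg (fun c => smk (Q := (simplexPlus.obj ⦋k⦌).obj n) x
      (some (SSet.stdSimplex.objEquiv.symm c))) (contrHom_const_one (SSet.stdSimplex.objEquiv a))

lemma cylinderEnd_contraction_one (K : PSSet.{u}) (k : ℕ) :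
    cylinderEnd _ 1 ≫ contraction K k =
      smashMap (𝟙 K) (simplexPlus.map (SimplexCategory.const ⦋k⦌ ⦋k⦌ 0)) :=
  SimplicialObject.hom_ext _ _ fun _ => smash_hom_ext fun x y => by
    cases y <;> rfl

lemma smashMap_contraction (K : PSSet.{u}) {k k' : ℕ} (η : ⦋k⦌ ⟶ ⦋k'⦌)
    (h : η.toOrderHom (0 : Fin (k + 1)) = (0 : Fin (k' + 1))) :
    smashMap (smashMap (𝟙 K) (simplexPlus.map η)) (𝟙 _) ≫ contraction K k' =
      contraction K k ≫ smashMap (𝟙 K) (simplexPlus.map η) := by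
  refine SimplicialObject.hom_ext _ _ fun n => smash_hom_ext fun w z => ?_
  revert w
  refine smash_ind fun x y => ?_
  cases y with
  | none => cases z <;> rfl
  | some a =>
    cases z with
    | none => rfl
    | some b =>
      exact congrArg (fun c => smk (Q := (simplexPlus.obj ⦋k'⦌).obj n) x
        (some (SSet.stdSimplex.objEquiv.symm c)))
        (contrHom_comp (SSet.stdSimplex.objEquiv a) (SSet.stdSimplex.objEquiv b) η h)

/-- The contraction of the interval to its base point. -/
def intervalContr : smash interval.{u} (simplexPlus.obj ⦋1⦌) ⟶ interval where
  app n := smashHom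
    (fun a o => Option.elim o (interval.obj n).point fun b => SSet.stdSimplex.objEquiv.symm
      (contrHom (SSet.stdSimplex.objEquiv a) (SSet.stdSimplex.objEquiv b)))
    (fun o => by
      cases o with
      | none => rfl
      | some b => exact congrArg SSet.stdSimplex.objEquiv.symm (contrHom_zero_left _))
    (fun _ => rfl)
  naturality _ _ _ := smash_hom_ext fun x y => by
    cases y <;> rfl

lemma cylinderEnd_intervalContr_zero (K : PSSet.{u}) :
    cylinderEnd _ 0 ≫ smashAssocInv K interval _ ≫ smashMap (𝟙 K) intervalContr = 𝟙 _ :=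
  SimplicialObject.hom_ext _ _ fun n => smash_hom_ext fun x a =>
    congrArg (fun c => smk (Q := interval.obj n) x (SSet.stdSimplex.objEquiv.symm c))
      (contrHom_const_one (SSet.stdSimplex.objEquiv a))

lemma cylinderEnd_intervalContr_one (K : PSSet.{u}) :
    cylinderEnd _ 1 ≫ smashAssocInv K interval _ ≫ smashMap (𝟙 K) intervalContr =
      constHom _ _ :=
  SimplicialObject.hom_ext _ _ fun _ => smash_hom_ext fun x _ => smk_right x

section

variable {V : ℤ → Type u} [∀ j, AddCommGroup (V j)] [∀ j, Module ℝ (V j)]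

lemma pull_constHom {n : ℤ} {K L : PSSet.{u}} (u : Cochain V n L) :
    pull (constHom K L) u = 0 :=
  cochain_ext fun p x => by
    rw [pull_gen]
    exact (congrArg (u p) (gen_point _)).trans (map_zero _)

/-- Every cocycle on the cone `K ∧ Δ^1` is a coboundary. -/
lemma exists_cone_primitive {n' n : ℤ} (hn : n' + 1 = n) {K : PSSet.{u}}
    {u : Cochain V n (smash K interval)} (hu : u ∈ cocycles V n (smash K interval)) :
    ∃ g, cobd hn _ g = u := by
  obtain ⟨g, hg, -⟩ := exists_homotopy_cobd
    (smashAssocInv K interval _ ≫ smashMap (𝟙 K) intervalContr) hn hu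
  refine ⟨g, ?_⟩
  rw [hg, cylinderEnd_intervalContr_zero, cylinderEnd_intervalContr_one, pull_constHom, pull_id,
    sub_zero]

/-- A cochain on `K ∧ Δ^k_+` is zero if it vanishes on all `x ∧ a`. -/
lemma cochain_simplex_ext {n : ℤ} {K : PSSet.{u}} {k : ℕ}
    {f g : Cochain V n (smash K (simplexPlus.obj ⦋k⦌))}
    (h : ∀ p (x : (K.obj (op ⦋p.1.1⦌)).X) (a : ⦋p.1.1⦌ ⟶ ⦋k⦌),
      f p (gen (smk x (some (SSet.stdSimplex.objEquiv.symm a)))) =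
        g p (gen (smk x (some (SSet.stdSimplex.objEquiv.symm a))))) : f = g := by
  refine cochain_ext fun p => smash_ind fun x o => ?_
  cases o with
  | none =>
    exact ((congrArg (f p) (gen_smk_right x)).trans (map_zero _)).trans
      ((congrArg (g p) (gen_smk_right x)).trans (map_zero _)).symm
  | some a => exact h p x (SSet.stdSimplex.objEquiv a)

/-- The cochains on `K ∧ Δ^k_+` that vanish on `K ∧ ∂Δ^k_+`. -/
def VanishesOnBoundary {n : ℤ} {K : PSSet.{u}} {k : ℕ}
    (f : Cochain V n (smash K (simplexPlus.obj ⦋k⦌))) : Prop :=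
  ∀ {m : ℕ} (θ : ⦋m⦌ ⟶ ⦋k⦌), ¬ Function.Surjective θ.toOrderHom → operator θ f = 0

lemma operator_eq_zero_of_missing {n : ℤ} {K : PSSet.{u}} {k : ℕ} {j : Fin (k + 2)}
    {f : Cochain V n (smash K (simplexPlus.obj ⦋k + 1⦌))}
    (h : operator (SimplexCategory.δ j) f = 0) {m : ℕ} (θ : ⦋m⦌ ⟶ ⦋k + 1⦌)
    (hθ : ∀ i, θ.toOrderHom i ≠ j) : operator θ f = 0 := by
  obtain ⟨θ', rfl⟩ := SimplexCategory.eq_comp_δ_of_not_surjective' θ j hθ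
  rw [operator_comp, h, map_zero]

lemma vanishesOnBoundary_zero {n : ℤ} {K : PSSet.{u}}
    (f : Cochain V n (smash K (simplexPlus.obj ⦋0⦌))) : VanishesOnBoundary f :=
  fun _ hθ => absurd (fun _ => ⟨0, Subsingleton.elim (α := Fin 1) _ _⟩) hθ

lemma vanishesOnBoundary_succ {n : ℤ} {K : PSSet.{u}} {k : ℕ}
    {f : Cochain V n (smash K (simplexPlus.obj ⦋k + 1⦌))}
    (h : ∀ j : Fin (k + 2), operator (SimplexCategory.δ j) f = 0) : VanishesOnBoundary f := by
  intro m θ hθ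
  obtain ⟨j, hj⟩ := not_forall.1 hθ
  exact operator_eq_zero_of_missing (h j) θ fun i hi => hj ⟨i, hi⟩

lemma not_surjective_δ {k : ℕ} (j : Fin (k + 2)) :
    ¬ Function.Surjective (SimplexCategory.δ j).toOrderHom := fun h => by
  obtain ⟨i, hi⟩ := h j
  exact Fin.succAbove_ne j i hi

lemma VanishesOnBoundary.face {n : ℤ} {K : PSSet.{u}} {k : ℕ}
    {f : Cochain V n (smash K (simplexPlus.obj ⦋k + 1⦌))} (hf : VanishesOnBoundary f)
    (j : Fin (k + 2)) : operator (SimplexCategory.δ j) f = 0 := hf _ (not_surjective_δ j)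

/-- A relative cocycle on `(Δ^{k+1}, ∂Δ^{k+1})` is the coboundary of a cochain that vanishes on
all faces but the face opposite to the vertex `0`, since `Δ^{k+1}` and these faces contract to that
vertex. -/
lemma exists_primitive {n' n : ℤ} (hn : n' + 1 = n) {K : PSSet.{u}} {k : ℕ}
    {f : Cochain V n (smash K (simplexPlus.obj ⦋k + 1⦌))}
    (hf : f ∈ cocycles V n (smash K (simplexPlus.obj ⦋k + 1⦌))) (hb : VanishesOnBoundary f) :
    ∃ G, cobd hn _ G = f ∧ ∀ j : Fin (k + 1), operator (SimplexCategory.δ j.succ) G = 0 := by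
  obtain ⟨G, hG, hG'⟩ := exists_homotopy_cobd (contraction K (k + 1)) hn hf
  refine ⟨G, ?_, fun j => hG' _ ?_⟩
  · rw [hG, cylinderEnd_contraction_zero, cylinderEnd_contraction_one, pull_id]
    refine (congrArg (f - ·) (hb (SimplexCategory.const ⦋k + 1⦌ ⦋k + 1⦌ 0) fun h => ?_)).trans
      (sub_zero f)
    obtain ⟨i, hi⟩ := h (1 : Fin (k + 2))
    exact zero_ne_one (α := Fin (k + 2)) hi
  · rw [smashMap_contraction K (SimplexCategory.δ j.succ)
      (Fin.succAbove_ne_zero_zero (Fin.succ_ne_zero j)), ← pull_pull]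
    exact (congrArg (pull _) (hb.face j.succ)).trans (map_zero _)

open Classical in
/-- The extension by zero of a cochain on `K ∧ Δ^k_+` along the face of `Δ^{k+1}` opposite to the
vertex `0`. -/
noncomputable def extendFace {n : ℤ} {K : PSSet.{u}} {k : ℕ}
    (g : Cochain V n (smash K (simplexPlus.obj ⦋k⦌))) :
    Cochain V n (smash K (simplexPlus.obj ⦋k + 1⦌)) := fun p =>
  redLift (P := (smash K (simplexPlus.obj ⦋k + 1⦌)).obj (op ⦋p.1.1⦌))
    (smashLift (P := K.obj (op ⦋p.1.1⦌)) (Q := (simplexPlus.obj ⦋k + 1⦌).obj (op ⦋p.1.1⦌))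
      (fun x o => Option.elim o 0 fun a =>
        if ∃ i, (SSet.stdSimplex.objEquiv a).toOrderHom i = (0 : Fin (k + 2)) then 0 else
          g p (gen (smk x (some (SSet.stdSimplex.objEquiv.symm
            (SSet.stdSimplex.objEquiv a ≫ SimplexCategory.σ 0)))))) 0
      (fun o => by
        cases o with
        | none => rfl
        | some a =>
          dsimp only [Option.elim]
          split_ifs
          · rfl
          · exact (congrArg (g p) (gen_smk_left _)).trans (map_zero _))
      (fun _ => rfl)) rfl

open Classical in
lemma extendFace_gen {n : ℤ} {K : PSSet.{u}} {k : ℕ}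
    (g : Cochain V n (smash K (simplexPlus.obj ⦋k⦌))) (p : Bideg n)
    (x : (K.obj (op ⦋p.1.1⦌)).X) (a : ⦋p.1.1⦌ ⟶ ⦋k + 1⦌) :
    extendFace g p (gen (smk x (some (SSet.stdSimplex.objEquiv.symm a)))) =
      if ∃ i, a.toOrderHom i = (0 : Fin (k + 2)) then 0 else
        g p (gen (smk x (some (SSet.stdSimplex.objEquiv.symm (a ≫ SimplexCategory.σ 0))))) :=
  redLift_gen _ _ _

lemma face_zero_extendFace {n : ℤ} {K : PSSet.{u}} {k : ℕ}
    (g : Cochain V n (smash K (simplexPlus.obj ⦋k⦌))) :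
    operator (SimplexCategory.δ 0) (extendFace g) = g := by
  refine cochain_simplex_ext fun p x a => ?_
  rw [operator_gen, extendFace_gen, if_neg, Category.assoc]
  · erw [SimplexCategory.δ_comp_σ_self (i := (0 : Fin (k + 1)))]
    rw [Category.comp_id]
  · rintro ⟨i, hi⟩
    exact Fin.succ_ne_zero _ hi

lemma face_succ_extendFace {n : ℤ} {K : PSSet.{u}} {k : ℕ}
    {g : Cochain V n (smash K (simplexPlus.obj ⦋k⦌))} (hg : VanishesOnBoundary g)
    (j : Fin (k + 1)) : operator (SimplexCategory.δ j.succ) (extendFace g) = 0 := by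
  refine cochain_simplex_ext fun p x a => ?_
  rw [operator_gen, extendFace_gen]
  split_ifs with h
  · rfl
  · have hs : ¬ Function.Surjective
        ((a ≫ SimplexCategory.δ j.succ) ≫ SimplexCategory.σ 0).toOrderHom := by
      intro hs
      obtain ⟨i, hi⟩ := hs j
      have h1 := not_exists.1 h i
      have h2 : (a ≫ SimplexCategory.δ j.succ).toOrderHom i ≠ j.succ := Fin.succAbove_ne _ _
      rw [Fin.ext_iff] at h1
      rw [ne_eq, Fin.ext_iff, Fin.val_succ] at h2
      have h3 : (((a ≫ SimplexCategory.δ j.succ).toOrderHom i : Fin (k + 2)) : ℕ) - 1 = j :=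
        (if_pos (Nat.pos_of_ne_zero h1)).symm.trans
          ((σ_val (0 : Fin (k + 1)) _).symm.trans (congrArg Fin.val hi))
      have h4 := Nat.pos_of_ne_zero h1
      omega
    have := congrFun (hg _ hs) p
    refine Eq.trans ?_ (LinearMap.congr_fun this (gen (smk x (topSimplex p.1.1))))
    exact ((operator_gen _ g p x (𝟙 _)).trans (by rw [Category.id_comp])).symm

end

/-! ### Relative cocycles on simplices and slant products -/

section

variable {V : ℤ → Type u} [∀ j, AddCommGroup (V j)] [∀ j, Module ℝ (V j)]

lemma altFace_eq {n : ℤ} {K : PSSet.{u}} {k : ℕ}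
    {G : Cochain V n (smash K (simplexPlus.obj ⦋k + 1⦌))}
    (hG : ∀ j : Fin (k + 1), operator (SimplexCategory.δ j.succ) G = 0) :
    altFace G = operator (SimplexCategory.δ 0) G := by
  rw [altFace, Fin.sum_univ_succ, Finset.sum_eq_zero fun j _ => by rw [hG, smul_zero], add_zero]
  exact one_smul _ _

/-- The face opposite to the vertex `0` vanishes on the boundary if all other faces vanish. -/
lemma vanishesOnBoundary_face_zero {n : ℤ} {K : PSSet.{u}} {k : ℕ}
    {G : Cochain V n (smash K (simplexPlus.obj ⦋k + 1⦌))}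
    (hG : ∀ j : Fin (k + 1), operator (SimplexCategory.δ j.succ) G = 0) :
    VanishesOnBoundary (operator (SimplexCategory.δ 0) G) := by
  intro m θ hθ
  obtain ⟨j, hj⟩ := not_forall.1 hθ
  rw [← operator_comp]
  refine operator_eq_zero_of_missing (hG j) _ fun i hi => hj ⟨i, ?_⟩
  exact Fin.succ_injective _ hi

variable {ε : ℤ} {S : ∀ (k : ℕ) {m n : ℤ} (_ : m + k = n) (K : PSSet.{u}),
    Cochain V n (smash K (simplexPlus.obj ⦋k⦌)) →ₗ[ℝ] Cochain V m K}

/-- Up to coboundaries, the slant product of `δG` is the slant product of the face of `G` opposite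
to the vertex `0`, if the other faces of `G` vanish. -/
lemma IsSimplexSlant.step (hS : IsSimplexSlant ε S) {k : ℕ} {m n' n : ℤ} (hn : n' + 1 = n)
    (h : m + (k + 1 : ℕ) = n) (h' : m + (k : ℕ) = n') {K : PSSet.{u}}
    {G : Cochain V n' (smash K (simplexPlus.obj ⦋k + 1⦌))}
    (hG : ∀ j : Fin (k + 1), operator (SimplexCategory.δ j.succ) G = 0) :
    IsCobd (S (k + 1) h K (cobd hn _ G) -
      twist ε (S k h' K (operator (SimplexCategory.δ 0) G))) := by
  obtain ⟨c, hc⟩ := hS.stokes k (sub_add_cancel m 1) hn h (by push_cast at h ⊢; omega) h' K G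
  rw [hc, altFace_eq hG, add_sub_cancel_right]
  exact (isCobd_cobd _ _).zsmul c

lemma IsSimplexSlant.isCobd_altFace (hS : IsSimplexSlant ε S) {k : ℕ} {m n : ℤ}
    (h : m + (k : ℕ) = n) {K : PSSet.{u}} {f : Cochain V n (smash K (simplexPlus.obj ⦋k + 1⦌))}
    (hf : f ∈ cocycles V n (smash K (simplexPlus.obj ⦋k + 1⦌))) :
    IsCobd (S k h K (altFace f)) := by
  obtain ⟨c, hc⟩ := hS.stokes k (sub_add_cancel m 1) (rfl : n + 1 = n + 1)
    (by push_cast; omega) (by push_cast; omega) h K f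
  rw [(cobd_eq_zero_iff _ _).2 hf, map_zero] at hc
  have h1 := ((isCobd_cobd (sub_add_cancel m 1)
    (S (k + 1) (by push_cast; omega) K f)).zsmul c).neg.twist ε
  rwa [neg_eq_of_add_eq_zero_right hc.symm, twist_twist hS.mul_self] at h1

/-- A primitive as in `exists_primitive`, with the face on which it may not vanish. -/
lemma exists_primitive_face {n' n : ℤ} (hn : n' + 1 = n) {K : PSSet.{u}} {k : ℕ}
    {f : Cochain V n (smash K (simplexPlus.obj ⦋k + 1⦌))}
    (hf : f ∈ cocycles V n (smash K (simplexPlus.obj ⦋k + 1⦌))) (hb : VanishesOnBoundary f) :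
    ∃ G, cobd hn _ G = f ∧ (∀ j : Fin (k + 1), operator (SimplexCategory.δ j.succ) G = 0) ∧
      operator (SimplexCategory.δ 0) G ∈ cocycles V n' (smash K (simplexPlus.obj ⦋k⦌)) ∧
      VanishesOnBoundary (operator (SimplexCategory.δ 0) G) := by
  obtain ⟨G, rfl, hG⟩ := exists_primitive hn hf hb
  refine ⟨G, rfl, hG, ?_, vanishesOnBoundary_face_zero hG⟩
  rw [← cobd_eq_zero_iff hn, ← operator_cobd]
  exact hb.face 0

/-- The slant product of a relative cocycle is a cocycle. By `IsSimplexSlant.step`, it is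
cohomologous to a slant product with a simplex of smaller dimension. -/
lemma IsSimplexSlant.mem (hS : IsSimplexSlant ε S) (k : ℕ) {m n : ℤ} (h : m + (k : ℕ) = n)
    {K : PSSet.{u}} {f : Cochain V n (smash K (simplexPlus.obj ⦋k⦌))}
    (hf : f ∈ cocycles V n (smash K (simplexPlus.obj ⦋k⦌))) (hb : VanishesOnBoundary f) :
    S k h K f ∈ cocycles V m K := by
  induction k generalizing n with
  | zero =>
    obtain rfl : m = n := by simpa using h
    rw [hS.zero]
    exact pull_mem _ _ hf
  | succ k ih =>
    obtain ⟨G, rfl, hG, hc, hv⟩ := exists_primitive_face (sub_add_cancel n 1) hf hb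
    have h' : m + (k : ℕ) = n - 1 := by push_cast at h; omega
    have := (hS.step (sub_add_cancel n 1) h h' hG).mem
    simpa using add_mem this (twist_mem ε (ih h' hc hv))

/-- The projection `K ∧ Δ^0_+ → K`. -/
def projPoint (K : PSSet.{u}) : smash K (simplexPlus.obj ⦋0⦌) ⟶ K where
  app n := smashHom (fun x o => Option.elim o (K.obj n).point fun _ => x)
    (fun o => by cases o <;> rfl) (fun _ => rfl)
  naturality n m f := smash_hom_ext fun x o => by
    cases o with
    | none => exact ((K.map f).map_point).symm
    | some a => rfl

lemma pointIncl_projPoint (K : PSSet.{u}) : pointIncl K (topSimplex 0) ≫ projPoint K = 𝟙 K := rfl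

lemma projPoint_pointIncl (K : PSSet.{u}) : projPoint K ≫ pointIncl K (topSimplex 0) = 𝟙 _ := by
  refine SimplicialObject.hom_ext _ _ fun n => smash_hom_ext fun x o => ?_
  cases o with
  | none => exact (smk_left _).trans (smk_right x).symm
  | some a =>
    exact congrArg (fun c => smk (Q := (simplexPlus.obj ⦋0⦌).obj n) x (some c))
      (SSet.stdSimplex.objEquiv.injective (Subsingleton.elim (α := n.unop ⟶ ⦋0⦌) _ _))

/-- A relative cocycle on `(Δ^k, ∂Δ^k)` whose slant product is a coboundary is a face of a cocycle
all of whose other faces are zero. -/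
lemma IsSimplexSlant.exists_cobd (hS : IsSimplexSlant ε S) (k : ℕ) {m n : ℤ}
    (h : m + (k : ℕ) = n) {K : PSSet.{u}} {f : Cochain V n (smash K (simplexPlus.obj ⦋k⦌))}
    (hf : f ∈ cocycles V n (smash K (simplexPlus.obj ⦋k⦌))) (hb : VanishesOnBoundary f)
    (hc : IsCobd (S k h K f)) :
    ∃ g ∈ cocycles V n (smash K (simplexPlus.obj ⦋k + 1⦌)),
      operator (SimplexCategory.δ 0) g = f ∧
      ∀ j : Fin (k + 1), operator (SimplexCategory.δ j.succ) g = 0 := by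
  -- it suffices to write `f` as the coboundary of a cochain vanishing on the boundary
  suffices H : ∃ G : Cochain V (n - 1) (smash K (simplexPlus.obj ⦋k⦌)),
      cobd (sub_add_cancel n 1) _ G = f ∧ VanishesOnBoundary G by
    obtain ⟨G, rfl, hG⟩ := H
    refine ⟨cobd (sub_add_cancel n 1) _ (extendFace G), cobd_mem _ _, ?_, fun j => ?_⟩
    · rw [operator_cobd, face_zero_extendFace]
    · rw [operator_cobd, face_succ_extendFace hG, map_zero]
  induction k generalizing n with
  | zero =>
    obtain rfl : m = n := by simpa using h
    rw [hS.zero, isCobd_iff (sub_add_cancel m 1)] at hc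
    obtain ⟨g, hg⟩ := hc
    refine ⟨pull (projPoint K) g, ?_, vanishesOnBoundary_zero _⟩
    rw [← pull_cobd, hg, pull_pull, projPoint_pointIncl, pull_id]
  | succ k ih =>
    obtain ⟨G, rfl, hG, hc', hv⟩ := exists_primitive_face (sub_add_cancel n 1) hf hb
    have h' : m + (k : ℕ) = n - 1 := by push_cast at h; omega
    have h1 := (hc.sub (hS.step (sub_add_cancel n 1) h h' hG)).twist ε
    rw [sub_sub_cancel, twist_twist hS.mul_self] at h1
    obtain ⟨G₁, hG₁, hv₁⟩ := ih h' hc' hv h1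
    -- correct `G` so that its last nonzero face vanishes as well
    refine ⟨G - cobd (sub_add_cancel (n - 1) 1) _ (extendFace G₁), ?_, ?_⟩
    · rw [map_sub, (cobd_eq_zero_iff _ _).2 (cobd_mem _ _), sub_zero]
    · refine vanishesOnBoundary_succ (Fin.cases ?_ fun j => ?_)
      · rw [map_sub, operator_cobd, face_zero_extendFace, hG₁, sub_self]
      · rw [map_sub, operator_cobd, face_succ_extendFace hv₁, map_zero, hG, sub_zero]

/-- Each cocycle on `K` is cohomologous to the slant product of a relative cocycle on
`(Δ^k, ∂Δ^k)`. -/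
lemma IsSimplexSlant.exists_preimage (hS : IsSimplexSlant ε S) (k : ℕ) {m n : ℤ}
    (h : m + (k : ℕ) = n) {K : PSSet.{u}} {y : Cochain V m K} (hy : y ∈ cocycles V m K) :
    ∃ f ∈ cocycles V n (smash K (simplexPlus.obj ⦋k⦌)), VanishesOnBoundary f ∧
      IsCobd (S k h K f - y) := by
  induction k generalizing n y with
  | zero =>
    obtain rfl : m = n := by simpa using h
    refine ⟨pull (projPoint K) y, pull_mem _ _ hy, vanishesOnBoundary_zero _, ?_⟩
    rw [hS.zero, pull_pull, pointIncl_projPoint, pull_id, sub_self]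
    exact .zero
  | succ k ih =>
    have h' : m + (k : ℕ) = n - 1 := by push_cast at h; omega
    obtain ⟨g, hg, hv, hc⟩ := ih h' (twist_mem ε hy)
    have hb : VanishesOnBoundary (cobd (sub_add_cancel n 1) _ (extendFace g)) := by
      refine vanishesOnBoundary_succ (Fin.cases ?_ fun j => ?_)
      · rw [operator_cobd, face_zero_extendFace, cobd_eq_zero_iff]
        exact hg
      · rw [operator_cobd, face_succ_extendFace hv, map_zero]
    refine ⟨_, cobd_mem _ _, hb, ?_⟩
    have h1 := hS.step (sub_add_cancel n 1) h h' (face_succ_extendFace hv)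
    have h2 := hc.twist ε
    rw [face_zero_extendFace] at h1
    rw [twist_sub, twist_twist hS.mul_self] at h2
    simpa using h1.add h2

/-! ### Comparison of slant products with the suspension -/

/-- The isomorphism `(K ∧ L) ∧ M → (K ∧ M) ∧ L`. -/
def smashSwapRight (K L M : PSSet.{u}) : smash (smash K L) M ⟶ smash (smash K M) L :=
  smashAssocInv K L M ≫ smashMap (𝟙 K) (smashSwap L M) ≫ smashAssoc K M L

lemma smashSwapRight_smashSwapRight (K L M : PSSet.{u}) :
    smashSwapRight K L M ≫ smashSwapRight K M L = 𝟙 _ :=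
  SimplicialObject.hom_ext _ _ fun _ => Pointed.Hom.ext (funext
    (smash_ind (smash_ind fun _ _ _ => rfl)))

lemma smashSwapRight_natural {K L L' M : PSSet.{u}} (φ : L ⟶ L') :
    smashMap (smashMap (𝟙 K) φ) (𝟙 M) ≫ smashSwapRight K L' M =
      smashSwapRight K L M ≫ smashMap (𝟙 (smash K M)) φ :=
  SimplicialObject.hom_ext _ _ fun _ => Pointed.Hom.ext (funext
    (smash_ind (smash_ind fun _ _ _ => rfl)))

/-- The map `C^n((K ∧ S^1) ∧ Δ^k_+) → C^{n-1}(K ∧ Δ^k_+)` given by the slant product with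
`[S^1]`. -/
noncomputable def desuspend {m n : ℤ} (h : m + (1 : ℕ) = n) (K : PSSet.{u}) (k : ℕ) :
    Cochain V n (smash (smash K circle) (simplexPlus.obj ⦋k⦌)) →ₗ[ℝ]
      Cochain V m (smash K (simplexPlus.obj ⦋k⦌)) :=
  slant circleChain h ∘ₗ pull (smashSwapRight K (simplexPlus.obj ⦋k⦌) circle)

lemma desuspend_cobd {l m n : ℤ} (h : m + (1 : ℕ) = n) (hl : l + 1 = m)
    (h' : l + (1 : ℕ) = m) (h'' : m + 1 = n) {K : PSSet.{u}} {k : ℕ}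
    (g : Cochain V m (smash (smash K circle) (simplexPlus.obj ⦋k⦌))) :
    desuspend h K k (cobd h'' _ g) = cobd hl _ (desuspend h' K k g) := by
  rw [desuspend, LinearMap.comp_apply, pull_cobd, slant_circle_cobd h hl h']
  rfl

lemma pull_slantCircle {K L : PSSet.{u}} (φ : K ⟶ L) {m n : ℤ} (h : m + (1 : ℕ) = n)
    (u : Cochain V n (smash L circle)) :
    pull φ (slant circleChain h u) = slant circleChain h (pull (smashMap φ (𝟙 circle)) u) := by
  rw [← pull_slant]
  exact congrArg (fun e => pull φ (slant e h u))
    (chainMap_gen (𝟙 circle.{u}) 1 (circleMk (𝟙 ⦋1⦌))).symm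

lemma operator_desuspend {m n : ℤ} (h : m + (1 : ℕ) = n) {K : PSSet.{u}} {l k : ℕ}
    (θ : ⦋l⦌ ⟶ ⦋k⦌) (g : Cochain V n (smash (smash K circle) (simplexPlus.obj ⦋k⦌))) :
    operator θ (desuspend h K k g) = desuspend h K l (operator θ g) := by
  unfold operator desuspend
  rw [LinearMap.comp_apply, LinearMap.comp_apply, pull_slantCircle, pull_pull, pull_pull,
    smashSwapRight_natural]

lemma slantCircle_twist (ε : ℤ) {m n : ℤ} (h : m + (1 : ℕ) = n) {K : PSSet.{u}}
    (u : Cochain V n (smash K circle)) :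
    slant circleChain h (twist ε u) = ε • twist ε (slant circleChain h u) := by
  funext p
  refine LinearMap.ext fun c => ?_
  change ε ^ (p.1.1 + 1) • u (p.right 1 h) (EZ K circle p.1.1 1 c circleChain) =
    ε • ε ^ p.1.1 • u (p.right 1 h) (EZ K circle p.1.1 1 c circleChain)
  rw [pow_succ', mul_smul]

lemma IsCobd.slantCircle {m n : ℤ} (h : m + (1 : ℕ) = n) {K : PSSet.{u}}
    {u : Cochain V n (smash K circle)} (hu : IsCobd u) : IsCobd (slant circleChain h u) := by
  obtain ⟨l, hl, g, rfl⟩ := hu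
  obtain rfl : l = m := by push_cast at h; omega
  rw [slant_circle_cobd h (sub_add_cancel l 1) (by push_cast; omega)]
  exact isCobd_cobd _ _

/-- The slant products with `[S^1]` and with `[Δ^k_+]` commute up to the sign `ε^k` and up to
coboundaries. -/
lemma IsSimplexSlant.isCobd_desuspend (hS : IsSimplexSlant ε S) (k : ℕ) {l m n' n : ℤ}
    (h : m + (k : ℕ) = n) (h₁ : n' + (1 : ℕ) = n) (h₂ : l + (k : ℕ) = n') (h₃ : l + (1 : ℕ) = m)
    {K : PSSet.{u}} {f : Cochain V n (smash (smash K circle) (simplexPlus.obj ⦋k⦌))}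
    (hf : f ∈ cocycles V n _) (hb : VanishesOnBoundary f) :
    IsCobd (S k h₂ K (desuspend h₁ K k f) -
      ε ^ k • slant circleChain h₃ (S k h (smash K circle) f)) := by
  induction k generalizing n n' with
  | zero =>
    obtain rfl : m = n := by simpa using h
    obtain rfl : l = n' := by simpa using h₂
    rw [hS.zero, hS.zero, pow_zero, one_smul, desuspend, LinearMap.comp_apply,
      pull_slantCircle, pull_pull]
    refine (congrArg IsCobd (sub_eq_zero_of_eq ?_)).mpr .zero
    exact congrArg (fun φ => slant circleChain h₁ (pull φ f))
      (SimplicialObject.hom_ext _ _ fun _ => smash_hom_ext fun _ _ => rfl)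
  | succ k ih =>
    obtain ⟨G, rfl, hG, hc, hv⟩ := exists_primitive_face (sub_add_cancel n 1) hf hb
    have h4 : n' = n - 1 := by push_cast at h₁; omega
    subst h4
    have h5 : l + (k : ℕ) = n - 1 - 1 := by push_cast at h₂; omega
    have h6 : m + (k : ℕ) = n - 1 := by push_cast at h; omega
    have h7 : n - 1 - 1 + (1 : ℕ) = n - 1 := by push_cast; omega
    have e1 := ih h6 h7 h5 hc hv
    have e2 := hS.step (sub_add_cancel n 1) h h6 hG
    have e3 := hS.step (sub_add_cancel (n - 1) 1) h₂ h5 (G := desuspend h7 K (k + 1) G)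
      fun j => by rw [operator_desuspend, hG, map_zero]
    rw [operator_desuspend] at e3
    rw [desuspend_cobd h₁ (sub_add_cancel _ _) h7]
    have e4 := ((e2.slantCircle h₃).zsmul (ε ^ (k + 1))).neg
    rw [map_sub, slantCircle_twist] at e4
    have e5 := (e3.add (e1.twist ε)).add e4
    rw [twist_sub, twist_zsmul, smul_sub, smul_smul, pow_succ, mul_assoc, hS.mul_self,
      mul_one] at e5
    convert e5 using 1
    rw [pow_succ]
    abel

end

/-! ### The suspension isomorphism -/

/-- The canonical chain of the interval. -/
noncomputable def intervalChain : Chains interval.{u} 1 :=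
  gen (P := interval.{u}.obj (op ⦋1⦌)) (SSet.stdSimplex.objEquiv.symm (𝟙 ⦋1⦌))

lemma chainMap_intervalChain : chainMap intervalToCircle.{u} 1 intervalChain = circleChain :=
  chainMap_gen _ _ _

lemma bd_zero_gen (K : PSSet.{u}) (x : (K.obj (op ⦋1⦌)).X) :
    bd K 0 (gen x) = gen ((K.δ 0).toFun x) - gen ((K.δ 1).toFun x) := by
  rw [bd_gen, Fin.sum_univ_two, sub_eq_add_neg]
  exact congrArg₂ (· + ·) (one_smul _ _) (neg_one_smul _ _)

lemma bd_intervalChain :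
    bd interval.{u} 0 intervalChain = gen (P := interval.{u}.obj (op ⦋0⦌)) (constOne _ 1) := by
  have h1 : (interval.{u}.δ (1 : Fin 2)).toFun (SSet.stdSimplex.objEquiv.symm (𝟙 ⦋1⦌)) =
      (interval.{u}.obj (op ⦋0⦌)).point :=
    SSet.stdSimplex.objEquiv.injective (SimplexCategory.Hom.ext _ _ (OrderHom.ext _ _
      (funext fun j => by rw [Subsingleton.elim (α := Fin 1) j 0]; rfl)))
  have h0 : (interval.{u}.δ (0 : Fin 2)).toFun (SSet.stdSimplex.objEquiv.symm (𝟙 ⦋1⦌)) =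
      constOne (op ⦋0⦌) 1 :=
    SSet.stdSimplex.objEquiv.injective (SimplexCategory.Hom.ext _ _ (OrderHom.ext _ _
      (funext fun j => by rw [Subsingleton.elim (α := Fin 1) j 0]; rfl)))
  refine (bd_zero_gen interval.{u} _).trans ?_
  refine (congrArg₂ (fun a b => gen (P := interval.{u}.obj (op ⦋0⦌)) a - gen b) h0 h1).trans ?_
  rw [gen_point, sub_zero]

lemma constOne_zero_ne_one (n : SimplexCategoryᵒᵖ) : constOne.{u} n 0 ≠ constOne n 1 := fun h =>
  zero_ne_one (α := Fin 2)
    (congrArg (fun a => (SSet.stdSimplex.objEquiv a).toOrderHom (0 : Fin (n.unop.len + 1))) h)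

lemma eq_constOne_of_mem_boundary {n : SimplexCategoryᵒᵖ} {a : (Δ[1] : SSet.{u}).obj n}
    (h : a ∈ (SSet.boundary.{u} 1).obj n) : ∃ e, a = constOne n e := by
  obtain ⟨j, hj⟩ := not_forall.1 h
  refine ⟨1 - j, SSet.stdSimplex.objEquiv.injective (SimplexCategory.Hom.ext _ _
    (OrderHom.ext _ _ (funext fun i => ?_)))⟩
  have key : ∀ j l : Fin 2, l ≠ j → l = 1 - j := by decide
  exact key j _ fun hi => hj ⟨i, hi⟩

section

variable {V : ℤ → Type u} [∀ j, AddCommGroup (V j)] [∀ j, Module ℝ (V j)]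

/-- If `δg` on the cone is the pullback of `u`, then the slant product of `u` with `[S^1]` is the
restriction of `g` to the base, up to signs and a coboundary: `[S^1]` is the image of `[Δ^1]`, and
the boundary of `[Δ^1]` is the vertex `1`. -/
lemma slantCircle_of_cone {K : PSSet.{u}} {l m n : ℤ} (hl : l + 1 = m) (hm : m + 1 = n)
    (h : m + (1 : ℕ) = n) (h' : l + (1 : ℕ) = m) {u : Cochain V n (smash K circle)}
    {g : Cochain V m (smash K interval)}
    (hg : cobd hm _ g = pull (smashMap (𝟙 K) intervalToCircle) u) :
    slant circleChain h u = cobd hl _ (slant intervalChain h' g) +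
      signTwist (pull (coneBase K) g) := by
  rw [← chainMap_intervalChain, slant_chainMap, ← hg,
    slant_cobd intervalChain hl hm h h' (by simp), bd_intervalChain]
  exact congrArg (fun w => _ + twist (-1) w)
    (slant_gen_zero (L := interval.{u}) (constOne _ 1) (by simp) g)

open Classical in
/-- The extension by zero of a cochain on the base of the cone. -/
noncomputable def extendBase {n : ℤ} {K : PSSet.{u}} (b : Cochain V n K) :
    Cochain V n (smash K interval) := fun p =>
  redLift (P := (smash K interval).obj (op ⦋p.1.1⦌))
    (smashLift (P := K.obj (op ⦋p.1.1⦌)) (Q := interval.obj (op ⦋p.1.1⦌))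
      (fun x a => if a = constOne (op ⦋p.1.1⦌) 1 then b p (gen x) else 0) 0
      (fun a => by
        split_ifs
        · rw [gen_point, map_zero]
        · rfl)
      (fun _ => if_neg (constOne_zero_ne_one _)))
    (if_neg (constOne_zero_ne_one _))

lemma pull_coneBase_extendBase {n : ℤ} {K : PSSet.{u}} (b : Cochain V n K) :
    pull (coneBase K) (extendBase b) = b := by
  refine cochain_ext fun p x => ?_
  rw [pull_gen]
  exact (redLift_gen _ _ _).trans (if_pos rfl)

/-- A cochain on the cone that vanishes on the base descends to `K ∧ S^1`. -/
lemma exists_descent {n : ℤ} {K : PSSet.{u}} {g : Cochain V n (smash K interval)}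
    (hg : pull (coneBase K) g = 0) :
    ∃ u : Cochain V n (smash K circle), pull (smashMap (𝟙 K) intervalToCircle) u = g := by
  have hz : ∀ (p : Bideg n) (x : (K.obj (op ⦋p.1.1⦌)).X) (a : (Δ[1] : SSet.{u}).obj _),
      a ∈ (SSet.boundary.{u} 1).obj (op ⦋p.1.1⦌) →
        g p (gen (smk (Q := interval.obj (op ⦋p.1.1⦌)) x a)) = 0 := by
    intro p x a ha
    obtain ⟨e, rfl⟩ := eq_constOne_of_mem_boundary ha
    match e with
    | 0 => exact (congrArg (g p) (gen_smk_right x)).trans (map_zero _)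
    | 1 => exact (pull_gen (coneBase K) g p x).symm.trans (congrArg (fun w => w p (gen x)) hg)
  refine ⟨fun p => redLift (P := (smash K circle).obj (op ⦋p.1.1⦌))
    (smashLift (P := K.obj (op ⦋p.1.1⦌)) (Q := circle.obj (op ⦋p.1.1⦌))
      (fun x => Quot.lift (fun a => g p (gen (smk (Q := interval.obj (op ⦋p.1.1⦌)) x a)))
        fun a a' h => (hz p x a h.1).trans (hz p x a' h.2).symm) 0 ?_ ?_) ?_, ?_⟩
  · rintro ⟨a⟩
    exact (congrArg (g p) (gen_smk_left _)).trans (map_zero _)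
  · intro x
    exact (congrArg (g p) (gen_smk_right x)).trans (map_zero _)
  · exact (congrArg (g p) (gen_smk_right _)).trans (map_zero _)
  · refine cochain_ext fun p => smash_ind fun x a => ?_
    rw [pull_gen]
    exact redLift_gen _ _ _

lemma pull_intervalToCircle_injective {n : ℤ} {K : PSSet.{u}}
    {u v : Cochain V n (smash K circle)}
    (h : pull (smashMap (𝟙 K) intervalToCircle) u = pull (smashMap (𝟙 K) intervalToCircle) v) :
    u = v := by
  refine cochain_ext fun p => smash_ind fun x => ?_
  rintro ⟨a⟩
  have := congrArg (fun w => w p (gen (smk (Q := interval.obj (op ⦋p.1.1⦌)) x a))) h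
  dsimp only at this
  rw [pull_gen, pull_gen] at this
  exact this

lemma suspension_coh {K : PSSet.{u}} {n : ℤ} (u : Cochain V n (smash K circle))
    (hu : u ∈ cocycles V n (smash K circle)) :
    suspension V K n (coh u hu) =
      coh (slant circleChain (by push_cast; omega) u) (slant_circle_mem _ u hu) := rfl

/-- The slant product with `[S^1]` is the connecting map of the cone, up to signs. -/
lemma suspension_eq_iff {K : PSSet.{u}} {n : ℤ} (x : Coh V n (smash K circle))
    (y : Coh V (n - 1) K) : suspension V K n x = y ↔ IsSuspensionOf x y := by
  constructor
  · rintro rfl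
    obtain ⟨u, hu, rfl⟩ := coh_surjective x
    obtain ⟨g, hg⟩ := exists_cone_primitive (sub_add_cancel n 1)
      (pull_mem (smashMap (𝟙 K) intervalToCircle) u hu)
    have h := slantCircle_of_cone (sub_add_cancel (n - 1) 1) (sub_add_cancel n 1)
      (by push_cast; omega) (by push_cast; omega) hg
    have hw : signTwist (pull (coneBase K) g) ∈ cocycles V (n - 1) K := by
      rw [eq_sub_of_add_eq' h.symm]
      exact sub_mem (slant_circle_mem _ u hu) (cobd_mem _ _)
    refine ⟨u, hu, g, hw, hg, rfl, ?_⟩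
    rw [suspension_coh, coh_eq_iff, h, sub_add_cancel_right]
    exact (isCobd_cobd _ _).neg
  · rintro ⟨u, hu, g, hw, hg, rfl, rfl⟩
    rw [suspension_coh, coh_eq_iff, slantCircle_of_cone (sub_add_cancel (n - 1) 1)
      (sub_add_cancel n 1) (by push_cast; omega) (by push_cast; omega) hg, add_sub_cancel_right]
    exact isCobd_cobd _ _

/-- The slant product with `[S^1]` is injective on cohomology. -/
lemma isCobd_of_isCobd_slantCircle {K : PSSet.{u}} {m n : ℤ} (h : m + (1 : ℕ) = n)
    {u : Cochain V n (smash K circle)} (hu : u ∈ cocycles V n (smash K circle))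
    (hs : IsCobd (slant circleChain h u)) : IsCobd u := by
  have hm : m + 1 = n := by push_cast at h; omega
  obtain ⟨g, hg⟩ := exists_cone_primitive hm (pull_mem (smashMap (𝟙 K) intervalToCircle) u hu)
  rw [slantCircle_of_cone (sub_add_cancel m 1) hm h (by push_cast; omega) hg] at hs
  have hb := hs.sub (isCobd_cobd (sub_add_cancel m 1) (slant intervalChain (by simp) g))
  rw [add_sub_cancel_left] at hb
  have hb' := hb.twist (-1)
  change IsCobd (twist (-1) (twist (-1) (pull (coneBase K) g))) at hb'
  rw [twist_twist rfl, isCobd_iff (sub_add_cancel m 1)] at hb'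
  obtain ⟨b, hb⟩ := hb'
  obtain ⟨v, hv⟩ := exists_descent (g := g - cobd (sub_add_cancel m 1) _ (extendBase b)) (by
    rw [map_sub, pull_cobd, pull_coneBase_extendBase, hb, sub_self])
  refine ⟨m, hm, v, pull_intervalToCircle_injective ?_⟩
  rw [pull_cobd, hv, map_sub, hg, (cobd_eq_zero_iff _ _).2 (cobd_mem _ _), sub_zero]

/-- The slant product with `[S^1]` is surjective on cohomology. -/
lemma exists_slantCircle {K : PSSet.{u}} {m n : ℤ} (h : m + (1 : ℕ) = n)
    {y : Cochain V m K} (hy : y ∈ cocycles V m K) :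
    ∃ u ∈ cocycles V n (smash K circle), IsCobd (slant circleChain h u - y) := by
  have hm : m + 1 = n := by push_cast at h; omega
  obtain ⟨u, hu⟩ := exists_descent (g := cobd hm _ (extendBase (twist (-1) y))) (by
    rw [pull_cobd, pull_coneBase_extendBase, cobd_eq_zero_iff]
    exact twist_mem _ hy)
  refine ⟨u, ?_, ?_⟩
  · rw [← cobd_eq_zero_iff (rfl : n + 1 = n + 1)]
    refine pull_intervalToCircle_injective ?_
    rw [pull_cobd, hu, (cobd_eq_zero_iff _ _).2 (cobd_mem _ _), map_zero]
  · rw [slantCircle_of_cone (sub_add_cancel m 1) hm h (by push_cast; omega) hu.symm,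
      pull_coneBase_extendBase]
    change IsCobd (_ + twist (-1) (twist (-1) y) - y)
    rw [twist_twist rfl, add_sub_cancel_right]
    exact isCobd_cobd _ _

lemma suspension_bijective (K : PSSet.{u}) (n : ℤ) :
    Function.Bijective (suspension V K n) := by
  constructor
  · intro x x' h
    obtain ⟨u, hu, rfl⟩ := coh_surjective x
    obtain ⟨u', hu', rfl⟩ := coh_surjective x'
    rw [suspension_coh, suspension_coh, coh_eq_iff, ← map_sub] at h
    exact (coh_eq_iff _ _).2 (isCobd_of_isCobd_slantCircle _ (sub_mem hu hu') h)
  · intro y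
    obtain ⟨y, hy, rfl⟩ := coh_surjective y
    obtain ⟨u, hu, h⟩ := exists_slantCircle (by push_cast; omega : n - 1 + (1 : ℕ) = n) hy
    exact ⟨coh u hu, (coh_eq_iff _ _).2 h⟩

end

/-! ### Simplicial vector spaces are Kan complexes -/

/-- The simplicial operator `X_b → X_a` of a simplicial vector space given by `θ : a → b`. -/
def act (X : SimplicialObject (ModuleCat.{u} ℝ)) {a b : SimplexCategory} (θ : a ⟶ b) :
    X.obj (op b) →ₗ[ℝ] X.obj (op a) := (X.map θ.op).hom

lemma act_act (X : SimplicialObject (ModuleCat.{u} ℝ)) {a b c : SimplexCategory} (η : a ⟶ b)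
    (θ : b ⟶ c) (y : X.obj (op c)) : act X η (act X θ y) = act X (η ≫ θ) y := by
  unfold act
  rw [op_comp, X.map_comp]
  rfl

lemma act_id (X : SimplicialObject (ModuleCat.{u} ℝ)) {a : SimplexCategory} (y : X.obj (op a)) :
    act X (𝟙 a) y = y := by
  unfold act
  rw [op_id, X.map_id]
  rfl

lemma app_act {X Y : SimplicialObject (ModuleCat.{u} ℝ)} (φ : X ⟶ Y) {a b : SimplexCategory}
    (θ : a ⟶ b) (y : X.obj (op b)) :
    (φ.app (op a)).hom (act X θ y) = act Y θ ((φ.app (op b)).hom y) :=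
  LinearMap.congr_fun (congrArg ModuleCat.Hom.hom (φ.naturality θ.op)) y

/-- The simplicial set underlying a simplicial vector space. -/
abbrev under (X : SimplicialObject (ModuleCat.{u} ℝ)) : SSet.{u} := toSSet (toPSSet.obj X)

/-- A map out of a simplex sends `θ` to the face or degeneracy along `θ` of its top simplex. -/
lemma app_objEquiv_symm {X : SimplicialObject (ModuleCat.{u} ℝ)} {a b : SimplexCategory}
    (F : SSet.stdSimplex.obj b ⟶ under X) (θ : a ⟶ b) :
    F.app (op a) (SSet.stdSimplex.objEquiv.symm θ) = act X θ (SSet.yonedaEquiv F) := by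
  obtain ⟨y, rfl⟩ := SSet.yonedaEquiv.symm.surjective F
  rw [Equiv.apply_symm_apply]
  rfl

/-- Moore's construction: a simplex of a simplicial vector space can be corrected by a degenerate
one so as to have a prescribed face `r` without changing the faces in `J`. -/
lemma exists_correction (X : SimplicialObject (ModuleCat.{u} ℝ)) {n : ℕ} {i : Fin (n + 2)}
    (y : ∀ j : Fin (n + 2), j ≠ i → X.obj (op ⦋n⦌))
    (hy : ∀ (j k : Fin (n + 2)) (hj : j ≠ i) (hk : k ≠ i) {m : SimplexCategory} (θ θ' : m ⟶ ⦋n⦌),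
      θ ≫ SimplexCategory.δ j = θ' ≫ SimplexCategory.δ k → act X θ (y j hj) = act X θ' (y k hk))
    (J : Fin (n + 2) → Prop) {w : X.obj (op ⦋n + 1⦌)}
    (hw : ∀ j hj, J j → act X (SimplexCategory.δ j) w = y j hj)
    {r : Fin (n + 2)} (hr : r ≠ i) (c : Fin (n + 1))
    (hrc : SimplexCategory.δ r ≫ SimplexCategory.σ c = 𝟙 ⦋n⦌)
    (hJ : ∀ j, J j → ∀ x, (SimplexCategory.σ c ≫ SimplexCategory.δ r).toOrderHom x = j → x = j) :
    ∃ w' : X.obj (op ⦋n + 1⦌), ∀ j hj, (J j ∨ j = r) → act X (SimplexCategory.δ j) w' = y j hj := by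
  refine ⟨w + act X (SimplexCategory.σ c) (y r hr - act X (SimplexCategory.δ r) w),
    fun j hj h => ?_⟩
  rw [map_add, act_act]
  rcases h with h | rfl
  · obtain ⟨θ', hθ'⟩ := SimplexCategory.eq_comp_δ_of_not_surjective'
      ((SimplexCategory.δ j ≫ SimplexCategory.σ c) ≫ SimplexCategory.δ r) j fun x hx =>
        Fin.succAbove_ne j x (hJ j h _ hx)
    rw [map_sub, act_act, hθ', ← act_act X θ', hw j hj h, hy r j hr hj _ _ hθ', sub_self, add_zero]
  · rw [hrc, act_id, add_sub_cancel]

/-- Simplices of a simplicial vector space that form a horn are the faces of a simplex. -/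
lemma exists_filler (X : SimplicialObject (ModuleCat.{u} ℝ)) {n : ℕ} {i : Fin (n + 2)}
    (y : ∀ j : Fin (n + 2), j ≠ i → X.obj (op ⦋n⦌))
    (hy : ∀ (j k : Fin (n + 2)) (hj : j ≠ i) (hk : k ≠ i) {m : SimplexCategory} (θ θ' : m ⟶ ⦋n⦌),
      θ ≫ SimplexCategory.δ j = θ' ≫ SimplexCategory.δ k →
        act X θ (y j hj) = act X θ' (y k hk)) :
    ∃ w : X.obj (op ⦋n + 1⦌), ∀ j hj, act X (SimplexCategory.δ j) w = y j hj := by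
  have val : ∀ (c : Fin (n + 1)) (r x : Fin (n + 2)),
      (((SimplexCategory.σ c ≫ SimplexCategory.δ r).toOrderHom x : Fin (n + 2)) : ℕ) =
        if (if (c : ℕ) < x then (x : ℕ) - 1 else x) < r then (if (c : ℕ) < x then (x : ℕ) - 1 else x)
          else (if (c : ℕ) < x then (x : ℕ) - 1 else x) + 1 := by
    intro c r x
    refine (δ_val r _).trans ?_
    rw [σ_val]
  -- the faces below `i`, in increasing order
  have low : ∀ s : ℕ, s ≤ i → ∃ w : X.obj (op ⦋n + 1⦌), ∀ (j : Fin (n + 2)) hj, (j : ℕ) < s →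
      act X (SimplexCategory.δ j) w = y j hj := by
    intro s
    induction s with
    | zero => exact fun _ => ⟨0, fun j _ h => absurd h (Nat.not_lt_zero _)⟩
    | succ s ih =>
      intro hs
      obtain ⟨w, hw⟩ := ih (by omega)
      have hi := i.2
      let c : Fin (n + 1) := ⟨s, by omega⟩
      obtain ⟨w', hw'⟩ := exists_correction X y hy (fun j => (j : ℕ) < s) hw (r := c.castSucc)
        (fun h => by have := congrArg Fin.val h; simp [c] at this; omega) c
        SimplexCategory.δ_comp_σ_self (fun j hj x hx => by
          have h := (val c c.castSucc x).symm.trans (congrArg Fin.val hx)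
          simp only [Fin.val_castSucc, c] at h
          refine Fin.ext ?_
          split_ifs at h <;> omega)
      refine ⟨w', fun j hj h => hw' j hj ?_⟩
      rcases Nat.lt_succ_iff_lt_or_eq.1 h with h | h
      · exact Or.inl h
      · exact Or.inr (Fin.ext h)
  -- then the faces above `i`, in decreasing order
  have high : ∀ s : ℕ, s + i ≤ n + 1 → ∃ w : X.obj (op ⦋n + 1⦌), ∀ (j : Fin (n + 2)) hj,
      ((j : ℕ) < i ∨ n + 1 < j + s) → act X (SimplexCategory.δ j) w = y j hj := by
    intro s
    induction s with
    | zero =>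
      intro _
      obtain ⟨w, hw⟩ := low i le_rfl
      exact ⟨w, fun j hj h => hw j hj (by have := j.2; omega)⟩
    | succ s ih =>
      intro hs
      obtain ⟨w, hw⟩ := ih (by omega)
      let c : Fin (n + 1) := ⟨n - s, by omega⟩
      obtain ⟨w', hw'⟩ := exists_correction X y hy
        (fun j => (j : ℕ) < i ∨ n + 1 < j + s) hw (r := c.succ)
        (fun h => by have := congrArg Fin.val h; simp [c] at this; omega) c
        SimplexCategory.δ_comp_σ_succ (fun j hj x hx => by
          have h := (val c c.succ x).symm.trans (congrArg Fin.val hx)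
          simp only [Fin.val_succ, c] at h
          refine Fin.ext ?_
          split_ifs at h <;> omega)
      refine ⟨w', fun j hj h => hw' j hj ?_⟩
      rcases h with h | h
      · exact Or.inl (Or.inl h)
      · by_cases h' : n + 1 < j + s
        · exact Or.inl (Or.inr h')
        · exact Or.inr (Fin.ext (by simp [c]; omega))
  obtain ⟨w, hw⟩ := high (n + 1 - i) (by have := i.2; omega)
  refine ⟨w, fun j hj => hw j hj ?_⟩
  have := i.2
  have : (j : ℕ) ≠ i := fun h => hj (Fin.ext h)
  omega

lemma kanComplex_under (X : SimplicialObject (ModuleCat.{u} ℝ)) :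
    SSet.KanComplex (under X) := by
  rw [SSet.KanComplex.iff]
  intro n i f hf
  obtain ⟨φ, hφ⟩ := hf.exists_desc
  have key : ∀ (j : Fin (n + 2)) (hj : j ≠ i) {m : SimplexCategory} (θ : m ⟶ ⦋n⦌),
      act X θ (SSet.yonedaEquiv (f j hj)) =
        φ.app (op m) ((SSet.horn.ι i j hj).app (op m) (SSet.stdSimplex.objEquiv.symm θ)) := by
    intro j hj m θ
    rw [← app_objEquiv_symm, ← hφ]
    rfl
  obtain ⟨w, hw⟩ := exists_filler X (fun j hj => SSet.yonedaEquiv (f j hj))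
    (fun j k hj hk m θ θ' h => by
      rw [key, key]
      refine congrArg (φ.app (op m)) (Subtype.ext ?_)
      exact congrArg SSet.stdSimplex.objEquiv.symm h)
  refine ⟨SSet.yonedaEquiv.symm w, fun j hj => SSet.yonedaEquiv.injective ?_⟩
  exact hw j hj

/-! ### Homotopy classes in simplicial vector spaces -/

/-- The degenerate simplex on a vertex. -/
abbrev constAt (X : SimplicialObject (ModuleCat.{u} ℝ)) (x : X.obj (op ⦋0⦌)) (m : SimplexCategory) :
    X.obj (op m) := act X (SimplexCategory.const m ⦋0⦌ 0) x

lemma act_constAt (X : SimplicialObject (ModuleCat.{u} ℝ)) (x : X.obj (op ⦋0⦌))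
    {a b : SimplexCategory} (θ : a ⟶ b) : act X θ (constAt X x b) = constAt X x a :=
  act_act X _ _ _

/-- The simplices of a simplicial vector space with zero boundary. -/
def IsCycle {X : SimplicialObject (ModuleCat.{u} ℝ)} {k : ℕ} (f : X.obj (op ⦋k⦌)) : Prop :=
  ∀ {m : ℕ} (θ : ⦋m⦌ ⟶ ⦋k⦌), ¬ Function.Surjective θ.toOrderHom → act X θ f = 0

/-- The simplex underlying a simplex with constant boundary. -/
abbrev ptVal {X : SimplicialObject (ModuleCat.{u} ℝ)} {k : ℕ} {x : X.obj (op ⦋0⦌)}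
    (f : (under X).PtSimplex k x) : X.obj (op ⦋k⦌) := SSet.yonedaEquiv f.map

lemma act_ptVal {X : SimplicialObject (ModuleCat.{u} ℝ)} {k : ℕ} {x : X.obj (op ⦋0⦌)}
    (f : (under X).PtSimplex k x) {m : ℕ} (θ : ⦋m⦌ ⟶ ⦋k⦌)
    (hθ : ¬ Function.Surjective θ.toOrderHom) : act X θ (ptVal f) = constAt X x ⦋m⦌ := by
  rw [← app_objEquiv_symm]
  exact SSet.RelativeMorphism.map_eq_of_mem f (SSet.stdSimplex.objEquiv.symm θ) hθ

/-- A simplex whose boundary is constant. -/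
def ptMk {X : SimplicialObject (ModuleCat.{u} ℝ)} {k : ℕ} {x : X.obj (op ⦋0⦌)}
    (y : X.obj (op ⦋k⦌)) (hy : ∀ {m : ℕ} (θ : ⦋m⦌ ⟶ ⦋k⦌), ¬ Function.Surjective θ.toOrderHom →
      act X θ y = constAt X x ⦋m⦌) : (under X).PtSimplex k x where
  map := SSet.yonedaEquiv.symm y
  comm := by
    ext m ⟨a, ha⟩
    exact hy (SSet.stdSimplex.objEquiv a) ha

lemma ptVal_ptMk {X : SimplicialObject (ModuleCat.{u} ℝ)} {k : ℕ} {x : X.obj (op ⦋0⦌)}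
    (y : X.obj (op ⦋k⦌)) (hy) : ptVal (ptMk (x := x) y hy) = y :=
  Equiv.apply_symm_apply _ _

lemma isCycle_sub {X : SimplicialObject (ModuleCat.{u} ℝ)} {k : ℕ} {x : X.obj (op ⦋0⦌)}
    (f g : (under X).PtSimplex k x) : IsCycle (ptVal f - ptVal g) := fun θ hθ => by
  rw [map_sub, act_ptVal f θ hθ, act_ptVal g θ hθ, sub_self]

section

open MonoidalCategory

variable {X : SimplicialObject (ModuleCat.{u} ℝ)} {k : ℕ}

/-- The value of a map `Δ^k × Δ^1 → X`. -/
def pairVal (F : Δ[k] ⊗ Δ[1] ⟶ under X) {m : SimplexCategory} (a : m ⟶ ⦋k⦌) (b : m ⟶ ⦋1⦌) :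
    X.obj (op m) :=
  F.app (op m) (SSet.stdSimplex.objEquiv.symm a, SSet.stdSimplex.objEquiv.symm b)

lemma act_pairVal (F : Δ[k] ⊗ Δ[1] ⟶ under X) {m m' : SimplexCategory} (η : m' ⟶ m)
    (a : m ⟶ ⦋k⦌) (b : m ⟶ ⦋1⦌) :
    act X η (pairVal F a b) = pairVal F (η ≫ a) (η ≫ b) := by
  let ab : (Δ[k] ⊗ Δ[1] : SSet.{u}).obj (op m) :=
    (SSet.stdSimplex.objEquiv.symm a, SSet.stdSimplex.objEquiv.symm b)
  exact (ConcreteCategory.congr_hom (F.naturality η.op) ab).symm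

/-- Evaluation of a map `F : Δ^k × Δ^1 → X`, reduced by the vertex `x`, on chains of
`Δ^k_+ ∧ Δ^1_+`. -/
noncomputable def evalChain (F : Δ[k] ⊗ Δ[1] ⟶ under X) (x : X.obj (op ⦋0⦌)) (m : ℕ) :
    Chains (smash (simplexPlus.{u}.obj ⦋k⦌) (simplexPlus.obj ⦋1⦌)) m →ₗ[ℤ] X.obj (op ⦋m⦌) :=
  redLift (smashLift
    (fun o o' => Option.elim o 0 fun a => Option.elim o' 0 fun b =>
      pairVal F (SSet.stdSimplex.objEquiv a) (SSet.stdSimplex.objEquiv b) - constAt X x ⦋m⦌) 0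
    (fun _ => rfl) (fun o => by cases o <;> rfl)) rfl

lemma evalChain_gen (F : Δ[k] ⊗ Δ[1] ⟶ under X) (x : X.obj (op ⦋0⦌)) (m : ℕ)
    (a : Δ[k].obj (op ⦋m⦌)) (b : Δ[1].obj (op ⦋m⦌)) :
    evalChain F x m (gen (smk (P := (simplexPlus.{u}.obj ⦋k⦌).obj (op ⦋m⦌))
      (Q := (simplexPlus.{u}.obj ⦋1⦌).obj (op ⦋m⦌)) (some a) (some b))) =
      pairVal F (SSet.stdSimplex.objEquiv a) (SSet.stdSimplex.objEquiv b) - constAt X x ⦋m⦌ :=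
  redLift_gen _ _ _

lemma evalChain_bd (F : Δ[k] ⊗ Δ[1] ⟶ under X) (x : X.obj (op ⦋0⦌)) (m : ℕ)
    (z : Chains (smash (simplexPlus.{u}.obj ⦋k⦌) (simplexPlus.obj ⦋1⦌)) (m + 1)) :
    evalChain F x m (bd _ m z) =
      ∑ a : Fin (m + 2), (-1 : ℤ) ^ (a : ℕ) •
        act X (SimplexCategory.δ a) (evalChain F x (m + 1) z) := by
  suffices h : evalChain F x m ∘ₗ bd _ m = ∑ a : Fin (m + 2), (-1 : ℤ) ^ (a : ℕ) •
      ((act X (SimplexCategory.δ a)).restrictScalars ℤ ∘ₗ evalChain F x (m + 1)) by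
    refine (LinearMap.congr_fun h z).trans ?_
    rw [LinearMap.sum_apply]
    rfl
  refine redFree_ext (smash_ind fun o o' => ?_)
  rw [LinearMap.comp_apply, bd_gen, map_sum, LinearMap.sum_apply]
  refine Finset.sum_congr rfl fun a _ => ?_
  rw [map_zsmul, LinearMap.smul_apply]
  refine congrArg _ ?_
  cases o with
  | none =>
    exact ((congrArg _ (gen_smk_left _)).trans (map_zero _)).trans
      (((congrArg _ (gen_smk_left _)).trans (map_zero _))).symm
  | some b =>
    cases o' with
    | none =>
      exact ((congrArg _ (gen_smk_right _)).trans (map_zero _)).trans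
        (((congrArg _ (gen_smk_right _)).trans (map_zero _))).symm
    | some c =>
      refine (evalChain_gen F x m _ _).trans ?_
      rw [LinearMap.comp_apply]
      refine Eq.trans ?_ (congrArg (act X (SimplexCategory.δ a))
        (evalChain_gen F x (m + 1) b c)).symm
      rw [map_sub, act_constAt, act_pairVal]
      rfl

/-- The prism operator: a homotopy relative to the boundary between `f` and `g` gives a
`(k+1)`-simplex whose alternating sum of faces is `±(f - g)`. -/
lemma exists_of_homotopy {x : X.obj (op ⦋0⦌)} {f g : (under X).PtSimplex k x}
    (H : f.Homotopy g) : ∃ (ε : ℤ) (h : X.obj (op ⦋k + 1⦌)), ptVal f - ptVal g =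
      ε • ∑ a : Fin (k + 2), (-1 : ℤ) ^ (a : ℕ) • act X (SimplexCategory.δ a) h := by
  let F := H.h
  have hrel : ∀ {m : ℕ} (θ : ⦋m⦌ ⟶ ⦋k⦌) (b : ⦋m⦌ ⟶ ⦋1⦌),
      ¬ Function.Surjective θ.toOrderHom → pairVal F θ b = constAt X x ⦋m⦌ := by
    intro m θ b hθ
    let ab : ((SSet.boundary.{u} k : SSet.{u}) ⊗ Δ[1]).obj (op ⦋m⦌) :=
      (⟨SSet.stdSimplex.objEquiv.symm θ, hθ⟩, SSet.stdSimplex.objEquiv.symm b)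
    exact ConcreteCategory.congr_hom (congrArg (fun φ => NatTrans.app φ (op ⦋m⦌)) H.rel) ab
  have h0 : evalChain F x k (ezN _ _ k 0 k (simplexChain k)
      (gen ((simplexPlus.{u}.obj ⦋1⦌).δ 1 |>.toFun (topSimplex 1)))) =
        ptVal f - constAt X x ⦋k⦌ := by
    rw [simplexChain, ezN_zero_right]
    refine (evalChain_gen F x k _ _).trans ?_
    refine congrArg (fun w : X.obj (op ⦋k⦌) => w - constAt X x ⦋k⦌) ?_
    rw [ptVal, ← H.h₀]
    rfl
  have h1 : evalChain F x k (ezN _ _ k 0 k (simplexChain k)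
      (gen ((simplexPlus.{u}.obj ⦋1⦌).δ 0 |>.toFun (topSimplex 1)))) =
        ptVal g - constAt X x ⦋k⦌ := by
    rw [simplexChain, ezN_zero_right]
    refine (evalChain_gen F x k _ _).trans ?_
    refine congrArg (fun w : X.obj (op ⦋k⦌) => w - constAt X x ⦋k⦌) ?_
    rw [ptVal, ← H.h₁]
    rfl
  have hv : evalChain F x k (ezN _ _ k 0 k (simplexChain k) (bd _ 0 (simplexChain 1))) =
      -(ptVal f - ptVal g) := by
    rw [simplexChain.eq_def 1, bd_zero_gen, map_sub, map_sub, h0, h1]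
    abel
  have hb : ∃ ε : ℤ, ε * ε = 1 ∧ evalChain F x k (bd _ k (ezN _ _ k 1 (k + 1) (simplexChain k)
      (simplexChain 1))) = ε • (ptVal f - ptVal g) := by
    cases k with
    | zero =>
      refine ⟨-1, rfl, ?_⟩
      rw [bd_ezN_zero_left, hv, neg_one_smul]
    | succ k =>
      refine ⟨-(-1) ^ (k + 1), by rw [neg_mul_neg, ← mul_pow]; norm_num, ?_⟩
      rw [bd_ezN, map_add, map_zsmul, hv, smul_neg, neg_smul, bd_simplexChain, map_sum,
        LinearMap.sum_apply, map_sum, Finset.sum_eq_zero, zero_add]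
      intro a _
      rw [map_zsmul, LinearMap.smul_apply, map_zsmul]
      refine smul_eq_zero_of_right _ ?_
      have hz : evalChain F x (k + 1) ∘ₗ chainMap (smashMap
          (simplexPlus.map (SimplexCategory.δ a)) (𝟙 (simplexPlus.obj ⦋1⦌))) (k + 1) = 0 := by
        refine redFree_ext (smash_ind fun o o' => ?_)
        rw [LinearMap.comp_apply, chainMap_gen]
        cases o with
        | none => exact (congrArg _ (gen_smk_left _)).trans (map_zero _)
        | some b =>
          cases o' with
          | none => exact (congrArg _ (gen_smk_right _)).trans (map_zero _)
          | some c =>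
            refine (evalChain_gen F x (k + 1) _ _).trans ?_
            refine sub_eq_zero_of_eq (hrel (SSet.stdSimplex.objEquiv b ≫ SimplexCategory.δ a)
              (SSet.stdSimplex.objEquiv c) ?_)
            intro hs
            obtain ⟨i, hi⟩ := hs a
            exact Fin.succAbove_ne _ _ hi
      have h2 := ezN_natural (simplexPlus.map (SimplexCategory.δ a))
        (𝟙 (simplexPlus.{u}.obj ⦋1⦌)) k 1 (k + 1) (simplexChain k) (simplexChain 1)
      rw [show chainMap (𝟙 (simplexPlus.{u}.obj ⦋1⦌)) 1 (simplexChain 1) = simplexChain 1 from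
        chainMap_gen (𝟙 (simplexPlus.{u}.obj ⦋1⦌)) 1 (topSimplex 1)] at h2
      rw [h2]
      exact LinearMap.congr_fun hz _
  obtain ⟨ε, hε, hb⟩ := hb
  refine ⟨ε, evalChain F x (k + 1) (ezN _ _ k 1 (k + 1) (simplexChain k) (simplexChain 1)), ?_⟩
  rw [← evalChain_bd, hb, smul_smul, hε, one_smul]

/-- The value at `(θ, t)` of the homotopy `Δ^k × Δ^1 → X` from `g` to `g + d_0 h` obtained by
contracting `Δ^{k+1}` to its vertex `0`. -/
def coneVal (g : X.obj (op ⦋k⦌)) (h : X.obj (op ⦋k + 1⦌)) {m : SimplexCategory} (θ : m ⟶ ⦋k⦌)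
    (t : m ⟶ ⦋1⦌) : X.obj (op m) :=
  act X θ g + act X (contrHom (θ ≫ SimplexCategory.δ 0) t) h

lemma act_coneVal (g : X.obj (op ⦋k⦌)) (h : X.obj (op ⦋k + 1⦌)) {m m' : SimplexCategory}
    (η : m' ⟶ m) (θ : m ⟶ ⦋k⦌) (t : m ⟶ ⦋1⦌) :
    act X η (coneVal g h θ t) = coneVal g h (η ≫ θ) (η ≫ t) := by
  rw [coneVal, map_add, act_act, act_act, comp_contrHom]
  rfl

/-- Simplices with the same constant boundary are homotopic if their difference is the face
opposite to the vertex `0` of a simplex all of whose other faces are zero. -/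
lemma homotopyClass_eq {x : X.obj (op ⦋0⦌)} {f g : (under X).PtSimplex k x}
    {h : X.obj (op ⦋k + 1⦌)} (h₀ : act X (SimplexCategory.δ 0) h = ptVal f - ptVal g)
    (h₁ : ∀ j : Fin (k + 1), act X (SimplexCategory.δ j.succ) h = 0) :
    f.homotopyClass = g.homotopyClass := by
  have hm : ∀ {m : ℕ} (θ : ⦋m⦌ ⟶ ⦋k + 1⦌) (j : Fin (k + 1)),
      (∀ i, θ.toOrderHom i ≠ j.succ) → act X θ h = 0 := by
    intro m θ j hj
    obtain ⟨θ', rfl⟩ := SimplexCategory.eq_comp_δ_of_not_surjective' θ j.succ hj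
    rw [← act_act, h₁, map_zero]
  have hcone₀ : ∀ {m : SimplexCategory} (θ : m ⟶ ⦋k⦌),
      coneVal (ptVal g) h θ (SimplexCategory.const m ⦋1⦌ 0) = act X θ (ptVal g) := by
    intro m θ
    rw [coneVal, contrHom_const_zero, hm (m := m.len) (SimplexCategory.const m _ 0) 0 fun i hi =>
      zero_ne_one (α := Fin (k + 2)) hi, add_zero]
  have hcone₁ : ∀ {m : SimplexCategory} (θ : m ⟶ ⦋k⦌),
      coneVal (ptVal g) h θ (SimplexCategory.const m ⦋1⦌ 1) = act X θ (ptVal f) := by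
    intro m θ
    rw [coneVal, contrHom_const_one, ← act_act, h₀, map_sub, add_sub_cancel]
  refine (SSet.RelativeMorphism.Homotopy.eq (f := g) (g := f)
    { h :=
        { app := fun m => ↾fun ab : Δ[k].obj m × Δ[1].obj m =>
            coneVal (ptVal g) h (SSet.stdSimplex.objEquiv ab.1) (SSet.stdSimplex.objEquiv ab.2)
          naturality := fun m m' η => ?_ }
      h₀ := ?_
      h₁ := ?_
      rel := ?_ }).symm
  · ext ab
    exact (act_coneVal _ _ η.unop _ _).symm
  · ext m a
    refine Eq.trans ?_ (app_objEquiv_symm g.map (SSet.stdSimplex.objEquiv a)).symm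
    exact hcone₀ _
  · ext m a
    refine Eq.trans ?_ (app_objEquiv_symm f.map (SSet.stdSimplex.objEquiv a)).symm
    exact hcone₁ _
  · ext m ⟨⟨a, ha⟩, b⟩
    obtain ⟨j, hj⟩ := not_forall.1 ha
    refine Eq.trans ?_ (add_zero (constAt X x m.unop))
    refine congrArg₂ (fun v w : X.obj m => v + w)
      (act_ptVal g (SSet.stdSimplex.objEquiv a) ha) (hm _ j fun i hi => hj ⟨i, ?_⟩)
    rw [contrHom_apply] at hi
    split_ifs at hi
    · exact absurd hi.symm (Fin.succ_ne_zero j)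
    · exact Fin.succ_injective _ hi

end

/-! ### Homotopy groups detected by cohomology -/

section

variable {V : ℤ → Type u} [∀ j, AddCommGroup (V j)] [∀ j, Module ℝ (V j)]

/-- The map `S` from the `k`-simplices of `X` to cochains on `K` identifies homotopy classes of
simplices with cohomology classes: it sends cycles to cocycles and alternating sums of faces to
coboundaries; a cycle with image a coboundary is a face of a simplex whose other faces are zero; and
each cohomology class is the class of the image of a cycle. -/
structure Detects {X : SimplicialObject (ModuleCat.{u} ℝ)} {k : ℕ} {m : ℤ} {K : PSSet.{u}}
    (S : X.obj (op ⦋k⦌) →ₗ[ℝ] Cochain V m K) : Prop where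
  mem : ∀ f, IsCycle f → S f ∈ cocycles V m K
  isCobd_altFace : ∀ h : X.obj (op ⦋k + 1⦌),
    IsCobd (S (∑ a : Fin (k + 2), (-1 : ℤ) ^ (a : ℕ) • act X (SimplexCategory.δ a) h))
  exists_face : ∀ f, IsCycle f → IsCobd (S f) → ∃ h : X.obj (op ⦋k + 1⦌),
    act X (SimplexCategory.δ 0) h = f ∧ ∀ j : Fin (k + 1), act X (SimplexCategory.δ j.succ) h = 0
  exists_preimage : ∀ y ∈ cocycles V m K, ∃ f, IsCycle f ∧ IsCobd (S f - y)

variable {X : SimplicialObject (ModuleCat.{u} ℝ)} {k : ℕ} {m : ℤ} {K : PSSet.{u}}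

lemma Detects.homotopyClass_eq_iff {S : X.obj (op ⦋k⦌) →ₗ[ℝ] Cochain V m K} (hS : Detects S)
    {x : X.obj (op ⦋0⦌)} (f g : (under X).PtSimplex k x) :
    f.homotopyClass = g.homotopyClass ↔ IsCobd (S (ptVal f - ptVal g)) := by
  constructor
  · intro h
    replace h := Quot.eq.1 h
    induction h with
    | rel f g h =>
      obtain ⟨ε, h, hh⟩ := exists_of_homotopy h.some
      rw [hh, map_zsmul]
      exact (hS.isCobd_altFace h).zsmul ε
    | refl f => rw [sub_self, map_zero]; exact .zero
    | symm f g _ ih => rw [← neg_sub, map_neg]; exact ih.neg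
    | trans f g h _ _ ih ih' =>
      rw [← sub_add_sub_cancel (ptVal f) (ptVal g), map_add]; exact ih.add ih'
  · intro h
    obtain ⟨w, h₀, h₁⟩ := hS.exists_face _ (isCycle_sub f g) h
    exact homotopyClass_eq h₀ h₁

lemma isCycle_zero_dim (f : X.obj (op ⦋0⦌)) : IsCycle f :=
  fun _ hθ => absurd (fun _ => ⟨0, Subsingleton.elim (α := Fin 1) _ _⟩) hθ

lemma Detects.component_eq_iff {S : X.obj (op ⦋0⦌) →ₗ[ℝ] Cochain V m K} (hS : Detects S)
    (x y : X.obj (op ⦋0⦌)) :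
    (SSet.π₀.mk (X := under X) x = SSet.π₀.mk (X := under X) y) ↔ IsCobd (S (x - y)) := by
  refine (SSet.π₀.mk_eq_mk_iff _ _).trans ?_
  constructor
  · intro h
    induction h with
    | rel x y h =>
      obtain ⟨e⟩ := h
      have h := hS.isCobd_altFace e.edge
      have h0 : act X (SimplexCategory.δ 0) e.edge = y := e.tgt_eq
      have h1 : act X (SimplexCategory.δ 1) e.edge = x := e.src_eq
      rw [Fin.sum_univ_two, h0, h1] at h
      have h' := h.neg
      rw [← map_neg] at h'
      convert h' using 2
      simp
      abel
    | refl f => rw [sub_self, map_zero]; exact .zero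
    | symm f g _ ih => rw [← neg_sub, map_neg]; exact ih.neg
    | trans f g h _ _ ih ih' => rw [← sub_add_sub_cancel f g, map_add]; exact ih.add ih'
  · intro h
    obtain ⟨w, h₀, h₁⟩ := hS.exists_face _ (isCycle_zero_dim _) h
    refine .symm _ _ (.rel _ _ ⟨SSet.Edge.mk (X := under X)
      (w + act X (SimplexCategory.σ 0) y : X.obj (op ⦋1⦌)) ?_ ?_⟩)
    · change act X (SimplexCategory.δ 1) _ = y
      rw [map_add, act_act]
      have h2 : SimplexCategory.δ (1 : Fin 2) ≫ SimplexCategory.σ (0 : Fin 1) = 𝟙 ⦋0⦌ :=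
        SimplexCategory.δ_comp_σ_succ
      rw [h2, act_id]
      exact (congrArg (· + y) (h₁ 0)).trans (zero_add y)
    · change act X (SimplexCategory.δ 0) _ = x
      rw [map_add, act_act]
      have h2 : SimplexCategory.δ (0 : Fin 2) ≫ SimplexCategory.σ (0 : Fin 1) = 𝟙 ⦋0⦌ :=
        SimplexCategory.δ_comp_σ_self
      rw [h2, act_id, h₀, sub_add_cancel]

lemma act_yonedaEquiv {j : ℕ} (θ : ⦋j⦌ ⟶ ⦋k⦌) (F : Δ[k] ⟶ under X) :
    act X θ (SSet.yonedaEquiv F) = SSet.yonedaEquiv (SSet.stdSimplex.map θ ≫ F) :=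
  SSet.yonedaEquiv_naturality θ F

lemma isCycle_ptVal (f : (under X).PtSimplex k (0 : X.obj (op ⦋0⦌))) : IsCycle (ptVal f) :=
  fun θ hθ => (act_ptVal f θ hθ).trans (map_zero _)

/-- The alternating sum of the faces of a simplex that exhibits a product of homotopy classes. -/
lemma altFace_mulStruct {f g fg : (under X).PtSimplex k (0 : X.obj (op ⦋0⦌))} {i : Fin k}
    (h : SSet.PtSimplex.MulStruct f g fg i) :
    ∑ a : Fin (k + 2), (-1 : ℤ) ^ (a : ℕ) • act X (SimplexCategory.δ a) (SSet.yonedaEquiv h.map) =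
      (-1 : ℤ) ^ (i : ℕ) • (ptVal f + ptVal g - ptVal fg) := by
  have hc : @Eq (X.obj (op ⦋k⦌)) (SSet.yonedaEquiv
      (SSet.const (X := Δ[k]) (Y := under X) (0 : X.obj (op ⦋0⦌)))) 0 :=
    map_zero (act X (SimplexCategory.const ⦋k⦌ ⦋0⦌ 0))
  have hg : act X (SimplexCategory.δ i.castSucc.castSucc) (SSet.yonedaEquiv h.map) = ptVal g :=
    (act_yonedaEquiv _ _).trans (congrArg SSet.yonedaEquiv h.δ_castSucc_castSucc_map)
  have hfg : act X (SimplexCategory.δ i.castSucc.succ) (SSet.yonedaEquiv h.map) = ptVal fg :=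
    (act_yonedaEquiv _ _).trans (congrArg SSet.yonedaEquiv h.δ_succ_castSucc_map)
  have hf : act X (SimplexCategory.δ i.succ.succ) (SSet.yonedaEquiv h.map) = ptVal f :=
    (act_yonedaEquiv _ _).trans (congrArg SSet.yonedaEquiv h.δ_succ_succ_map)
  have h1 : i.castSucc.castSucc ≠ i.castSucc.succ := fun h => by
    have := congrArg Fin.val h; simp at this
  have h2 : i.castSucc.castSucc ≠ i.succ.succ := fun h => by
    have := congrArg Fin.val h; simp at this; omega
  have h3 : i.castSucc.succ ≠ i.succ.succ := fun h => by
    have := congrArg Fin.val h; simp at this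
  rw [← Finset.sum_subset (Finset.subset_univ {i.castSucc.castSucc, i.castSucc.succ, i.succ.succ}),
    Finset.sum_insert (by simp [h1, h2]), Finset.sum_insert (by simp [h3]), Finset.sum_singleton,
    hg, hfg, hf]
  · simp only [Fin.val_castSucc, Fin.val_succ, pow_succ]
    module
  · intro a _ ha
    simp only [Finset.mem_insert, Finset.mem_singleton, not_or, Fin.ext_iff, Fin.val_castSucc,
      Fin.val_succ] at ha
    refine smul_eq_zero_of_right _ (Eq.trans ?_ hc)
    by_cases h' : (a : ℕ) < i
    · exact (act_yonedaEquiv _ _).trans (congrArg SSet.yonedaEquiv (h.δ_map_of_lt a h'))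
    · refine (act_yonedaEquiv _ _).trans (congrArg SSet.yonedaEquiv (h.δ_map_of_gt a ?_))
      rw [Fin.lt_def]
      simp only [Fin.val_succ]
      omega

/-- A map that detects homotopy classes induces an isomorphism from `π_k` to cohomology. -/
lemma Detects.exists_iso {S : X.obj (op ⦋k⦌) →ₗ[ℝ] Cochain V m K} (hS : Detects S) :
    ∃ Φ : PiVect k X → Coh V m K, IsIsoInducedBy S Φ := by
  let Φ : PiVect k X → Coh V m K :=
    Quot.lift (fun f => coh (S (ptVal f)) (hS.mem _ (isCycle_ptVal f))) fun f g h => by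
      rw [coh_eq_iff, ← map_sub, ← hS.homotopyClass_eq_iff]
      exact Quot.sound h
  have hΦ : ∀ f : (under X).PtSimplex k (0 : X.obj (op ⦋0⦌)),
      Φ f.homotopyClass = coh (S (ptVal f)) (hS.mem _ (isCycle_ptVal f)) := fun f => rfl
  refine ⟨Φ, ⟨?_, ?_⟩, fun f => ⟨_, hΦ f⟩, ?_⟩
  · intro c c' h
    obtain ⟨f, rfl⟩ := c.eq_homotopyClass
    obtain ⟨g, rfl⟩ := c'.eq_homotopyClass
    rw [hΦ, hΦ, coh_eq_iff, ← map_sub] at h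
    exact (hS.homotopyClass_eq_iff f g).2 h
  · intro c
    obtain ⟨y, hy, rfl⟩ := coh_surjective c
    obtain ⟨f, hf, h⟩ := hS.exists_preimage y hy
    let p : (under X).PtSimplex k (0 : X.obj (op ⦋0⦌)) :=
      ptMk f fun θ hθ => (hf θ hθ).trans (map_zero _).symm
    refine ⟨p.homotopyClass, ?_⟩
    rw [hΦ, coh_eq_iff, ptVal_ptMk]
    exact h
  · rintro i f g fg ⟨h⟩
    rw [hΦ, hΦ, hΦ]
    refine (coh_eq_iff _ (add_mem (hS.mem _ (isCycle_ptVal f)) (hS.mem _ (isCycle_ptVal g)))).2 ?_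
    have h1 := (hS.isCobd_altFace (SSet.yonedaEquiv h.map)).zsmul ((-1) ^ ((i : ℕ) + 1))
    rw [altFace_mulStruct h, map_zsmul, smul_smul, pow_succ', mul_assoc, ← mul_pow] at h1
    norm_num at h1
    exact h1

variable {Y : SimplicialObject (ModuleCat.{u} ℝ)} {m' : ℤ} {K' : PSSet.{u}}

/-- A map of simplicial vector spaces that is compatible with an isomorphism on the cohomology
detecting `π_k` is bijective on `π_k` at every base vertex, since translation by a vertex reduces
all questions to cycles. -/
lemma bijective_piAtMap (φ : X ⟶ Y) {S : X.obj (op ⦋k⦌) →ₗ[ℝ] Cochain V m K}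
    {T : Y.obj (op ⦋k⦌) →ₗ[ℝ] Cochain V m' K'} (hS : Detects S) (hT : Detects T)
    (hi : ∀ f, IsCycle f → IsCobd (T ((φ.app (op ⦋k⦌)).hom f)) → IsCobd (S f))
    (hs : ∀ g : Y.obj (op ⦋k⦌), IsCycle g →
      ∃ f, IsCycle f ∧ IsCobd (T ((φ.app (op ⦋k⦌)).hom f - g)))
    (x : X.obj (op ⦋0⦌)) :
    Function.Bijective (piAtMap k (toSSetMap (toPSSet.map φ)) x
      ((toSSetMap (toPSSet.map φ)).app (op ⦋0⦌) x) rfl) := by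
  constructor
  · intro c c' h
    obtain ⟨f, rfl⟩ := c.eq_homotopyClass
    obtain ⟨g, rfl⟩ := c'.eq_homotopyClass
    refine (hS.homotopyClass_eq_iff f g).2 (hi _ (isCycle_sub f g) ?_)
    rw [map_sub]
    exact (hT.homotopyClass_eq_iff _ _).1 h
  · intro c
    obtain ⟨g, rfl⟩ := c.eq_homotopyClass
    let y : Y.obj (op ⦋0⦌) := (φ.app (op ⦋0⦌)).hom x
    have hg : IsCycle (ptVal (x := y) g - constAt Y y ⦋k⦌) := fun θ hθ => by
      rw [map_sub, act_ptVal g θ hθ, act_constAt]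
      exact sub_self (constAt Y y _)
    obtain ⟨f, hf, h⟩ := hs _ hg
    obtain ⟨p, hp⟩ : ∃ p : (under X).PtSimplex k x, ptVal p = f + constAt X x ⦋k⦌ :=
      ⟨ptMk (f + constAt X x ⦋k⦌) fun θ hθ => by
        rw [map_add, hf θ hθ, act_constAt, zero_add], ptVal_ptMk _ _⟩
    refine ⟨p.homotopyClass, (hT.homotopyClass_eq_iff _ _).2 ?_⟩
    have e : (φ.app (op ⦋k⦌)).hom (ptVal p) - ptVal (x := y) g =
        (φ.app (op ⦋k⦌)).hom f - (ptVal (x := y) g - constAt Y y ⦋k⦌) := by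
      rw [hp, map_add, app_act, sub_sub_eq_add_sub]
    rw [← e] at h
    exact h

/-- The analogue of `bijective_piAtMap` for path components. -/
lemma bijective_mapπ₀ (φ : X ⟶ Y) {S : X.obj (op ⦋0⦌) →ₗ[ℝ] Cochain V m K}
    {T : Y.obj (op ⦋0⦌) →ₗ[ℝ] Cochain V m' K'} (hS : Detects S) (hT : Detects T)
    (hi : ∀ f, IsCycle f → IsCobd (T ((φ.app (op ⦋0⦌)).hom f)) → IsCobd (S f))
    (hs : ∀ g : Y.obj (op ⦋0⦌), IsCycle g →
      ∃ f, IsCycle f ∧ IsCobd (T ((φ.app (op ⦋0⦌)).hom f - g))) :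
    Function.Bijective (SSet.mapπ₀ (toSSetMap (toPSSet.map φ))) := by
  constructor
  · intro c c' h
    obtain ⟨(x : X.obj (op ⦋0⦌)), rfl⟩ := SSet.π₀.mk_surjective c
    obtain ⟨(y : X.obj (op ⦋0⦌)), rfl⟩ := SSet.π₀.mk_surjective c'
    refine (hS.component_eq_iff x y).2 (hi _ (isCycle_zero_dim _) ?_)
    refine (congrArg (fun w => IsCobd (T w)) (map_sub (φ.app (op ⦋0⦌)).hom x y)).mpr ?_
    exact (hT.component_eq_iff _ _).1 h
  · intro c
    obtain ⟨y, rfl⟩ := SSet.π₀.mk_surjective c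
    obtain ⟨x, -, h⟩ := hs y (isCycle_zero_dim _)
    exact ⟨SSet.π₀.mk (X := under X) x, (hT.component_eq_iff _ _).2 h⟩

/-- Detection is invariant under isomorphisms of simplicial vector spaces. -/
lemma Detects.of_iso (e : X ≅ Y) {T : Y.obj (op ⦋k⦌) →ₗ[ℝ] Cochain V m K} (hT : Detects T) :
    Detects (T ∘ₗ (e.hom.app (op ⦋k⦌)).hom) := by
  have hc : ∀ {X Y : SimplicialObject (ModuleCat.{u} ℝ)} (φ : X ⟶ Y) {f : X.obj (op ⦋k⦌)},
      IsCycle f → IsCycle ((φ.app (op ⦋k⦌)).hom f) := fun φ f hf _ θ hθ => by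
    rw [← app_act, hf θ hθ, map_zero]
  have hl : ∀ {j : ℕ} (f : X.obj (op ⦋j⦌)),
      (e.inv.app (op ⦋j⦌)).hom ((e.hom.app (op ⦋j⦌)).hom f) = f := fun {j} f =>
    LinearMap.congr_fun (congrArg ModuleCat.Hom.hom (e.hom_inv_id_app (op ⦋j⦌))) f
  have hr : ∀ {j : ℕ} (f : Y.obj (op ⦋j⦌)),
      (e.hom.app (op ⦋j⦌)).hom ((e.inv.app (op ⦋j⦌)).hom f) = f := fun {j} f =>
    LinearMap.congr_fun (congrArg ModuleCat.Hom.hom (e.inv_hom_id_app (op ⦋j⦌))) f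
  refine ⟨fun f hf => hT.mem _ (hc e.hom hf), fun h => ?_, fun f hf hb => ?_, fun y hy => ?_⟩
  · have := hT.isCobd_altFace ((e.hom.app (op ⦋k + 1⦌)).hom h)
    rw [LinearMap.comp_apply, map_sum]
    convert this using 2
    refine Finset.sum_congr rfl fun a _ => ?_
    rw [map_zsmul, app_act]
  · obtain ⟨h, h₀, h₁⟩ := hT.exists_face _ (hc e.hom hf) hb
    refine ⟨(e.inv.app (op ⦋k + 1⦌)).hom h, ?_, fun j => ?_⟩
    · rw [← app_act, h₀, hl]
    · rw [← app_act, h₁, map_zero]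
  · obtain ⟨f, hf, hb⟩ := hT.exists_preimage y hy
    refine ⟨(e.inv.app (op ⦋k⦌)).hom f, hc e.inv hf, ?_⟩
    rw [LinearMap.comp_apply, hr]
    exact hb

end

/-! ### The costructure map on homotopy groups -/

section

variable {V : ℤ → Type u} [∀ j, AddCommGroup (V j)] [∀ j, Module ℝ (V j)]

/-- The cochain underlying a simplex of `Z^n(K ∧ Δ^•_+)`. -/
noncomputable def cochainOf (n : ℤ) (K : PSSet.{u}) (k : ℕ) :
    (cocycleSpace V n K).obj (op ⦋k⦌) →ₗ[ℝ] Cochain V n (smash K (simplexPlus.obj ⦋k⦌)) :=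
  (cocycles V n (smash K (simplexPlus.obj ⦋k⦌))).subtype

lemma cochainOf_mem {n : ℤ} {K : PSSet.{u}} {k : ℕ} (f : (cocycleSpace V n K).obj (op ⦋k⦌)) :
    cochainOf n K k f ∈ cocycles V n (smash K (simplexPlus.obj ⦋k⦌)) := f.2

lemma cochainOf_injective {n : ℤ} {K : PSSet.{u}} {k : ℕ} :
    Function.Injective (cochainOf (V := V) n K k) := Subtype.val_injective

lemma cochainOf_surjective {n : ℤ} {K : PSSet.{u}} {k : ℕ}
    {u : Cochain V n (smash K (simplexPlus.obj ⦋k⦌))} (hu : u ∈ cocycles V n _) :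
    ∃ f, cochainOf n K k f = u := ⟨⟨u, hu⟩, rfl⟩

lemma cochainOf_act {n : ℤ} {K : PSSet.{u}} {l k : ℕ} (θ : ⦋l⦌ ⟶ ⦋k⦌)
    (f : (cocycleSpace V n K).obj (op ⦋k⦌)) :
    cochainOf n K l (act _ θ f) = operator θ (cochainOf n K k f) := rfl

lemma isCycle_iff {n : ℤ} {K : PSSet.{u}} {k : ℕ} (f : (cocycleSpace V n K).obj (op ⦋k⦌)) :
    IsCycle f ↔ VanishesOnBoundary (cochainOf n K k f) := by
  refine forall_congr' fun l => forall_congr' fun θ => imp_congr_right fun _ => ?_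
  rw [← cochainOf_act, map_eq_zero_iff _ cochainOf_injective]

variable {ε : ℤ} {S : ∀ (k : ℕ) {m n : ℤ} (_ : m + k = n) (K : PSSet.{u}),
    Cochain V n (smash K (simplexPlus.obj ⦋k⦌)) →ₗ[ℝ] Cochain V m K}

/-- Slant products with `[Δ^k_+]` identify `π_k(Z^n(K ∧ Δ^•_+))` with `H^{n-k}(K)`. -/
lemma IsSimplexSlant.detects (hS : IsSimplexSlant ε S) (k : ℕ) {m n : ℤ} (h : m + (k : ℕ) = n)
    (K : PSSet.{u}) : Detects (S k h K ∘ₗ cochainOf n K k) where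
  mem f hf := hS.mem k h (cochainOf_mem f) ((isCycle_iff f).1 hf)
  isCobd_altFace g := by
    have := hS.isCobd_altFace h (cochainOf_mem g)
    rw [altFace] at this
    rw [LinearMap.comp_apply, map_sum]
    simpa only [map_zsmul, cochainOf_act] using this
  exists_face f hf hc := by
    obtain ⟨g, hg, h₀, h₁⟩ := hS.exists_cobd k h (cochainOf_mem f) ((isCycle_iff f).1 hf) hc
    obtain ⟨g, rfl⟩ := cochainOf_surjective hg
    exact ⟨g, cochainOf_injective h₀, fun j => cochainOf_injective ((h₁ j).trans (map_zero _).symm)⟩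
  exists_preimage y hy := by
    obtain ⟨f, hf, hb, hc⟩ := hS.exists_preimage k h hy
    obtain ⟨f, rfl⟩ := cochainOf_surjective hf
    exact ⟨f, (isCycle_iff f).2 hb, hc⟩

/-- The isomorphism `(K ∧ S^1) ∧ Δ^k_+ ≅ (K ∧ Δ^k_+) ∧ S^1`. -/
noncomputable def cylindersSuspend (K : PSSet.{u}) : cylinders (smash K circle) ≅ cylinders K ⋙ suspend :=
  NatIso.ofComponents
    (fun k => ⟨smashSwapRight K circle (simplexPlus.obj k),
      smashSwapRight K (simplexPlus.obj k) circle, smashSwapRight_smashSwapRight _ _ _,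
      smashSwapRight_smashSwapRight _ _ _⟩)
    fun _ => SimplicialObject.hom_ext _ _ fun _ => Pointed.Hom.ext (funext
      (smash_ind (smash_ind fun _ _ _ => rfl)))

/-- The isomorphism `Z^n(K ∧ Δ^•_+ ∧ S^1) ≅ Z^n((K ∧ S^1) ∧ Δ^•_+)`. -/
noncomputable def suspIso (V : ℤ → Type u) [∀ j, AddCommGroup (V j)] [∀ j, Module ℝ (V j)]
    (n : ℤ) (K : PSSet.{u}) : suspCocycleSpace V n K ≅ cocycleSpace V n (smash K circle) :=
  Functor.isoWhiskerRight (NatIso.op (cylindersSuspend K)) (cocyclesFunctor V n)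

/-- The slant product with `[Δ^k_+]` on `Z^n(K ∧ Δ^•_+ ∧ S^1)`. -/
noncomputable def suspSlant (S : ∀ (k : ℕ) {m n : ℤ} (_ : m + k = n) (K : PSSet.{u}),
    Cochain V n (smash K (simplexPlus.obj ⦋k⦌)) →ₗ[ℝ] Cochain V m K) (k : ℕ) {m n : ℤ}
    (h : m + (k : ℕ) = n) (K : PSSet.{u}) :
    (suspCocycleSpace V n K).obj (op ⦋k⦌) →ₗ[ℝ] Cochain V m (smash K circle) :=
  (S k h (smash K circle) ∘ₗ cochainOf n (smash K circle) k) ∘ₗ ((suspIso V n K).hom.app _).hom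

lemma desuspend_suspIso {n n' : ℤ} (h : n' + (1 : ℕ) = n) {K : PSSet.{u}} {k : ℕ}
    (f : (suspCocycleSpace V n K).obj (op ⦋k⦌)) :
    desuspend h K k (cochainOf n _ k (((suspIso V n K).hom.app _).hom f)) =
      slant circleChain h (Subtype.val (p := (· ∈ cocycles V n _)) f) := by
  have e : pull (smashSwapRight K (simplexPlus.obj ⦋k⦌) circle)
      (cochainOf n _ k (((suspIso V n K).hom.app _).hom f)) =
        Subtype.val (p := (· ∈ cocycles V n _)) f := by
    refine (pull_pull (smashSwapRight K (simplexPlus.obj ⦋k⦌) circle)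
      (smashSwapRight K circle (simplexPlus.obj ⦋k⦌)) _).trans ?_
    exact (congrArg (fun φ => pull φ _) (smashSwapRight_smashSwapRight _ _ _)).trans (pull_id _)
  exact congrArg (slant circleChain h) e

/-- The comparison of `IsSimplexSlant.isCobd_desuspend`, for the costructure map. -/
lemma IsSimplexSlant.isCobd_psiLin (hS : IsSimplexSlant ε S) (k : ℕ) {l m n : ℤ}
    (h : m + (k : ℕ) = n) (h₂ : l + (k : ℕ) = n - 1) (h₃ : l + (1 : ℕ) = m)
    {K : PSSet.{u}} {f : (suspCocycleSpace V n K).obj (op ⦋k⦌)} (hf : IsCycle f) :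
    IsCobd (S k h₂ K (cochainOf (n - 1) K k (((psiLin V n K).app _).hom f)) -
      ε ^ k • slant circleChain h₃ (suspSlant S k h K f)) := by
  have hc : IsCycle (((suspIso V n K).hom.app (op ⦋k⦌)).hom f) := fun θ hθ => by
    rw [← app_act, hf θ hθ, map_zero]
  have := hS.isCobd_desuspend k h (by push_cast; omega : n - 1 + (1 : ℕ) = n) h₂ h₃
    (cochainOf_mem _) ((isCycle_iff _).1 hc)
  rw [desuspend_suspIso] at this
  exact this

lemma pow_mul_self_of_mul_self {ε : ℤ} (hε : ε * ε = 1) (k : ℕ) : ε ^ k * ε ^ k = 1 := by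
  rw [← mul_pow, hε, one_pow]

/-- The costructure map is injective on `π_k`, expressed through the detecting cohomology. -/
lemma IsSimplexSlant.psiLin_injective (hS : IsSimplexSlant ε S) (k : ℕ) {l m n : ℤ}
    (h : m + (k : ℕ) = n) (h₂ : l + (k : ℕ) = n - 1) {K : PSSet.{u}}
    (f : (suspCocycleSpace V n K).obj (op ⦋k⦌)) (hf : IsCycle f)
    (hc : IsCobd ((S k h₂ K ∘ₗ cochainOf (n - 1) K k) (((psiLin V n K).app _).hom f))) :
    IsCobd (suspSlant S k h K f) := by
  have h₃ : l + (1 : ℕ) = m := by push_cast; omega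
  refine isCobd_of_isCobd_slantCircle h₃ (((hS.detects k h _).of_iso (suspIso V n K)).mem f hf) ?_
  have := (hc.sub (hS.isCobd_psiLin k h h₂ h₃ hf)).zsmul (ε ^ k)
  rw [LinearMap.comp_apply, sub_sub_cancel, smul_smul, pow_mul_self_of_mul_self hS.mul_self,
    one_smul] at this
  exact this

/-- The costructure map is surjective on `π_k`, expressed through the detecting cohomology. -/
lemma IsSimplexSlant.psiLin_surjective (hS : IsSimplexSlant ε S) (k : ℕ) {l n : ℤ}
    (h₂ : l + (k : ℕ) = n - 1) {K : PSSet.{u}}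
    (g : (cocycleSpace V (n - 1) K).obj (op ⦋k⦌)) (hg : IsCycle g) :
    ∃ f : (suspCocycleSpace V n K).obj (op ⦋k⦌), IsCycle f ∧
      IsCobd ((S k h₂ K ∘ₗ cochainOf (n - 1) K k) (((psiLin V n K).app _).hom f - g)) := by
  have h : l + 1 + (k : ℕ) = n := by omega
  have h₃ : l + (1 : ℕ) = l + 1 := by push_cast; rfl
  obtain ⟨u, hu, h₄⟩ := exists_slantCircle h₃
    (zsmul_mem ((hS.detects k h₂ K).mem g hg) (ε ^ k))
  obtain ⟨f, hf, h₅⟩ := ((hS.detects k h _).of_iso (suspIso V n K)).exists_preimage u hu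
  refine ⟨f, hf, ?_⟩
  have e₁ := hS.isCobd_psiLin k h h₂ h₃ hf
  have e₂ := ((h₅.slantCircle h₃).add h₄).zsmul (ε ^ k)
  rw [map_sub, sub_add_sub_cancel, smul_sub, smul_smul, pow_mul_self_of_mul_self hS.mul_self,
    one_smul] at e₂
  have e₃ := e₁.add e₂
  rw [map_sub]
  rw [suspSlant, sub_add_sub_cancel] at e₃
  exact e₃

/-- The slant products with `[Δ^k_+]` carry the costructure map on `π_k` to `ε^k` times the
suspension isomorphism. -/
lemma IsSimplexSlant.exists_isos (hS : IsSimplexSlant ε S) (k : ℕ) {m n : ℤ}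
    (h : m + (k : ℕ) = n) (h₂ : m - 1 + (k : ℕ) = n - 1) (K : PSSet.{u}) :
    ∃ (A : PiVect k (suspCocycleSpace V n K) → Coh V m (smash K circle))
      (B : PiVect k (cocycleSpace V (n - 1) K) → Coh V (m - 1) K),
      IsIsoInducedBy (suspSlant S k h K) A ∧
      IsIsoInducedBy (S k h₂ K ∘ₗ cochainOf (n - 1) K k) B ∧
      ∀ c, B (piVectMap k (psiLin V n K) c) = ε ^ k • suspension V K m (A c) := by
  obtain ⟨A, hA⟩ := ((hS.detects k h _).of_iso (suspIso V n K)).exists_iso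
  obtain ⟨B, hB⟩ := (hS.detects k h₂ K).exists_iso
  refine ⟨A, B, hA, hB, fun c => ?_⟩
  obtain ⟨f, rfl⟩ := c.eq_homotopyClass
  obtain ⟨hf, ef⟩ := hA.apply_class f
  obtain ⟨hg, eg⟩ := hB.apply_class (SSet.RelativeMorphism.comp f
    (SSet.RelativeMorphism.ofSimplex₀ (toSSetMap (toPSSet.map (psiLin V n K))) _ _
      (map_zero ((psiLin V n K).app (op ⦋0⦌)).hom)) rfl)
  rw [ef]
  refine eg.trans ?_
  rw [suspension_coh]
  exact (coh_eq_iff hg (zsmul_mem (slant_circle_mem _ _ hf) (ε ^ k))).2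
    (hS.isCobd_psiLin k h h₂ (by push_cast; omega) (isCycle_ptVal f))

/-! ### The costructure map as a weak equivalence -/

lemma piAtMap_comp (k : ℕ) {X Y Z : SSet.{u}} (f : X ⟶ Y) (g : Y ⟶ Z) (x : X _⦋0⦌) (y : Y _⦋0⦌)
    (z : Z _⦋0⦌) (hf : f.app _ x = y) (hg : g.app _ y = z) (h : (f ≫ g).app _ x = z)
    (c : PiAt k X x) : piAtMap k (f ≫ g) x z h c = piAtMap k g y z hg (piAtMap k f x y hf c) := by
  obtain ⟨f, rfl⟩ := c.eq_homotopyClass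
  rfl

lemma piAtMap_id (k : ℕ) {X : SSet.{u}} (x : X _⦋0⦌) (h : (𝟙 X : X ⟶ X).app _ x = x)
    (c : PiAt k X x) : piAtMap k (𝟙 X) x x h c = c := by
  obtain ⟨f, rfl⟩ := c.eq_homotopyClass
  rfl

lemma bijective_piAtMap_iso (k : ℕ) {X Y : SSet.{u}} (e : X ≅ Y) (x : X _⦋0⦌) (y : Y _⦋0⦌)
    (h : e.hom.app _ x = y) : Function.Bijective (piAtMap k e.hom x y h) := by
  have h' : e.inv.app _ y = x := by
    rw [← h]
    exact ConcreteCategory.congr_hom (congrArg (fun φ => NatTrans.app φ (op ⦋0⦌)) e.hom_inv_id) x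
  refine Function.bijective_iff_has_inverse.2 ⟨piAtMap k e.inv y x h', fun c => ?_, fun c => ?_⟩
  · rw [← piAtMap_comp k e.hom e.inv x y x h h'
      (ConcreteCategory.congr_hom (congrArg (fun φ => NatTrans.app φ (op ⦋0⦌)) e.hom_inv_id) x)]
    have : ∀ (φ : X ⟶ X) (hφ : φ = 𝟙 X) (hx : φ.app _ x = x), piAtMap k φ x x hx c = c := by
      rintro _ rfl hx
      exact piAtMap_id k x hx c
    exact this _ e.hom_inv_id _
  · rw [← piAtMap_comp k e.inv e.hom y x y h' h
      (ConcreteCategory.congr_hom (congrArg (fun φ => NatTrans.app φ (op ⦋0⦌)) e.inv_hom_id) y)]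
    have : ∀ (φ : Y ⟶ Y) (hφ : φ = 𝟙 Y) (hy : φ.app _ y = y), piAtMap k φ y y hy c = c := by
      rintro _ rfl hy
      exact piAtMap_id k y hy c
    exact this _ e.inv_hom_id _

lemma bijective_mapπ₀_iso {X Y : SSet.{u}} (e : X ≅ Y) :
    Function.Bijective (SSet.mapπ₀ e.hom) := by
  refine Function.bijective_iff_has_inverse.2 ⟨SSet.mapπ₀ e.inv, fun c => ?_, fun c => ?_⟩
  · rw [← SSet.mapπ₀_comp_apply, e.hom_inv_id, SSet.mapπ₀_id_apply]
  · rw [← SSet.mapπ₀_comp_apply, e.inv_hom_id, SSet.mapπ₀_id_apply]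

/-- The isomorphism of simplicial sets underlying `loopIso`. -/
noncomputable def loopIsoSSet (V : ℤ → Type u) [∀ j, AddCommGroup (V j)] [∀ j, Module ℝ (V j)]
    (n : ℤ) (K : PSSet.{u}) :
    toSSet (loop.obj (toPSSet.obj (cocycleSpace V n K))) ≅ under (suspCocycleSpace V n K) where
  hom := toSSetMap (loopIso V n K).hom
  inv := toSSetMap (loopIso V n K).inv
  hom_inv_id := congrArg toSSetMap (loopIso V n K).hom_inv_id
  inv_hom_id := congrArg toSSetMap (loopIso V n K).inv_hom_id

lemma kanComplex_of_iso {X Y : SSet.{u}} (e : X ≅ Y) (hY : SSet.KanComplex Y) :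
    SSet.KanComplex X := by
  rw [SSet.KanComplex.iff] at hY ⊢
  intro n i f hf
  obtain ⟨φ, hφ⟩ := hY (fun j hj => f j hj ≫ e.hom) (by
    cases n with
    | zero => trivial
    | succ n =>
      intro j k hj hk hjk
      rw [← Category.assoc, ← Category.assoc, hf j k hj hk hjk])
  refine ⟨φ ≫ e.inv, fun j hj => ?_⟩
  rw [← Category.assoc, hφ, Category.assoc, e.hom_inv_id, Category.comp_id]

lemma isKanWeakEquivalence_psi (V : ℤ → Type u) [∀ j, AddCommGroup (V j)] [∀ j, Module ℝ (V j)]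
    (n : ℤ) (K : PSSet.{u}) : IsKanWeakEquivalence (toSSetMap (psi V n K)) := by
  have hc : toSSetMap (psi V n K) =
      (loopIsoSSet V n K).hom ≫ toSSetMap (toPSSet.map (psiLin V n K)) := rfl
  have hS := isSimplexSlant_slant (V := V)
  refine ⟨kanComplex_of_iso (loopIsoSSet V n K) (kanComplex_under _), kanComplex_under _, ?_, ?_⟩
  · rw [hc]
    have hψ := bijective_mapπ₀ (psiLin V n K)
      ((hS.detects 0 (by simp : n + (0 : ℕ) = n) _).of_iso (suspIso V n K))
      (hS.detects 0 (by simp : n - 1 + (0 : ℕ) = n - 1) K)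
      (hS.psiLin_injective 0 _ _) (hS.psiLin_surjective 0 _)
    exact (congrArg Function.Bijective (funext fun c => SSet.mapπ₀_comp_apply _ _ c)).mpr
      (hψ.comp (bijective_mapπ₀_iso (loopIsoSSet V n K)))
  · intro k x
    let y : (suspCocycleSpace V n K).obj (op ⦋0⦌) := (loopIsoSSet V n K).hom.app _ x
    have hψ := bijective_piAtMap (psiLin V n K)
      ((hS.detects (k + 1) (by omega : n - (k + 1 : ℕ) + (k + 1 : ℕ) = n) _).of_iso
        (suspIso V n K))
      (hS.detects (k + 1) (by omega : n - 1 - (k + 1 : ℕ) + (k + 1 : ℕ) = n - 1) K)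
      (hS.psiLin_injective (k + 1) _ _) (hS.psiLin_surjective (k + 1) _) y
    exact (congrArg Function.Bijective (funext fun c =>
      piAtMap_comp (k + 1) (loopIsoSSet V n K).hom _ x y _ rfl rfl rfl c)).mpr
      (hψ.comp (bijective_piAtMap_iso (k + 1) (loopIsoSSet V n K) x y rfl))

/-! ### Naturality of the costructure map -/

lemma psi_natural (V : ℤ → Type u) [∀ j, AddCommGroup (V j)] [∀ j, Module ℝ (V j)]
    (n : ℤ) {K K' : PSSet.{u}} (φ : K ⟶ K') :
    loop.map (toPSSet.map (cocycleSpaceMap V n φ)) ≫ psi V n K =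
      psi V n K' ≫ toPSSet.map (cocycleSpaceMap V (n - 1) φ) := by
  refine SimplicialObject.hom_ext _ _ fun k => Pointed.Hom.ext (funext fun F => ?_)
  change slantCircle (smash K (simplexPlus.obj k.unop)) _
      (cocyclesPull (smashAssocInv K _ circle)
        (uncurry (F ≫ toPSSet.map (cocycleSpaceMap V n φ)))) =
    cocyclesPull (smashMap φ (𝟙 (simplexPlus.obj k.unop)))
      (slantCircle (smash K' (simplexPlus.obj k.unop)) _
        (cocyclesPull (smashAssocInv K' _ circle) (uncurry F)))
  rw [slantCircle_natural]
  refine congrArg _ (Subtype.ext (cochain_ext fun p => smash_ind (smash_ind fun x a t => ?_)))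
  rw [cocyclesPull_gen, cocyclesPull_gen, cocyclesPull_gen]
  refine (uncurryCochain_gen _ p _ _).trans (Eq.trans ?_ (uncurryCochain_gen F p _ _).symm)
  exact cocyclesPull_gen (smashMap φ (𝟙 _)) (valAt F (smk a t)) p _

end

section

variable {V : ℤ → Type u} [∀ j, AddCommGroup (V j)] [∀ j, Module ℝ (V j)]

/-- The two ways to move the factor `Δ^k_+` of `(K ∧ Δ^k_+) ∧ S^1` to the front agree. -/
lemma suspSlant_slantFront (k : ℕ) {m n : ℤ} (h : m + (k : ℕ) = n) (K : PSSet.{u}) :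
    suspSlant (V := V) (fun k {_ _} h K =>
      slantFront (simplexChain k) h ∘ₗ pull (smashSwap (simplexPlus.obj ⦋k⦌) K)) k h K =
      (slantSimplexSuspFront k h K : (suspCocycleSpace V n K).obj (op ⦋k⦌) → _) := by
  refine funext fun f => congrArg (slantFront (simplexChain k) h) ?_
  refine cochain_ext fun p => smash_ind fun a => smash_ind fun x t => ?_
  refine (pull_gen _ _ p _).trans (Eq.trans ?_ (pull_gen _ _ p _).symm)
  exact pull_gen (smashSwapRight K circle (simplexPlus.obj ⦋k⦌)) _ p _

end

end CocycleSpectrum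

theorem mainTheorem6 (V : ℤ → Type u) [∀ j, AddCommGroup (V j)] [∀ j, Module ℝ (V j)] (n : ℤ) :
    (∀ (K K' : CocycleSpectrum.PSSet.{u}) (φ : K ⟶ K'),
      CocycleSpectrum.loop.map (CocycleSpectrum.toPSSet.map
          (CocycleSpectrum.cocycleSpaceMap V n φ)) ≫ CocycleSpectrum.psi V n K =
        CocycleSpectrum.psi V n K' ≫
          CocycleSpectrum.toPSSet.map (CocycleSpectrum.cocycleSpaceMap V (n - 1) φ)) ∧
    ∀ K : CocycleSpectrum.PSSet.{u},
      CocycleSpectrum.IsKanWeakEquivalence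
        (CocycleSpectrum.toSSetMap (CocycleSpectrum.psi V n K)) ∧
      (∀ m : ℤ, Function.Bijective (CocycleSpectrum.suspension V K m) ∧
        ∀ x y, CocycleSpectrum.suspension V K m x = y ↔ CocycleSpectrum.IsSuspensionOf x y) ∧
      ∀ k : ℕ,
        (∃ (A : CocycleSpectrum.PiVect k (CocycleSpectrum.suspCocycleSpace V n K) →
              CocycleSpectrum.Coh V (n - k) (CocycleSpectrum.smash K CocycleSpectrum.circle))
            (B : CocycleSpectrum.PiVect k (CocycleSpectrum.cocycleSpace V (n - 1) K) →
              CocycleSpectrum.Coh V (n - k - 1) K),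
          CocycleSpectrum.IsIsoInducedBy
            (CocycleSpectrum.slantSimplexSusp k (by omega) K) A ∧
          CocycleSpectrum.IsIsoInducedBy
            (CocycleSpectrum.slantSimplex k (by omega) K) B ∧
          ∀ c, B (CocycleSpectrum.piVectMap k (CocycleSpectrum.psiLin V n K) c) =
            (-1 : ℤ) ^ k • CocycleSpectrum.suspension V K (n - k) (A c)) ∧
        (∃ (A : CocycleSpectrum.PiVect k (CocycleSpectrum.suspCocycleSpace V n K) →
              CocycleSpectrum.Coh V (n - k) (CocycleSpectrum.smash K CocycleSpectrum.circle))
            (B : CocycleSpectrum.PiVect k (CocycleSpectrum.cocycleSpace V (n - 1) K) →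
              CocycleSpectrum.Coh V (n - k - 1) K),
          CocycleSpectrum.IsIsoInducedBy
            (CocycleSpectrum.slantSimplexSuspFront k (by omega) K) A ∧
          CocycleSpectrum.IsIsoInducedBy
            (CocycleSpectrum.slantSimplexFront k (by omega) K) B ∧
          ∀ c, B (CocycleSpectrum.piVectMap k (CocycleSpectrum.psiLin V n K) c) =
            CocycleSpectrum.suspension V K (n - k) (A c)) := by
  refine ⟨fun K K' φ => CocycleSpectrum.psi_natural V n φ, fun K =>
    ⟨CocycleSpectrum.isKanWeakEquivalence_psi V n K,
      fun m => ⟨CocycleSpectrum.suspension_bijective K m,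
        fun x y => CocycleSpectrum.suspension_eq_iff x y⟩, fun k => ⟨?_, ?_⟩⟩⟩
  · exact CocycleSpectrum.isSimplexSlant_slant.exists_isos k (m := n - k) (by omega) (by omega) K
  · obtain ⟨A, B, hA, hB, h⟩ := CocycleSpectrum.isSimplexSlant_slantFront.exists_isos (V := V) k
      (m := n - k) (n := n) (by omega) (by omega) K
    rw [CocycleSpectrum.suspSlant_slantFront] at hA
    exact ⟨A, B, hA, hB, fun c => (h c).trans (by rw [one_pow, one_smul])⟩
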